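/- **Operators.** Let $\mathsf{Un}=\{\neg,\mathbf X,\mathbf F,\mathbf G\}$, $\mathsf{Bin}_{tp}=\{\mathbf U,\mathbf R,\mathbf W,\mathbf M\}$ (until, release, weak until, mighty release), and let $\mathsf{Bin}_{lg}$ consist of $\lor,\land,\Rightarrow,\Leftarrow,\Leftrightarrow$ and their five negations. On a sequence of positions $0,1,\dots$, with $\varphi$ and $\psi$ evaluated at each position: $\mathbf X\varphi$ means that $\varphi$ holds at position $1$; $\mathbf F\varphi$ that it holds at some position; $\mathbf G\varphi$ that it holds at every position; $\varphi\,\mathbf U\,\psi$ that $\psi$ holds at some position $i$ and $\varphi$ at all positions $j<i$; $\varphi\,\mathbf R\,\psi=\neg(\neg\varphi\,\mathbf U\,\neg\psi)$; $\varphi\,\mathbf W\,\psi=(\varphi\,\mathbf U\,\psi)\lor\mathbf G\varphi$; $\varphi\,\mathbf M\,\psi=(\varphi\,\mathbf R\,\psi)\land\mathbf F\varphi$. Let $\mathsf U^t\subseteq\mathsf{Un}$, $\mathsf B^t\subseteq\mathsf{Bin}_{tp}$, $\mathsf B^l\subseteq\mathsf{Bin}_{lg}$. **Formulas.** Over a non-empty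 finite set $\mathsf{Prop}$ of propositions, the LTL formulas of the fragment $(\mathsf U^t,\mathsf B^t,\mathsf B^l)$ are built from propositions with the operators in $\mathsf U^t\cup\mathsf B^t\cup\mathsf B^l$. For $k\ge 1$, the $\mathrm{ATL}^k$ (state) formulas of the fragment are $\phi ::= p \mid \neg\phi \mid \phi * \phi \mid \langle\!\langle A\rangle\!\rangle(*_1\phi)\mid\langle\!\langle A\rangle\!\rangle(\phi *_2\phi)$ with $p\in\mathsf{Prop}$, negation allowed only if $\neg\in\mathsf U^t$, $*\in\mathsf B^l$, $*_1\in\mathsf U^t\setminus\{\neg\}$, $*_2\in\mathsf B^t$ and $A\subseteq\{1,\dots,k\}$. CTL formulas are $\mathrm{ATL}^1$ formulas, $\langle\!\langle\emptyset\rangle\!\rangle$ being read as $\forall$ and $\langle\!\langle\{1\}\rangle\!\rangle$ as $\exists$. The size $|\varphi|$ is the number of distinct sub-formulas of $\varphi$ (for ATL and CTL: state sub-formulas), and $|\varphi|_{\mathsf{Bin}}$ is the number of those whose outermost logical or temporal operator (below the quantifier $\langle\!\langle A\rangle\!\rangle$, if there is one) is binary. **Models.** - LTL: ultimately periodic words $u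 v^\omega$, given by finite words $u,v$ over $2^{\mathsf{Prop}}$ with $v$ non-empty, of size $|u|+|v|$, with the usual LTL semantics. - $\mathrm{ATL}^k$: concurrent game structures with finite state set $Q$, initial states $I\subseteq Q$, labels $\pi:Q\to2^{\mathsf{Prop}}$, agents $1,\dots,k$, $d(q,a)\ge1$ actions for agent $a$ at state $q$, and a transition function $\delta$ that maps a state and one available action per agent to a state. The size is the number of pairs of a state and a joint action available there, plus $|\mathsf{Prop}|$. The formula $\langle\!\langle A\rangle\!\rangle\psi$ holds at $q$ iff the agents of $A$ have strategies, depending on the history of visited states, such that all compatible infinite paths from $q$ satisfy $\psi$. A structure satisfies $\phi$ iff $\phi$ holds at all its initial states. - CTL: Kripke structures, with finite $Q$, $I$, $\pi$ as above and a non-empty set $\mathrm{Succ}(q)\subseteq Q$ for every state $q$. The size is $\sum_{q}|\mathrm{Succ}(q)|+|\mathsf{Prop}|$; $\forall\psi$ and $\exists\psi$ quantify over the infinite paths from a state, and satisfaction again means at all initial states. **Learning problem.** For $L\in\{\mathrm{LTL},\mathrm{CTL},\mathrm{ATL}^k\mid k\ge1\}$ and $n\in\mathbb N\cup\{\infty\}$,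 the problem $L_{\mathsf{Learn}}(\mathsf U^t,\mathsf B^t,\mathsf B^l,n)$ is: given a non-empty finite set $\mathsf{Prop}$, finite collections $\mathcal P,\mathcal N$ of models for $L$ over $\mathsf{Prop}$, and $B\in\mathbb N$, decide whether there is an $L$-formula $\varphi$ over $\mathsf{Prop}$ in the fragment $(\mathsf U^t,\mathsf B^t,\mathsf B^l)$ with $|\varphi|\le B$ and $|\varphi|_{\mathsf{Bin}}\le n$ that is satisfied by every model in $\mathcal P$ and by no model in $\mathcal N$. The size of the input is $|\mathsf{Prop}|+\sum_{X\in\mathcal P}|X|+\sum_{X\in\mathcal N}|X|+B$ (so $B$ counts as written in unary). **Proposition.** For all $\mathsf U^t\subseteq\mathsf{Un}$, $\mathsf B^t\subseteq\mathsf{Bin}_{tp}$, $\mathsf B^l\subseteq\mathsf{Bin}_{lg}$ and $n\in\mathbb N\cup\{\infty\}$, the decision problems $\mathrm{LTL}_{\mathsf{Learn}}(\mathsf U^t,\mathsf B^t,\mathsf B^l,n)$, $\mathrm{CTL}_{\mathsf{Learn}}(\mathsf U^t,\mathsf B^t,\mathsf B^l,n)$ and, for every $k\ge1$, $\mathrm{ATL}^k_{\mathsf{Learn}}(\mathsf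 U^t,\mathsf B^t,\mathsf B^l,n)$ are in $\mathsf{NP}$. That is, the inputs have a string encoding of length polynomial in their size, for which a verifier running in polynomial time on a Turing machine accepts an input together with some certificate of polynomial length if and only if the input is positive. -/

import Mathlib

open Computability

namespace TemporalLearning

/-! ### Decision problems and the class NP -/

/-- A decision problem: its inputs, the size of an input, a string encoding of the inputs over a
fixed finite alphabet, and the set of positive inputs. -/
structure DecisionProblem where
  Input : Type
  size : Input → ℕ
  encode : Input → List Γ'
  yes : Set Input

/-- A pair of an input and a certificate, written as one string over the disjoint union of the two
alphabets. -/
def DecisionProblem.encodePair (D : DecisionProblem) {Δ : Type} (x : D.Input × List Δ) :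
    List (Γ' ⊕ Δ) :=
  (D.encode x.1).map Sum.inl ++ x.2.map Sum.inr

/-- Membership in NP: the encoding of the inputs has length polynomial in their size, and there is a
verifier, computed by a polynomial-time Turing machine, such that an input is positive if and only
if the verifier accepts it together with some certificate of polynomial length. -/
def DecisionProblem.InNP (D : DecisionProblem) : Prop :=
  (∃ q : Polynomial ℕ, ∀ x, (D.encode x).length ≤ q.eval (D.size x)) ∧
  ∃ (Δ : Type) (_ : Fintype Δ) (p : Polynomial ℕ) (V : D.Input × List Δ → Bool),
    Nonempty (Turing.TM2ComputableInPolyTime D.encodePair encodeBool V) ∧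
    ∀ x, x ∈ D.yes ↔ ∃ c : List Δ, c.length ≤ p.eval (D.encode x).length ∧ V (x, c) = true

/-! ### Operators -/

/-- Unary temporal operators: next, future, globally. -/
inductive UnTp
  | X | F | G
  deriving DecidableEq

/-- Unary operators: negation and the unary temporal operators. -/
inductive UnOp
  | neg
  | tp (o : UnTp)
  deriving DecidableEq

/-- Binary temporal operators: until, release, weak until, mighty release. -/
inductive BinTp
  | U | R | W | M
  deriving DecidableEq

/-- Binary logical operators and their negations; `impl` is `⇒` and `conv` is `⇐`. -/
inductive BinLg
  | or | and | impl | conv | iff | nor | nand | nimpl | nconv | niff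
  deriving DecidableEq

/-- The truth value of a unary temporal operator at the start of a sequence, where `f i` says that
the operand holds at position `i` (positions start at `0`). -/
def UnTp.eval : UnTp → (ℕ → Prop) → Prop
  | .X, f => f 1
  | .F, f => ∃ i, f i
  | .G, f => ∀ i, f i

/-- The truth value of a unary operator at the start of a sequence. -/
def UnOp.eval : UnOp → (ℕ → Prop) → Prop
  | .neg, f => ¬ f 0
  | .tp o, f => o.eval f

/-- `f` until `g`. -/
def untilSem (f g : ℕ → Prop) : Prop := ∃ i, g i ∧ ∀ j < i, f j

/-- `f` releases `g`, the dual of until. -/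
def releaseSem (f g : ℕ → Prop) : Prop := ¬ untilSem (fun i => ¬ f i) (fun i => ¬ g i)

/-- The truth value of a binary temporal operator at the start of a sequence. -/
def BinTp.eval : BinTp → (ℕ → Prop) → (ℕ → Prop) → Prop
  | .U, f, g => untilSem f g
  | .R, f, g => releaseSem f g
  | .W, f, g => untilSem f g ∨ ∀ i, f i
  | .M, f, g => releaseSem f g ∧ ∃ i, f i

/-- The truth table of a binary logical operator. -/
def BinLg.eval : BinLg → Prop → Prop → Prop
  | .or, a, b => a ∨ b
  | .and, a, b => a ∧ b
  | .impl, a, b => a → b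
  | .conv, a, b => b → a
  | .iff, a, b => a ↔ b
  | .nor, a, b => ¬ (a ∨ b)
  | .nand, a, b => ¬ (a ∧ b)
  | .nimpl, a, b => ¬ (a → b)
  | .nconv, a, b => ¬ (b → a)
  | .niff, a, b => ¬ (a ↔ b)

/-! ### LTL -/

/-- LTL formulas over the propositions `P`. -/
inductive LTL (P : Type)
  | prop (p : P)
  | un (o : UnOp) (φ : LTL P)
  | tp (o : BinTp) (φ ψ : LTL P)
  | lg (o : BinLg) (φ ψ : LTL P)
  deriving DecidableEq

namespace LTL

variable {P : Type}

/-- The formula only uses the given operators. -/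
def InFragment (Ut : Set UnOp) (Bt : Set BinTp) (Bl : Set BinLg) : LTL P → Prop
  | prop _ => True
  | un o φ => o ∈ Ut ∧ φ.InFragment Ut Bt Bl
  | tp o φ ψ => o ∈ Bt ∧ φ.InFragment Ut Bt Bl ∧ ψ.InFragment Ut Bt Bl
  | lg o φ ψ => o ∈ Bl ∧ φ.InFragment Ut Bt Bl ∧ ψ.InFragment Ut Bt Bl

/-- The set of sub-formulas. -/
def subF [DecidableEq P] : LTL P → Finset (LTL P)
  | prop p => {prop p}
  | un o φ => insert (un o φ) φ.subF
  | tp o φ ψ => insert (tp o φ ψ) (φ.subF ∪ ψ.subF)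
  | lg o φ ψ => insert (lg o φ ψ) (φ.subF ∪ ψ.subF)

/-- The outermost operator is binary. -/
def isBin : LTL P → Bool
  | prop _ => false
  | un _ _ => false
  | tp _ _ _ => true
  | lg _ _ _ => true

/-- The size of a formula is its number of distinct sub-formulas. -/
def size [DecidableEq P] (φ : LTL P) : ℕ := φ.subF.card

/-- The number of distinct sub-formulas whose outermost operator is binary. -/
def numBin [DecidableEq P] (φ : LTL P) : ℕ := (φ.subF.filter fun ψ => ψ.isBin).card

/-- `φ.Sat w`: the infinite word `w` satisfies `φ`. -/
def Sat : LTL P → (ℕ → Finset P) → Prop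
  | prop p, w => p ∈ w 0
  | un o φ, w => o.eval fun i => φ.Sat fun j => w (i + j)
  | tp o φ ψ, w => o.eval (fun i => φ.Sat fun j => w (i + j)) (fun i => ψ.Sat fun j => w (i + j))
  | lg o φ ψ, w => o.eval (φ.Sat w) (ψ.Sat w)

end LTL

/-- A (finite representation of an) ultimately periodic word `u · v^ω` with `v` non-empty. -/
structure UPWord (P : Type) where
  u : List (Finset P)
  v : List (Finset P)
  v_ne : v ≠ []

namespace UPWord

variable {P : Type}

/-- The infinite word `u · v^ω`. -/
def word (w : UPWord P) (i : ℕ) : Finset P :=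
  if h : i < w.u.length then w.u[i]
  else w.v[(i - w.u.length) % w.v.length]'(Nat.mod_lt _ (List.length_pos_of_ne_nil w.v_ne))

/-- The size `|u| + |v|`. -/
def size (w : UPWord P) : ℕ := w.u.length + w.v.length

end UPWord

/-! ### ATL and CTL -/

/-- State formulas of `ATL^k` over the propositions `P`, for the agents `Fin k`; the constructors
`un` and `tp` are a strategic quantifier applied to a path formula. -/
inductive ATL (k : ℕ) (P : Type)
  | prop (p : P)
  | neg (φ : ATL k P)
  | lg (o : BinLg) (φ ψ : ATL k P)
  | un (A : Finset (Fin k)) (o : UnTp) (φ : ATL k P)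
  | tp (A : Finset (Fin k)) (o : BinTp) (φ ψ : ATL k P)
  deriving DecidableEq

namespace ATL

variable {k : ℕ} {P : Type}

/-- The formula only uses the given operators. -/
def InFragment (Ut : Set UnOp) (Bt : Set BinTp) (Bl : Set BinLg) : ATL k P → Prop
  | prop _ => True
  | neg φ => UnOp.neg ∈ Ut ∧ φ.InFragment Ut Bt Bl
  | lg o φ ψ => o ∈ Bl ∧ φ.InFragment Ut Bt Bl ∧ ψ.InFragment Ut Bt Bl
  | un _ o φ => UnOp.tp o ∈ Ut ∧ φ.InFragment Ut Bt Bl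
  | tp _ o φ ψ => o ∈ Bt ∧ φ.InFragment Ut Bt Bl ∧ ψ.InFragment Ut Bt Bl

/-- The set of (state) sub-formulas. -/
def subF [DecidableEq P] : ATL k P → Finset (ATL k P)
  | prop p => {prop p}
  | neg φ => insert (neg φ) φ.subF
  | lg o φ ψ => insert (lg o φ ψ) (φ.subF ∪ ψ.subF)
  | un A o φ => insert (un A o φ) φ.subF
  | tp A o φ ψ => insert (tp A o φ ψ) (φ.subF ∪ ψ.subF)

/-- The outermost logical or temporal operator is binary. -/
def isBin : ATL k P → Bool
  | prop _ => false
  | neg _ => false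
  | lg _ _ _ => true
  | un _ _ _ => false
  | tp _ _ _ _ => true

/-- The size of a formula is its number of distinct sub-formulas. -/
def size [DecidableEq P] (φ : ATL k P) : ℕ := φ.subF.card

/-- The number of distinct sub-formulas whose outermost operator is binary. -/
def numBin [DecidableEq P] (φ : ATL k P) : ℕ := (φ.subF.filter fun ψ => ψ.isBin).card

/-- Satisfaction at a state, given the labels of the states and the meaning of the strategic
quantifiers: `quant A q Π` says that `⟨⟨A⟩⟩` holds at `q` for the set `Π` of paths. -/
def SatAt {Q : Type} (label : Q → Finset P)
    (quant : Finset (Fin k) → Q → Set (ℕ → Q) → Prop) : ATL k P → Q → Prop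
  | prop p, q => p ∈ label q
  | neg φ, q => ¬ φ.SatAt label quant q
  | lg o φ ψ, q => o.eval (φ.SatAt label quant q) (ψ.SatAt label quant q)
  | un A o φ, q => quant A q {ρ | o.eval fun i => φ.SatAt label quant (ρ i)}
  | tp A o φ ψ, q => quant A q
      {ρ | o.eval (fun i => φ.SatAt label quant (ρ i)) (fun i => ψ.SatAt label quant (ρ i))}

end ATL

/-- CTL formulas are `ATL^1` formulas: `⟨⟨∅⟩⟩` is `∀` and `⟨⟨{1}⟩⟩` is `∃`. -/
abbrev CTL (P : Type) := ATL 1 P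

/-- A concurrent game structure with agents `Fin k` and states `Fin numStates`. -/
structure CGS (k : ℕ) (P : Type) where
  numStates : ℕ
  init : Finset (Fin numStates)
  label : Fin numStates → Finset P
  /-- the number of actions available to an agent at a state -/
  d : Fin numStates → Fin k → ℕ
  d_pos : ∀ q a, 0 < d q a
  /-- the transition function -/
  δ : (q : Fin numStates) → ((a : Fin k) → Fin (d q a)) → Fin numStates

namespace CGS

variable {k : ℕ} {P : Type} (C : CGS k P)

/-- The states. -/
abbrev Q : Type := Fin C.numStates

/-- The successors of `q` compatible with the actions `α` of the coalition `A`. -/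
def succ (A : Finset (Fin k)) (q : C.Q) (α : (a : Fin k) → a ∈ A → Fin (C.d q a)) : Set C.Q :=
  {q' | ∃ β : (a : Fin k) → Fin (C.d q a), (∀ a (ha : a ∈ A), β a = α a ha) ∧ C.δ q β = q'}

/-- A strategy of agent `a`: an available action for every non-empty history, which is given as the
list of its earlier states together with its last state. -/
abbrev Strategy (a : Fin k) : Type := List C.Q → (q : C.Q) → Fin (C.d q a)

/-- The infinite paths from `q` that are compatible with the strategy profile `s`. -/
def out (A : Finset (Fin k)) (s : (a : Fin k) → a ∈ A → C.Strategy a) (q : C.Q) : Set (ℕ → C.Q) :=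
  {ρ | ρ 0 = q ∧
    ∀ i, ρ (i + 1) ∈ C.succ A (ρ i) fun a ha => s a ha ((List.range i).map ρ) (ρ i)}

/-- The coalition `A` has a strategy profile from `q` all of whose outcomes lie in `S`. -/
def Enforces (A : Finset (Fin k)) (q : C.Q) (S : Set (ℕ → C.Q)) : Prop :=
  ∃ s : (a : Fin k) → a ∈ A → C.Strategy a, ∀ ρ ∈ C.out A s q, ρ ∈ S

/-- The formula holds at all initial states. -/
def Sat (φ : ATL k P) : Prop := ∀ q ∈ C.init, φ.SatAt C.label C.Enforces q

/-- The number of pairs of a state and a joint action there, plus the number of propositions. -/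
def size [Fintype P] : ℕ := (∑ q, ∏ a, C.d q a) + Fintype.card P

end CGS

/-- A Kripke structure with states `Fin numStates`. -/
structure Kripke (P : Type) where
  numStates : ℕ
  init : Finset (Fin numStates)
  label : Fin numStates → Finset P
  succ : Fin numStates → Finset (Fin numStates)
  succ_nonempty : ∀ q, (succ q).Nonempty

namespace Kripke

variable {P : Type} (K : Kripke P)

/-- The states. -/
abbrev Q : Type := Fin K.numStates

/-- The infinite paths from `q`. -/
def out (q : K.Q) : Set (ℕ → K.Q) := {ρ | ρ 0 = q ∧ ∀ i, ρ (i + 1) ∈ K.succ (ρ i)}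

/-- The path quantifiers: the empty coalition is `∀`, the full one is `∃`. -/
def Quant (A : Finset (Fin 1)) (q : K.Q) (S : Set (ℕ → K.Q)) : Prop :=
  (A = ∅ ∧ ∀ ρ ∈ K.out q, ρ ∈ S) ∨ (A = Finset.univ ∧ ∃ ρ ∈ K.out q, ρ ∈ S)

/-- The formula holds at all initial states. -/
def Sat (φ : CTL P) : Prop := ∀ q ∈ K.init, φ.SatAt K.label K.Quant q

/-- The number of transitions, plus the number of propositions. -/
def size [Fintype P] : ℕ := (∑ q, (K.succ q).card) + Fintype.card P

end Kripke

/-! ### Encodings -/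

/-- A natural number in unary. -/
def encNat (n : ℕ) : List Γ' := List.replicate n (Γ'.bit true) ++ [Γ'.comma]

/-- A list, in brackets. -/
def encList {α : Type} (e : α → List Γ') (l : List α) : List Γ' :=
  [Γ'.bra] ++ l.flatMap e ++ [Γ'.ket]

/-- A subset of `Fin m` as a bracketed bit string of length `m`. -/
def encSubset {m : ℕ} (s : Finset (Fin m)) : List Γ' :=
  encList (fun i => [Γ'.bit (decide (i ∈ s))]) (List.finRange m)

def UPWord.encode {m : ℕ} (w : UPWord (Fin m)) : List Γ' :=
  encList encSubset w.u ++ encList encSubset w.v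

def Kripke.encode {m : ℕ} (K : Kripke (Fin m)) : List Γ' :=
  encNat K.numStates ++ encSubset K.init ++
    encList (fun q => encSubset (K.label q)) (List.finRange K.numStates) ++
    encList (fun q => encSubset (K.succ q)) (List.finRange K.numStates)

/-- One line of the transition table: the state, the action of every agent, the next state. -/
def CGS.encodeRow {k m : ℕ} (C : CGS k (Fin m)) (q : C.Q) (α : (a : Fin k) → Fin (C.d q a)) :
    List Γ' :=
  encNat q ++ encList (fun a => encNat (α a)) (List.finRange k) ++ encNat (C.δ q α)

/-- The joint actions at each state are listed in the order given by `finPiFinEquiv`. -/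
def CGS.encode {k m : ℕ} (C : CGS k (Fin m)) : List Γ' :=
  encNat C.numStates ++ encSubset C.init ++
    encList (fun q => encSubset (C.label q)) (List.finRange C.numStates) ++
    encList (fun q => encList (fun a => encNat (C.d q a)) (List.finRange k))
      (List.finRange C.numStates) ++
    encList (fun q => encList (fun j => C.encodeRow q (finPiFinEquiv.symm j))
      (List.finRange (∏ a, C.d q a))) (List.finRange C.numStates)

/-! ### The learning problems -/

/-- An input of a learning problem: a non-empty finite set of propositions `Fin numProp`, finite
collections of positive and of negative models over them, and a bound. -/
structure Sample (Model : ℕ → Type) where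
  numProp : ℕ
  numProp_pos : 0 < numProp
  pos : List (Model numProp)
  neg : List (Model numProp)
  bound : ℕ

namespace Sample

variable {Model : ℕ → Type}

/-- The size of an input, from the sizes of the models. -/
def size (modelSize : {m : ℕ} → Model m → ℕ) (x : Sample Model) : ℕ :=
  x.numProp + (x.pos.map modelSize).sum + (x.neg.map modelSize).sum + x.bound

/-- The encoding of an input, from an encoding of the models; the bound is in unary. -/
def encode (modelEnc : {m : ℕ} → Model m → List Γ') (x : Sample Model) : List Γ' :=
  encNat x.numProp ++ encList modelEnc x.pos ++ encList modelEnc x.neg ++ encNat x.bound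

end Sample

/-- The LTL learning problem. -/
def LTLLearn (Ut : Set UnOp) (Bt : Set BinTp) (Bl : Set BinLg) (n : ℕ∞) : DecisionProblem where
  Input := Sample fun m => UPWord (Fin m)
  size := Sample.size UPWord.size
  encode := Sample.encode UPWord.encode
  yes := {x | ∃ φ : LTL (Fin x.numProp), φ.InFragment Ut Bt Bl ∧
    φ.size ≤ x.bound ∧ (φ.numBin : ℕ∞) ≤ n ∧
    (∀ w ∈ x.pos, φ.Sat w.word) ∧ (∀ w ∈ x.neg, ¬ φ.Sat w.word)}

/-- The CTL learning problem. -/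
def CTLLearn (Ut : Set UnOp) (Bt : Set BinTp) (Bl : Set BinLg) (n : ℕ∞) : DecisionProblem where
  Input := Sample fun m => Kripke (Fin m)
  size := Sample.size fun K => K.size
  encode := Sample.encode Kripke.encode
  yes := {x | ∃ φ : CTL (Fin x.numProp), φ.InFragment Ut Bt Bl ∧
    φ.size ≤ x.bound ∧ (φ.numBin : ℕ∞) ≤ n ∧
    (∀ K ∈ x.pos, K.Sat φ) ∧ (∀ K ∈ x.neg, ¬ K.Sat φ)}

/-- The `ATL^k` learning problem. -/
def ATLLearn (k : ℕ) (Ut : Set UnOp) (Bt : Set BinTp) (Bl : Set BinLg) (n : ℕ∞) :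
    DecisionProblem where
  Input := Sample fun m => CGS k (Fin m)
  size := Sample.size fun C => C.size
  encode := Sample.encode CGS.encode
  yes := {x | ∃ φ : ATL k (Fin x.numProp), φ.InFragment Ut Bt Bl ∧
    φ.size ≤ x.bound ∧ (φ.numBin : ℕ∞) ≤ n ∧
    (∀ C ∈ x.pos, C.Sat φ) ∧ (∀ C ∈ x.neg, ¬ C.Sat φ)}

end TemporalLearning

/-!
A formula of size at most `B` is certified by the directed acyclic graph of its sub-formulas, on at
most `B` nodes, together with a truth table: for every model of the sample, every state and every
node, whether the sub-formula holds there. The table can be checked locally. Writing `Pre A S` for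
the states from which the coalition `A` can force the next state into `S`, the states satisfying
`⟪A⟫ (φ U ψ)` form the least fixed point of `Z ↦ ψ ∪ (φ ∩ Pre A Z)`, those satisfying `⟪A⟫ (φ W ψ)`
the greatest one, and the other temporal operators reduce to these two. A fixed point on `N` states
is reached after `N` iterations, so listing the stages of the iteration as further columns of the
table turns each temporal node into one comparison of neighbouring columns.

Ultimately periodic words are game structures without agents, since all strategies are trivial and
there is one path; Kripke structures are game structures in which one agent picks the successor. All
three problems thus share one verifier, which only needs access to the initial states, the labels
and `Pre` from the encoding of a model. That the verifier runs in polynomial time follows from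
closure properties: functions of finitely many numbers and a read-only input word which are computed
by structured stack programs with polynomial running time contain arithmetic and lookup, and are
closed under bounded sums, hence bounded quantification and bounded search.
-/

namespace TemporalLearning

open Function (update)
open Turing (TM2.Stmt TM2.Cfg TM2.step TM2.stepAux)

/-! ### Structured stack programs and their compilation to Turing machines -/

/-- Structured programs acting on stacks indexed by `ℕ`, as a source language for multi-stack
Turing machines. -/
inductive Prog (A : Type)
  | push (k : ℕ) (a : A)
  | pop (k : ℕ)
  /-- move the top symbol of stack `i`, if there is one, to stack `j` -/
  | move (i j : ℕ)
  | seq (p q : Prog A)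
  /-- branch on the top symbol -/
  | ifTop (k : ℕ) (P : Option A → Bool) (p q : Prog A)
  /-- iterate as long as stack `k` is non-empty -/
  | whileNE (k : ℕ) (p : Prog A)

namespace Prog

variable {A : Type}

/-- The effect of the instruction `move i j` on the stacks. -/
def moveTop (i j : ℕ) (s : ℕ → List A) : ℕ → List A :=
  match s i with
  | [] => s
  | a :: l => update (update s i l) j (a :: update s i l j)

/-- `Run p s s' t`: started with the stacks `s`, the program `p` ends with the stacks `s'` after at
most `t` machine steps. -/
inductive Run : Prog A → (ℕ → List A) → (ℕ → List A) → ℕ → Prop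
  | push (k a s) : Run (push k a) s (update s k (a :: s k)) 1
  | pop (k s) : Run (pop k) s (update s k (s k).tail) 1
  | move (i j s) : Run (move i j) s (moveTop i j s) 1
  | seq {p q s s₁ s₂ t₁ t₂} (h₁ : Run p s s₁ t₁) (h₂ : Run q s₁ s₂ t₂) :
      Run (seq p q) s s₂ (t₁ + t₂)
  | ifTop_true {k P p q s s' t} (h : P (s k).head? = true) (h₁ : Run p s s' t) :
      Run (ifTop k P p q) s s' (1 + t)
  | ifTop_false {k P p q s s' t} (h : P (s k).head? = false) (h₁ : Run q s s' t) :
      Run (ifTop k P p q) s s' (1 + t)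
  | while_nil {k p s} (h : s k = []) : Run (whileNE k p) s s 1
  | while_cons {k p s s₁ s₂ t₁ t₂} (h : s k ≠ []) (h₁ : Run p s s₁ t₁)
      (h₂ : Run (whileNE k p) s₁ s₂ t₂) : Run (whileNE k p) s s₂ (1 + (t₁ + t₂))
  | mono {p s s' t t'} (h : Run p s s' t) (ht : t ≤ t') : Run p s s' t'

/-- The largest index of a stack that the program touches. -/
def maxStack : Prog A → ℕ
  | push k _ => k
  | pop k => k
  | move i j => max i j
  | seq p q => max p.maxStack q.maxStack
  | ifTop k _ p q => max k (max p.maxStack q.maxStack)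
  | whileNE k p => max k p.maxStack

/-- The labels of the machine that executes a program: the positions of its atomic instructions and
of its tests. -/
def Label : Prog A → Type
  | push _ _ => Unit
  | pop _ => Unit
  | move _ _ => Unit
  | seq p q => p.Label ⊕ q.Label
  | ifTop _ _ p q => Option (p.Label ⊕ q.Label)
  | whileNE _ p => Option p.Label

@[reducible]
def labelFintype : (p : Prog A) → Fintype p.Label
  | push _ _ => inferInstanceAs (Fintype Unit)
  | pop _ => inferInstanceAs (Fintype Unit)
  | move _ _ => inferInstanceAs (Fintype Unit)
  | seq p q =>
    let _ := p.labelFintype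
    let _ := q.labelFintype
    inferInstanceAs (Fintype (p.Label ⊕ q.Label))
  | ifTop _ _ p q =>
    let _ := p.labelFintype
    let _ := q.labelFintype
    inferInstanceAs (Fintype (Option (p.Label ⊕ q.Label)))
  | whileNE _ p =>
    let _ := p.labelFintype
    inferInstanceAs (Fintype (Option p.Label))

/-- The label at which the execution of a program starts. -/
def entry : (p : Prog A) → p.Label
  | push _ _ => ()
  | pop _ => ()
  | move _ _ => ()
  | seq p _ => Sum.inl p.entry
  | ifTop _ _ _ _ => none
  | whileNE _ _ => none

/-- The stack alphabets of the machine for a program on the stacks `0, …, m`: the additional stack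
`none` receives the output bit. -/
abbrev StackAlphabet (A : Type) (m : ℕ) : Option (Fin (m + 1)) → Type
  | none => Bool
  | some _ => A

/-- The machine stack that represents stack `k ≤ m` of the program. -/
abbrev stackIdx (m k : ℕ) : Option (Fin (m + 1)) := some (Fin.ofNat (m + 1) k)

/-- The contents of the machine stacks, from the output and the stacks of the program. -/
def machineStacks (m : ℕ) (out : List Bool) (s : ℕ → List A) :
    (k : Option (Fin (m + 1))) → List (StackAlphabet A m k)
  | none => out
  | some i => s i

section MachineStacks

variable {L : Type} {m k : ℕ} (hk : k ≤ m) (out : List Bool) (s : ℕ → List A)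
include hk

theorem machineStacks_stackIdx : machineStacks m out s (stackIdx m k) = s k := by
  simp only [machineStacks, Fin.ofNat, Nat.mod_eq_of_lt (Nat.lt_succ_of_le hk)]

theorem update_machineStacks_stackIdx (l : List A) :
    update (machineStacks m out s) (stackIdx m k) l = machineStacks m out (update s k l) := by
  funext i
  rcases i with _ | i
  · simp [machineStacks]
  · by_cases h : i = Fin.ofNat (m + 1) k
    · subst h
      rw [machineStacks_stackIdx hk, Function.update_self, Function.update_self]
    · have hi : (i : ℕ) ≠ k := fun hi => h (by ext; simp [← hi])
      rw [Function.update_of_ne (by simpa using h)]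
      simp only [machineStacks, Function.update_of_ne hi]

theorem stepAux_push (f : Option A → A) (q : TM2.Stmt (StackAlphabet A m) L (Option A))
    (v : Option A) :
    TM2.stepAux (.push (stackIdx m k) f q) v (machineStacks m out s) =
      TM2.stepAux q v (machineStacks m out (update s k (f v :: s k))) := by
  simp only [TM2.stepAux]
  erw [machineStacks_stackIdx hk, update_machineStacks_stackIdx hk]

theorem stepAux_pop (f : Option A → Option A → Option A)
    (q : TM2.Stmt (StackAlphabet A m) L (Option A)) (v : Option A) :
    TM2.stepAux (.pop (stackIdx m k) f q) v (machineStacks m out s) =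
      TM2.stepAux q (f v (s k).head?) (machineStacks m out (update s k (s k).tail)) := by
  simp only [TM2.stepAux]
  erw [machineStacks_stackIdx hk, update_machineStacks_stackIdx hk]

theorem stepAux_peek (f : Option A → Option A → Option A)
    (q : TM2.Stmt (StackAlphabet A m) L (Option A)) (v : Option A) :
    TM2.stepAux (.peek (stackIdx m k) f q) v (machineStacks m out s) =
      TM2.stepAux q (f v (s k).head?) (machineStacks m out s) := by
  simp only [TM2.stepAux]
  erw [machineStacks_stackIdx hk]

end MachineStacks

section Compilation

variable {L : Type} {m : ℕ}

theorem stepAux_peek_branch {k : ℕ} (hk : k ≤ m) (P : Option A → Bool) (l₁ l₂ : L) (v : Option A)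
    (s : ℕ → List A) :
    TM2.stepAux (.peek (stackIdx m k) (fun _ o => o)
      (.branch P (.goto fun _ => l₁) (.goto fun _ => l₂))) v (machineStacks m [] s) =
      ⟨some (if P (s k).head? then l₁ else l₂), (s k).head?, machineStacks m [] s⟩ := by
  rw [stepAux_peek hk]
  cases h : P (s k).head? <;> simp [TM2.stepAux, h]

/-- The configuration `c'` is reached from `c` within `t` steps of the machine with code `M`. -/
def ReachesWithin (M : L → TM2.Stmt (StackAlphabet A m) L (Option A))
    (c c' : TM2.Cfg (StackAlphabet A m) L (Option A)) (t : ℕ) : Prop :=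
  ∃ n ≤ t, (flip bind (TM2.step M))^[n] (some c) = some c'

section ReachesWithin

variable {M : L → TM2.Stmt (StackAlphabet A m) L (Option A)}
  {c₁ c₂ c₃ : TM2.Cfg (StackAlphabet A m) L (Option A)} {t₁ t₂ : ℕ}

theorem ReachesWithin.mono (h : ReachesWithin M c₁ c₂ t₁) (ht : t₁ ≤ t₂) :
    ReachesWithin M c₁ c₂ t₂ :=
  let ⟨n, hn, hM⟩ := h
  ⟨n, hn.trans ht, hM⟩

theorem ReachesWithin.trans (h₁ : ReachesWithin M c₁ c₂ t₁) (h₂ : ReachesWithin M c₂ c₃ t₂) :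
    ReachesWithin M c₁ c₃ (t₁ + t₂) := by
  obtain ⟨n₁, hn₁, h₁⟩ := h₁
  obtain ⟨n₂, hn₂, h₂⟩ := h₂
  refine ⟨n₂ + n₁, by omega, ?_⟩
  rw [Function.iterate_add_apply, h₁, h₂]

theorem ReachesWithin.single {l : L} {v : Option A} {S : ∀ k, List (StackAlphabet A m k)}
    (h : TM2.stepAux (M l) v S = c₁) : ReachesWithin M ⟨some l, v, S⟩ c₁ 1 := by
  subst h
  exact ⟨1, le_rfl, rfl⟩

end ReachesWithin

variable [Inhabited A]

/-- The machine code of a program, with labels embedded by `e` and with exit label `x`. -/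
def code (m : ℕ) : (p : Prog A) → (e : p.Label → L) → (x : L) → p.Label →
    TM2.Stmt (StackAlphabet A m) L (Option A)
  | push k a, _, x, _ => .push (stackIdx m k) (fun _ => a) (.goto fun _ => x)
  | pop k, _, x, _ => .pop (stackIdx m k) (fun _ _ => none) (.goto fun _ => x)
  | move i j, _, x, _ => .pop (stackIdx m i) (fun _ o => o)
      (.branch Option.isSome
        (.push (stackIdx m j) (fun v => v.getD default) (.goto fun _ => x))
        (.goto fun _ => x))
  | seq p q, e, _, Sum.inl l => p.code m (fun l => e (Sum.inl l)) (e (Sum.inr q.entry)) l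
  | seq _ q, e, x, Sum.inr l => q.code m (fun l => e (Sum.inr l)) x l
  | ifTop k P p q, e, _, none => .peek (stackIdx m k) (fun _ o => o)
      (.branch P (.goto fun _ => e (some (Sum.inl p.entry)))
        (.goto fun _ => e (some (Sum.inr q.entry))))
  | ifTop _ _ p _, e, x, some (Sum.inl l) => p.code m (fun l => e (some (Sum.inl l))) x l
  | ifTop _ _ _ q, e, x, some (Sum.inr l) => q.code m (fun l => e (some (Sum.inr l))) x l
  | whileNE k p, e, x, none => .peek (stackIdx m k) (fun _ o => o)
      (.branch Option.isSome (.goto fun _ => e (some p.entry)) (.goto fun _ => x))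
  | whileNE _ p, e, _, some l => p.code m (fun l => e (some l)) (e none) l

theorem stepAux_code_move {i j : ℕ} (hi : i ≤ m) (hj : j ≤ m) (e : (move i j : Prog A).Label → L)
    (x : L) (v : Option A) (s : ℕ → List A) :
    TM2.stepAux ((move i j).code m e x ()) v (machineStacks m [] s) =
      ⟨some x, (s i).head?, machineStacks m [] (moveTop i j s)⟩ := by
  simp only [code]
  rw [stepAux_pop hi]
  cases hs : s i with
  | nil =>
    have hu : update s i [] = s := by rw [← hs, Function.update_eq_self]
    simp [TM2.stepAux, moveTop, hs, hu]
  | cons a l =>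
    simp only [TM2.stepAux.eq_5, List.head?_cons, Option.isSome_some, cond_true]
    rw [stepAux_push hj]
    simp [TM2.stepAux, moveTop, hs]

/-- The final contents of the machine's register `v'` are irrelevant, since every instruction that
reads the register sets it first. -/
theorem Run.reachesWithin {p : Prog A} {s s' : ℕ → List A} {t : ℕ} (h : Run p s s' t)
    (M : L → TM2.Stmt (StackAlphabet A m) L (Option A)) (hm : p.maxStack ≤ m) (e : p.Label → L)
    (x : L) (hM : ∀ l, M (e l) = p.code m e x l) (v : Option A) :
    ∃ v', ReachesWithin M ⟨some (e p.entry), v, machineStacks m [] s⟩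
      ⟨some x, v', machineStacks m [] s'⟩ t := by
  induction h generalizing x v with
  | push k a s =>
    rw [maxStack] at hm
    exact ⟨v, .single (by rw [hM, code, stepAux_push hm, TM2.stepAux])⟩
  | pop k s =>
    rw [maxStack] at hm
    exact ⟨none, .single (by rw [hM, code, stepAux_pop hm, TM2.stepAux])⟩
  | move i j s =>
    rw [maxStack, max_le_iff] at hm
    exact ⟨_, .single ((congrArg (TM2.stepAux · _ _) (hM _)).trans
      (stepAux_code_move hm.1 hm.2 e x v s))⟩
  | @seq p q s s₁ s₂ t₁ t₂ _ _ ih₁ ih₂ =>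
    rw [maxStack, max_le_iff] at hm
    obtain ⟨v₁, hv₁⟩ := ih₁ hm.1 _ _ (fun l => hM (Sum.inl l)) v
    obtain ⟨v₂, hv₂⟩ := ih₂ hm.2 _ x (fun l => hM (Sum.inr l)) v₁
    exact ⟨v₂, hv₁.trans hv₂⟩
  | @ifTop_true k P p q s s' t h _ ih =>
    simp only [maxStack, sup_le_iff] at hm
    obtain ⟨v', hv'⟩ := ih hm.2.1 _ x (fun l => hM (some (Sum.inl l))) (s k).head?
    refine ⟨v', (ReachesWithin.single ?_).trans hv'⟩
    rw [hM, entry, code, stepAux_peek_branch hm.1, if_pos h]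
  | @ifTop_false k P p q s s' t h _ ih =>
    simp only [maxStack, sup_le_iff] at hm
    obtain ⟨v', hv'⟩ := ih hm.2.2 _ x (fun l => hM (some (Sum.inr l))) (s k).head?
    refine ⟨v', (ReachesWithin.single ?_).trans hv'⟩
    rw [hM, entry, code, stepAux_peek_branch hm.1, h, if_neg Bool.false_ne_true]
  | @while_nil k p s h =>
    rw [maxStack, max_le_iff] at hm
    refine ⟨none, .single ?_⟩
    rw [hM, entry, code, stepAux_peek_branch hm.1, h, List.head?_nil, Option.isSome_none,
      if_neg Bool.false_ne_true]
  | @while_cons k p s s₁ s₂ t₁ t₂ h _ _ ih₁ ih₂ =>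
    have hkp := max_le_iff.1 hm
    obtain ⟨v₁, hv₁⟩ := ih₁ hkp.2 _ _ (fun l => hM (some l)) (s k).head?
    obtain ⟨v₂, hv₂⟩ := ih₂ hm e x hM v₁
    refine ⟨v₂, (ReachesWithin.single ?_).trans (hv₁.trans hv₂)⟩
    rw [hM, entry, code, stepAux_peek_branch hkp.1, if_pos (List.isSome_head?.2 h)]
  | mono _ ht ih => exact (ih hm e x hM v).imp fun _ h => h.mono ht

/-- The code that empties stack `0`, outputs whether it held a symbol, and halts. -/
def outputCode : TM2.Stmt (StackAlphabet A m) L (Option A) :=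
  .pop (stackIdx m 0) (fun _ o => o)
    (.branch Option.isSome (.push none (fun _ => true) (.load (fun _ => none) .halt))
      (.push none (fun _ => false) (.load (fun _ => none) .halt)))

theorem stepAux_outputCode (b : Bool) (v : Option A) :
    TM2.stepAux (outputCode : TM2.Stmt (StackAlphabet A m) L (Option A)) v
      (machineStacks m [] (update (fun _ => []) 0 (if b then [default] else []))) =
      ⟨none, none, machineStacks m [b] fun _ => []⟩ := by
  have hout (b) : update (machineStacks m [] fun _ => ([] : List A)) none
      (b :: machineStacks m [] (fun _ => []) none) = machineStacks m [b] fun _ => [] := by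
    funext k
    rcases k with _ | k <;> simp [machineStacks]
  rw [outputCode, stepAux_pop (Nat.zero_le m)]
  cases b <;> simpa [TM2.stepAux] using hout _

end Compilation

/-- The machine that runs a program with the input on stack `0`, and then outputs whether stack `0`
is non-empty. -/
def machine (p : Prog A) [Inhabited A] [Fintype A] : Turing.FinTM2 :=
  let _ := p.labelFintype
  { K := Option (Fin (p.maxStack + 1))
    k₀ := stackIdx p.maxStack 0
    k₁ := none
    Γ := StackAlphabet A p.maxStack
    Λ := Option p.Label
    main := some p.entry
    σ := Option A
    initialState := none
    Γk₀Fin := inferInstanceAs (Fintype A)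
    m := fun l => match l with
      | some l => p.code p.maxStack some none l
      | none => outputCode }

variable [Inhabited A] (p : Prog A)

theorem initList_machine [Fintype A] (w : List A) :
    Turing.initList p.machine w =
      ⟨some (some p.entry), none, machineStacks p.maxStack [] (update (fun _ => []) 0 w)⟩ := by
  refine congrArg (TM2.Cfg.mk _ _) ?_
  rw [← update_machineStacks_stackIdx (Nat.zero_le _)]
  let Contents := fun k => List (StackAlphabet A p.maxStack k)
  funext k
  by_cases hk : k = p.machine.k₀
  · subst hk
    rw [dif_pos rfl]
    exact (Function.update_self (β := Contents) (stackIdx p.maxStack 0) w _).symm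
  · rw [dif_neg hk]
    refine .trans ?_ (Function.update_of_ne (β := Contents) hk w _).symm
    rcases k with _ | k <;> rfl

theorem haltList_machine [Fintype A] (b : Bool) :
    Turing.haltList p.machine [b] = ⟨none, none, machineStacks p.maxStack [b] fun _ => []⟩ := by
  refine congrArg (TM2.Cfg.mk _ _) ?_
  funext k
  rcases k with _ | k <;> rfl

theorem tm2ComputableInPolyTime [Finite A] {α : Type} (ea : α → List A) (f : α → Bool)
    (Q : Polynomial ℕ)
    (h : ∀ a, Run p (update (fun _ => []) 0 (ea a))
      (update (fun _ => []) 0 (if f a then [default] else [])) (Q.eval (ea a).length)) :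
    Nonempty (Turing.TM2ComputableInPolyTime ea encodeBool f) := by
  have _ := Fintype.ofFinite A
  refine ⟨{ tm := p.machine, inputAlphabet := Equiv.refl A, outputAlphabet := Equiv.refl Bool,
            time := Q + 1, outputsFun := fun a => ?_ }⟩
  have hreach : ReachesWithin p.machine.m (Turing.initList p.machine (ea a))
      (Turing.haltList p.machine [f a]) ((Q + 1).eval (ea a).length) := by
    obtain ⟨v, hv⟩ := (h a).reachesWithin p.machine.m le_rfl some none (fun _ => rfl) none
    rw [initList_machine, haltList_machine, Polynomial.eval_add, Polynomial.eval_one]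
    exact hv.trans (.single (stepAux_outputCode (f a) v))
  have houtputs : Turing.TM2OutputsInTime p.machine (ea a) (some [f a])
      ((Q + 1).eval (ea a).length) :=
    { steps := hreach.choose
      evals_in_steps := hreach.choose_spec.2
      steps_le_m := hreach.choose_spec.1 }
  exact (List.map_id (ea a)).symm ▸ houtputs

end Prog

/-! ### Unary arithmetic by stack programs -/

namespace Prog

variable {A : Type}

theorem Run.while_of_seq {k : ℕ} {p : Prog A} {T N : ℕ} (S : ℕ → ℕ → List A)
    (hS : ∀ i ≤ N, (S i k).length = N - i) (hp : ∀ i < N, Run p (S i) (S (i + 1)) T) :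
    Run (whileNE k p) (S 0) (S N) (N * (T + 1) + 1) := by
  induction N generalizing S with
  | zero =>
    refine .mono (.while_nil ?_) (Nat.le_add_left 1 _)
    simpa using hS 0 le_rfl
  | succ N ih =>
    have hloop := ih (fun i => S (i + 1)) (fun i hi => by rw [hS _ (by omega)]; omega)
      fun i hi => hp _ (by omega)
    refine .mono (.while_cons ?_ (hp 0 (by omega)) hloop) (by grind)
    rw [← List.length_pos_iff, hS 0 (by omega)]
    omega

/-- The program that empties a stack. -/
def clear (k : ℕ) : Prog A := whileNE k (pop k)

theorem run_clear (k : ℕ) (s : ℕ → List A) :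
    Run (clear k) s (update s k []) (2 * (s k).length + 1) := by
  have hstep (i : ℕ) : Run (pop k) (update s k ((s k).drop i))
      (update s k ((s k).drop (i + 1))) 1 := by
    simpa using Run.pop k (update s k ((s k).drop i))
  have hloop := Run.while_of_seq (k := k) (N := (s k).length)
    (fun i => update s k ((s k).drop i)) (fun i _ => by simp) fun i _ => hstep i
  rw [mul_comm]
  simpa [clear] using hloop

variable [Inhabited A]

/-- The unary notation of a natural number. -/
def unary (A : Type) [Inhabited A] (n : ℕ) : List A := List.replicate n default

/-- The stacks that represent an input word `w`, with a reading head at position `i`, and registers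
`r` for natural numbers: stack `0` holds the word from the head on, stack `1` the reversal of the
part before the head, and stack `j + 2` holds `r j` in unary. -/
def config (w : List A) (i : ℕ) (r : ℕ → ℕ) : ℕ → List A
  | 0 => w.drop i
  | 1 => (w.take i).reverse
  | j + 2 => unary A (r j)

section Config

variable (w : List A) (i : ℕ) (r : ℕ → ℕ)

theorem config_zero_zero : config w 0 (fun _ => 0) = update (fun _ => []) 0 w := by
  funext k
  rcases k with _ | _ | k <;> simp [config, unary]

theorem length_config_register (j : ℕ) : (config w i r (j + 2)).length = r j := by
  simp [config, unary]

theorem update_config_register (j n : ℕ) :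
    update (config w i r) (j + 2) (unary A n) = config w i (update r j n) := by
  funext k
  rcases k with _ | _ | k
  · simp [config]
  · simp [config]
  · by_cases hk : k = j
    · simp [config, hk]
    · simp [config, hk]

variable {w i r} in
theorem Run.congr_config {p : Prog A} {s : ℕ → List A} {r' : ℕ → ℕ} {t t' : ℕ}
    (h : Run p s (config w i r) t) (hr : ∀ j, r j = r' j) (ht : t ≤ t') :
    Run p s (config w i r') t' :=
  funext hr ▸ h.mono ht

theorem run_incr (j : ℕ) :
    Run (push (j + 2) default) (config w i r) (config w i (update r j (r j + 1))) 1 := by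
  rw [← update_config_register]
  exact .push ..

theorem run_decr (j : ℕ) :
    Run (pop (j + 2)) (config w i r) (config w i (update r j (r j - 1))) 1 := by
  have hpop := Run.pop (j + 2) (config w i r)
  rwa [show (config w i r (j + 2)).tail = unary A (r j - 1) by simp [config, unary],
    update_config_register] at hpop

theorem run_clear_register (j : ℕ) :
    Run (clear (j + 2)) (config w i r) (config w i (update r j 0)) (2 * r j + 1) := by
  have hclear := run_clear (j + 2) (config w i r)
  rwa [length_config_register, show ([] : List A) = unary A 0 from rfl,
    update_config_register] at hclear

theorem run_countdown {j T N : ℕ} {p : Prog A} (pos : ℕ → ℕ) (R : ℕ → ℕ → ℕ)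
    (hR : ∀ n ≤ N, R n j = N - n)
    (hp : ∀ n < N, Run p (config w (pos n) (R n)) (config w (pos (n + 1)) (R (n + 1))) T) :
    Run (whileNE (j + 2) p) (config w (pos 0) (R 0)) (config w (pos N) (R N))
      (N * (T + 1) + 1) :=
  .while_of_seq (fun n => config w (pos n) (R n))
    (fun n hn => (length_config_register ..).trans (hR n hn)) hp

/-- The program that adds register `i` to register `j` and clears register `i`. -/
def transfer (i j : ℕ) : Prog A := whileNE (i + 2) (seq (pop (i + 2)) (push (j + 2) default))

theorem run_transfer {j k : ℕ} (hjk : j ≠ k) :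
    Run (transfer j k) (config w i r) (config w i (update (update r j 0) k (r j + r k)))
      (3 * r j + 1) := by
  let R (n : ℕ) : ℕ → ℕ := update (update r j (r j - n)) k (n + r k)
  have hbody (n : ℕ) (hn : n < r j) : Run (seq (pop (j + 2)) (push (k + 2) default))
      (config w i (R n)) (config w i (R (n + 1))) 2 := by
    convert (run_decr w i (R n) j).seq (run_incr w i _ k) using 2
    funext l
    grind [Function.update_apply]
  have hloop := run_countdown w (j := j) (N := r j) (fun _ => i) R (fun n _ => by simp [R, hjk])
    hbody
  rw [show R 0 = r by simp [R]] at hloop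
  exact hloop.congr_config (fun l => by grind [Function.update_apply]) (by omega)

/-- The program that copies register `i` to register `d`, with register `d + 1` as scratch. -/
def copy (i d : ℕ) : Prog A :=
  seq (transfer i (d + 1)) (whileNE (d + 1 + 2) (seq (pop (d + 1 + 2))
    (seq (push (i + 2) default) (push (d + 2) default))))

theorem run_copy {j d : ℕ} (hj : j < d) (hr : ∀ l ≥ d, r l = 0) :
    Run (copy j d) (config w i r) (config w i (update r d (r j))) (7 * r j + 2) := by
  let R (n : ℕ) : ℕ → ℕ := update (update (update r j n) (d + 1) (r j - n)) d n
  have hbody (n : ℕ) (hn : n < r j) :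
      Run (seq (pop (d + 1 + 2)) (seq (push (j + 2) default) (push (d + 2) default)))
        (config w i (R n)) (config w i (R (n + 1))) 3 := by
    convert (run_decr w i (R n) (d + 1)).seq ((run_incr w i _ j).seq (run_incr w i _ d)) using 2
    funext l
    grind [Function.update_apply]
  have htransfer := run_transfer w i r (show j ≠ d + 1 by omega)
  have hstart : update (update r j 0) (d + 1) (r j + r (d + 1)) = R 0 := by
    funext l
    grind [Function.update_apply]
  rw [hstart] at htransfer
  have hloop := run_countdown w (j := d + 1) (N := r j) (fun _ => i) R (fun n _ => by simp [R])
    hbody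
  exact (htransfer.seq hloop).congr_config (fun l => by grind [Function.update_apply]) (by omega)

theorem run_moveRight :
    Run (move 0 1) (config w i r) (config w (i + 1) r) 1 := by
  convert Run.move 0 1 (config w i r) using 1
  by_cases hi : i < w.length
  · rw [moveTop, config, List.drop_eq_getElem_cons hi]
    funext k
    rcases k with _ | _ | k
    · simp [config]
    · exact (congrArg List.reverse (List.take_succ_eq_append_getElem hi)).trans (by simp [config])
    · rfl
  · have hdrop : w.drop i = [] := List.drop_eq_nil_of_le (by omega)
    rw [moveTop, config, hdrop]
    funext k
    rcases k with _ | _ | k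
    · exact (List.drop_eq_nil_of_le (by omega)).trans hdrop.symm
    · exact congrArg List.reverse <| (List.take_of_length_le (by omega)).trans
        (List.take_of_length_le (by omega)).symm
    · rfl

theorem run_moveLeft (hi : i < w.length) :
    Run (move 1 0) (config w (i + 1) r) (config w i r) 1 := by
  convert Run.move 1 0 (config w (i + 1) r) using 1
  rw [moveTop, config, List.take_succ_eq_append_getElem hi, List.reverse_append]
  funext k
  rcases k with _ | _ | k <;> simp [config]

/-- The program that moves the reading head back to the start of the word. -/
def rewind : Prog A := whileNE 1 (move 1 0)

theorem run_rewind :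
    Run rewind (config w i r) (config w 0 r) (2 * w.length + 1) := by
  have hlen (n : ℕ) : (config w n r 1).length = min n w.length := by simp [config]
  have hstart : config w (min i w.length) r = config w i r := by
    rcases le_total i w.length with hi | hi
    · rw [min_eq_left hi]
    · rw [min_eq_right hi]
      funext k
      rcases k with _ | _ | k <;> simp [config, hi]
  have hloop := Run.while_of_seq (k := 1) (N := min i w.length)
    (fun n => config w (min i w.length - n) r) (fun n _ => by rw [hlen]; omega)
    fun n hn => by
      rw [show min i w.length - n = min i w.length - (n + 1) + 1 by omega]
      exact run_moveLeft w _ r (by omega)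
  rw [Nat.sub_zero, Nat.sub_self, hstart] at hloop
  exact hloop.mono (by omega)

end Config

end Prog

/-! ### Functions computable in polynomial time -/

/-- Contexts in which number-valued functions are evaluated: an input word and a list of numbers,
the values of the variables. The number bound last comes first. -/
class Ctx (A : outParam Type) (α : Type) where
  word : α → List A
  val : α → List ℕ

instance {A : Type} : Ctx A (List A) := ⟨id, fun _ => []⟩

instance {A α : Type} [Ctx A α] : Ctx A (α × ℕ) :=
  ⟨fun a => Ctx.word a.1, fun a => a.2 :: Ctx.val a.1⟩

namespace Ctx

variable {A α : Type} [Ctx A α]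

/-- The size of a context, with its numbers in unary. -/
def size (a : α) : ℕ := (word a).length + (val a).sum

@[simp] theorem word_list (w : List A) : word w = w := rfl

@[simp] theorem val_list (w : List A) : val w = [] := rfl

@[simp] theorem word_prod (a : α × ℕ) : word a = word a.1 := rfl

@[simp] theorem val_prod (a : α × ℕ) : val a = a.2 :: val a.1 := rfl

@[simp] theorem size_prod (a : α × ℕ) : size a = size a.1 + a.2 := by
  simp only [size, word_prod, val_prod, List.sum_cons]
  omega

end Ctx

theorem monotone_eval_natPolynomial (P : Polynomial ℕ) : Monotone fun n => P.eval n := by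
  intro m n h
  induction P using Polynomial.induction_on' with
  | add p q hp hq => simpa using Nat.add_le_add hp hq
  | monomial k a => simpa using Nat.mul_le_mul_left a (Nat.pow_le_pow_left h k)

/-- Functions bounded by a polynomial in the size of the context. -/
def PolyBdd {A α : Type} [Ctx A α] (f : α → ℕ) : Prop :=
  ∃ P : Polynomial ℕ, ∀ a, f a ≤ P.eval (Ctx.size a)

namespace PolyBdd

variable {A α β : Type} [Ctx A α] [Ctx A β] {f g : α → ℕ}

theorem mono (hg : PolyBdd g) (h : ∀ a, f a ≤ g a) : PolyBdd f :=
  let ⟨P, hP⟩ := hg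
  ⟨P, fun a => (h a).trans (hP a)⟩

theorem const (c : ℕ) : PolyBdd fun _ : α => c := ⟨Polynomial.C c, fun _ => by simp⟩

theorem size : PolyBdd fun a : α => Ctx.size a := ⟨Polynomial.X, fun _ => by simp⟩

theorem wordLength : PolyBdd fun a : α => (Ctx.word a).length :=
  size.mono fun _ => Nat.le_add_right ..

theorem add (hf : PolyBdd f) (hg : PolyBdd g) : PolyBdd fun a => f a + g a :=
  let ⟨P, hP⟩ := hf
  let ⟨Q, hQ⟩ := hg
  ⟨P + Q, fun a => by simpa using Nat.add_le_add (hP a) (hQ a)⟩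

theorem mul (hf : PolyBdd f) (hg : PolyBdd g) : PolyBdd fun a => f a * g a :=
  let ⟨P, hP⟩ := hf
  let ⟨Q, hQ⟩ := hg
  ⟨P * Q, fun a => by simpa using Nat.mul_le_mul (hP a) (hQ a)⟩

theorem affine (c e : ℕ) (hf : PolyBdd f) : PolyBdd fun a => c * f a + e :=
  ((const c).mul hf).add (const e)

theorem comp (hf : PolyBdd f) {φ : β → α} (hφ : PolyBdd fun b => Ctx.size (φ b)) :
    PolyBdd fun b => f (φ b) :=
  let ⟨P, hP⟩ := hf
  let ⟨Q, hQ⟩ := hφ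
  ⟨P.comp Q, fun b => by
    simpa using (hP (φ b)).trans (monotone_eval_natPolynomial P (hQ b))⟩

theorem weaken (hf : PolyBdd f) : PolyBdd fun c : α × ℕ => f c.1 :=
  hf.comp (size.mono fun c => by simp)

theorem exists_bound_forall_le {T : α × ℕ → ℕ} (hT : PolyBdd T) (hf : PolyBdd f) :
    ∃ U : α → ℕ, PolyBdd U ∧ ∀ a, ∀ n ≤ f a, T (a, n) ≤ U a := by
  obtain ⟨P, hP⟩ := hT
  obtain ⟨Q, hQ⟩ := size.add hf
  refine ⟨fun a => P.eval (Ctx.size a + f a), ⟨P.comp Q, fun a => ?_⟩, fun a n hn => ?_⟩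
  · simpa using monotone_eval_natPolynomial P (hQ a)
  · exact (hP _).trans (monotone_eval_natPolynomial P (by simpa using hn))

end PolyBdd

/-- The program `p` computes `f` into register `d` within time `T`, if the registers `ρ` hold the
variables of the context and all registers from `d` on are zero. -/
def Computes {A α : Type} [Inhabited A] [Ctx A α] (p : Prog A) (ρ : List ℕ) (d : ℕ) (f T : α → ℕ) :
    Prop :=
  ∀ (a : α) (r : ℕ → ℕ), ρ.map r = Ctx.val a → (∀ j ≥ d, r j = 0) →
    Prog.Run p (Prog.config (Ctx.word a) 0 r) (Prog.config (Ctx.word a) 0 (update r d (f a))) (T a)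

/-- Functions that are polynomially bounded and computable in polynomial time, with all numbers in
unary. A program is required for any placement `ρ` of the variables in registers below the target
register `d`, so that programs can be composed. -/
def PolyTime {A α : Type} [Inhabited A] [Ctx A α] (f : α → ℕ) : Prop :=
  PolyBdd f ∧ ∀ (ρ : List ℕ) (d : ℕ), (∀ j ∈ ρ, j < d) →
    ∃ (p : Prog A) (T : α → ℕ), PolyBdd T ∧ Computes p ρ d f T

namespace PolyTime

open Prog

variable {A α β : Type} [Inhabited A] [Ctx A α] [Ctx A β]

theorem var₀ : PolyTime fun c : α × ℕ => c.2 := by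
  refine ⟨PolyBdd.size.mono fun c => by simp, fun ρ d hρ => ?_⟩
  rcases ρ with _ | ⟨j, ρ⟩
  · exact ⟨pop 0, fun _ => 0, .const 0, fun a r h => by simp at h⟩
  · refine ⟨copy j d, fun c => 7 * c.2 + 2, .affine 7 2 (PolyBdd.size.mono fun c => by simp),
      fun c r h hr => ?_⟩
    obtain ⟨hc : r j = c.2, -⟩ := List.cons.inj h
    simp only [← hc]
    exact run_copy _ 0 r (hρ j List.mem_cons_self) hr

theorem reindex {f : α → ℕ} (hf : PolyTime f) (φ : β → α) (R : List ℕ → List ℕ)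
    (hR : ∀ ρ, R ρ ⊆ ρ) (hw : ∀ b, Ctx.word (φ b) = Ctx.word b)
    (hv : ∀ (b : β) (r : ℕ → ℕ) (ρ : List ℕ), ρ.map r = Ctx.val b → (R ρ).map r = Ctx.val (φ b))
    (hsize : ∀ b, Ctx.size (φ b) ≤ Ctx.size b) : PolyTime fun b => f (φ b) := by
  have hφ : PolyBdd fun b => Ctx.size (φ b) := PolyBdd.size.mono hsize
  refine ⟨hf.1.comp hφ, fun ρ d hρ => ?_⟩
  obtain ⟨p, T, hT, hp⟩ := hf.2 (R ρ) d fun j hj => hρ j (hR ρ hj)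
  refine ⟨p, fun b => T (φ b), hT.comp hφ, fun b r hr hd => ?_⟩
  simpa only [hw] using hp (φ b) r (hv b r ρ hr) hd

theorem weaken {f : α → ℕ} (hf : PolyTime f) : PolyTime fun c : α × ℕ => f c.1 :=
  hf.reindex Prod.fst List.tail (fun ρ => List.tail_subset ρ) (fun _ => rfl)
    (fun b r ρ h => by rw [List.map_tail, h]; simp) (fun b => by simp)

theorem map_update_of_forall_lt {ρ : List ℕ} {d j : ℕ} (hρ : ∀ l ∈ ρ, l < d) (hj : d ≤ j)
    (r : ℕ → ℕ) (x : ℕ) : ρ.map (update r j x) = ρ.map r :=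
  List.map_congr_left fun l hl => Function.update_of_ne ((hρ l hl).trans_le hj).ne _ _

theorem bind {f : α × ℕ → ℕ} (hf : PolyTime f) {g : α → ℕ} (hg : PolyTime g) :
    PolyTime fun a => f (a, g a) := by
  have hpair : PolyBdd fun a => Ctx.size (a, g a) := by simpa using PolyBdd.size.add hg.1
  refine ⟨hf.1.comp hpair, fun ρ d hρ => ?_⟩
  obtain ⟨p, T, hT, hp⟩ := hg.2 ρ d hρ
  obtain ⟨q, U, hU, hq⟩ := hf.2 (d :: ρ) (d + 1) (by grind)
  refine ⟨seq p (seq q (seq (clear (d + 2)) (transfer (d + 1) d))),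
    fun a => T a + (U (a, g a) + ((2 * g a + 1) + (3 * f (a, g a) + 1))),
    hT.add ((hU.comp hpair).add ((hg.1.affine 2 1).add ((hf.1.comp hpair).affine 3 1))),
    fun a r hr hd => ?_⟩
  set r₁ := update r d (g a) with hr₁
  have hval : (d :: ρ).map r₁ = Ctx.val (a, g a) := by
    rw [List.map_cons, map_update_of_forall_lt hρ le_rfl, hr]
    simp [hr₁]
  have hzero : ∀ j ≥ d + 1, r₁ j = 0 := by grind [Function.update_apply]
  have hrun := (hp a r hr hd).seq ((hq (a, g a) r₁ hval hzero).seq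
    ((run_clear_register _ 0 _ d).seq (run_transfer _ 0 _ (show d + 1 ≠ d by omega))))
  refine hrun.congr_config (fun l => ?_) ?_
  · grind [Function.update_apply]
  · grind [Function.update_apply]

theorem zero : PolyTime fun _ : α => 0 :=
  ⟨.const 0, fun _ d _ => ⟨pop (d + 2), fun _ => 1, .const 1, fun a r _ hr => by
    simpa [hr d le_rfl] using run_decr (Ctx.word a) 0 r d⟩⟩

theorem succ {f : α → ℕ} (hf : PolyTime f) : PolyTime fun a => f a + 1 := by
  refine ⟨hf.1.add (.const 1), fun ρ d hρ => ?_⟩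
  obtain ⟨p, T, hT, hp⟩ := hf.2 ρ d hρ
  refine ⟨seq p (push (d + 2) default), fun a => T a + 1, hT.add (.const 1), fun a r hr hd => ?_⟩
  simpa using (hp a r hr hd).seq (run_incr (Ctx.word a) 0 _ d)

theorem const (c : ℕ) : PolyTime fun _ : α => c := by
  induction c with
  | zero => exact zero
  | succ c ih => exact ih.succ

end PolyTime

namespace PolyTime

open Prog

variable {A α : Type} [Inhabited A] [Ctx A α]

/-- The registers during a recursion: the current value `x`, the number `m` of remaining steps, and
the number `i` of completed steps. -/
def natRecRegisters (r : ℕ → ℕ) (d x m i : ℕ) : ℕ → ℕ :=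
  update (update (update r d x) (d + 1) m) (d + 2) i

theorem natRecRegisters_apply (r : ℕ → ℕ) (d x m i l : ℕ) : natRecRegisters r d x m i l =
    if l = d + 2 then i else if l = d + 1 then m else if l = d then x else r l := by
  simp only [natRecRegisters, Function.update_apply]

/-- One step of a recursion, where the program `p` computes the next value into register
`d + 3`. -/
def natRecBody (d : ℕ) (p : Prog A) : Prog A :=
  seq (pop (d + 1 + 2)) (seq p (seq (clear (d + 2)) (seq (transfer (d + 3) d)
    (push (d + 2 + 2) default))))

theorem run_natRecBody {h T : (α × ℕ) × ℕ → ℕ} {p : Prog A} {ρ : List ℕ} {d : ℕ}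
    (hp : Computes p (d :: (d + 2) :: ρ) (d + 3) h T) (hρ : ∀ j ∈ ρ, j < d) {a : α} {r : ℕ → ℕ}
    (hr : ρ.map r = Ctx.val a) (hd : ∀ j ≥ d, r j = 0) (x m i : ℕ) :
    Run (natRecBody d p) (config (Ctx.word a) 0 (natRecRegisters r d x (m + 1) i))
      (config (Ctx.word a) 0 (natRecRegisters r d (h ((a, i), x)) m (i + 1)))
      (T ((a, i), x) + 2 * x + 3 * h ((a, i), x) + 4) := by
  set w := Ctx.word a
  set r₁ := natRecRegisters r d x m i with hr₁
  have hdecr : Run (pop (d + 1 + 2)) (config w 0 (natRecRegisters r d x (m + 1) i))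
      (config w 0 r₁) 1 := by
    convert run_decr w 0 (natRecRegisters r d x (m + 1) i) (d + 1) using 2
    funext l
    grind [natRecRegisters_apply, Function.update_apply]
  have hval : (d :: (d + 2) :: ρ).map r₁ = Ctx.val ((a, i), x) := by
    rw [List.map_cons, List.map_cons, hr₁, natRecRegisters,
      map_update_of_forall_lt hρ (by omega), map_update_of_forall_lt hρ (by omega),
      map_update_of_forall_lt hρ le_rfl, hr]
    simp
  have hstep := hp ((a, i), x) r₁ hval (by grind [natRecRegisters_apply, Function.update_apply])
  have hrun := hdecr.seq <| hstep.seq <| (run_clear_register w 0 _ d).seq <|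
    (run_transfer w 0 _ (show d + 3 ≠ d by omega)).seq (run_incr w 0 _ (d + 2))
  refine hrun.congr_config (fun l => ?_) ?_
  · grind [natRecRegisters_apply, Function.update_apply]
  · grind [natRecRegisters_apply, Function.update_apply]

omit [Inhabited A] in
theorem polyBdd_natRecBody_time {h T : (α × ℕ) × ℕ → ℕ} (hT : PolyBdd T) (hh : PolyBdd h)
    {b B : α → ℕ} (hb : PolyBdd b) (hB : PolyBdd B) :
    ∃ U : α → ℕ, PolyBdd U ∧ ∀ a, ∀ i ≤ b a, ∀ x ≤ B a,
      T ((a, i), x) + 2 * x + 3 * h ((a, i), x) + 4 ≤ U a := by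
  have htime : PolyBdd fun c : (α × ℕ) × ℕ => T c + 2 * c.2 + 3 * h c + 4 :=
    ((hT.add ((PolyBdd.size.mono (f := Prod.snd) fun c => by simp).affine 2 0)).add
      (hh.affine 3 4)).mono fun c => by omega
  obtain ⟨U₁, hU₁, hle₁⟩ := htime.exists_bound_forall_le hB.weaken
  obtain ⟨U, hU, hle⟩ := hU₁.exists_bound_forall_le hb
  exact ⟨U, hU, fun a i hi x hx => (hle₁ (a, i) x hx).trans (hle a i hi)⟩

theorem natRec {g b : α → ℕ} {h : (α × ℕ) × ℕ → ℕ} (hg : PolyTime g) (hb : PolyTime b)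
    (hh : PolyTime h) {B : α → ℕ} (hB : PolyBdd B)
    (hle : ∀ a, ∀ i ≤ b a, Nat.rec (g a) (fun i x => h ((a, i), x)) i ≤ B a) :
    PolyTime fun a => Nat.rec (motive := fun _ => ℕ) (g a) (fun i x => h ((a, i), x)) (b a) := by
  set R : α → ℕ → ℕ := fun a i => Nat.rec (motive := fun _ => ℕ) (g a)
    (fun i x => h ((a, i), x)) i
  refine ⟨hB.mono fun a => hle a _ le_rfl, fun ρ d hρ => ?_⟩
  obtain ⟨pb, Tb, hTb, hpb⟩ := hb.2 ρ (d + 1) (by grind)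
  obtain ⟨pg, Tg, hTg, hpg⟩ := hg.2 ρ (d + 2) (by grind)
  obtain ⟨ph, Th, hTh, hph⟩ := hh.2 (d :: (d + 2) :: ρ) (d + 3) (by grind)
  obtain ⟨U, hU, hbody⟩ := polyBdd_natRecBody_time hTh hh.1 hb.1 hB
  refine ⟨seq (seq pb (seq pg (transfer (d + 2) d)))
      (seq (whileNE (d + 1 + 2) (natRecBody d ph)) (clear (d + 2 + 2))),
    fun a => (Tb a + (Tg a + (3 * g a + 1))) + ((b a * (U a + 1) + 1) + (2 * b a + 1)),
    (hTb.add (hTg.add (hg.1.affine 3 1))).add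
      (((hb.1.mul (hU.add (.const 1))).add (.const 1)).add (hb.1.affine 2 1)),
    fun a r hr hd => ?_⟩
  have hrunb := hpb a r hr fun j hj => hd j (by omega)
  have hrung := hpg a (update r (d + 1) (b a))
    ((map_update_of_forall_lt hρ (by omega) _ _).trans hr) (by grind [Function.update_apply])
  have hloop := run_countdown (Ctx.word a) (j := d + 1) (N := b a) (fun _ => 0)
    (fun i => natRecRegisters r d (R a i) (b a - i) i) (by grind [natRecRegisters_apply])
    fun i hi => by
      have hstep := run_natRecBody hph hρ hr hd (R a i) (b a - (i + 1)) i
      rw [show b a - (i + 1) + 1 = b a - i by omega] at hstep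
      exact hstep.mono (hbody a i hi.le _ (hle a i hi.le))
  have hinit := (hrunb.seq (hrung.seq (run_transfer _ 0 _ (show d + 2 ≠ d by omega)))).congr_config
    (r' := natRecRegisters r d (g a) (b a) 0)
    (by grind [natRecRegisters_apply, Function.update_apply]) le_rfl
  refine (hinit.seq (hloop.seq (run_clear_register _ 0 _ (d + 2)))).congr_config (fun l => ?_) ?_
  · simp only [natRecRegisters]
    grind [Function.update_apply]
  · grind [natRecRegisters_apply, Function.update_apply]

theorem wordLength : PolyTime fun a : α => (Ctx.word a).length := by
  refine ⟨.wordLength, fun ρ d _ => ⟨seq (whileNE 0 (seq (move 0 1) (push (d + 2) default))) rewind,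
    fun a => ((Ctx.word a).length * 3 + 1) + (2 * (Ctx.word a).length + 1),
    ((PolyBdd.wordLength.mul (.const 3)).add (.const 1)).add (PolyBdd.wordLength.affine 2 1),
    fun a r _ hd => ?_⟩⟩
  set w := Ctx.word a
  have hloop : Run (whileNE 0 (seq (move 0 1) (push (d + 2) default)))
      (config w 0 (update r d 0)) (config w w.length (update r d w.length)) (w.length * 3 + 1) :=
    .while_of_seq (fun n => config w n (update r d n)) (fun n _ => by simp [config]) fun n _ =>
      ((run_moveRight w n _).seq (run_incr w (n + 1) _ d)).congr_config (by simp) le_rfl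
  rw [show update r d 0 = r by grind [Function.update_apply]] at hloop
  exact hloop.seq (run_rewind w w.length _)

theorem run_seek (w : List A) (r : ℕ → ℕ) (d : ℕ) :
    Run (whileNE (d + 2) (seq (pop (d + 2)) (move 0 1))) (config w 0 r)
      (config w (r d) (update r d 0)) (r d * 3 + 1) := by
  have hloop := run_countdown w (j := d) (N := r d) (fun n => n) (fun n => update r d (r d - n))
    (by simp) fun n _ => by
      refine ((run_decr w n _ d).seq (run_moveRight w n _)).congr_config ?_ le_rfl
      grind [Function.update_apply]
  simpa using hloop

theorem letter (P : Option A → Bool) {f : α → ℕ} (hf : PolyTime f) :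
    PolyTime fun a => if P (Ctx.word a)[f a]? then 1 else 0 := by
  refine ⟨(PolyBdd.const 1).mono fun a => by split <;> simp, fun ρ d hρ => ?_⟩
  obtain ⟨p, T, hT, hp⟩ := hf.2 ρ d hρ
  refine ⟨seq p (seq (whileNE (d + 2) (seq (pop (d + 2)) (move 0 1)))
    (seq (ifTop 0 P (push (d + 2) default) (pop (d + 2))) rewind)),
    fun a => T a + ((f a * 3 + 1) + (2 + (2 * (Ctx.word a).length + 1))),
    hT.add (((hf.1.mul (.const 3)).add (.const 1)).add ((PolyBdd.const 2).add
      (PolyBdd.wordLength.affine 2 1))), fun a r hr hd => ?_⟩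
  have hseek := run_seek (Ctx.word a) (update r d (f a)) d
  rw [Function.update_self, Function.update_idem] at hseek
  set w := Ctx.word a
  have hhead : (config w (f a) (update r d 0) 0).head? = w[f a]? := by simp [config]
  have htest : Run (ifTop 0 P (push (d + 2) default) (pop (d + 2)))
      (config w (f a) (update r d 0))
      (config w (f a) (update r d (if P w[f a]? then 1 else 0))) 2 := by
    by_cases hP : P w[f a]? = true
    · exact .ifTop_true (by rw [hhead, hP]) ((run_incr ..).congr_config (by simp [hP]) le_rfl)
    · exact .ifTop_false (by simpa [hhead] using hP)
        ((run_decr ..).congr_config (by simp [hP]) le_rfl)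
  exact (hp a r hr hd).seq (hseek.seq (htest.seq (run_rewind w (f a) _)))

end PolyTime

namespace PolyTime

variable {A α β : Type} [Inhabited A] [Ctx A α] [Ctx A β]

theorem var₁ : PolyTime fun c : (α × ℕ) × ℕ => c.1.2 := var₀.weaken
theorem var₂ : PolyTime fun c : ((α × ℕ) × ℕ) × ℕ => c.1.1.2 := var₁.weaken
theorem var₃ : PolyTime fun c : (((α × ℕ) × ℕ) × ℕ) × ℕ => c.1.1.1.2 := var₂.weaken

theorem weaken_under {f : α × ℕ → ℕ} (hf : PolyTime f) :
    PolyTime fun c : (α × ℕ) × ℕ => f (c.1.1, c.2) :=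
  hf.reindex (fun c : (α × ℕ) × ℕ => (c.1.1, c.2)) (fun ρ => ρ.take 1 ++ ρ.drop 2)
    (fun ρ => List.append_subset.2 ⟨List.take_subset _ _, List.drop_subset _ _⟩) (fun _ => rfl)
    (fun b s ρ h => by rw [List.map_append, List.map_take, List.map_drop, h]; simp)
    (fun b => by simp [Ctx.size])

theorem comp_word {f : List A → ℕ → ℕ} (hf : PolyTime fun c : List A × ℕ => f c.1 c.2) {g : α → ℕ}
    (hg : PolyTime g) : PolyTime fun a => f (Ctx.word a) (g a) := by
  have h : PolyTime fun c : α × ℕ => f (Ctx.word c.1) c.2 :=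
    hf.reindex (fun c : α × ℕ => (Ctx.word c.1, c.2)) (List.take 1)
      (fun ρ => List.take_subset 1 ρ) (fun _ => rfl)
      (fun b s ρ h => by rw [List.map_take, h]; simp)
      (fun b => by simp [Ctx.size])
  exact h.bind hg

theorem of_recurrence {g b : α → ℕ} {F : α → ℕ → ℕ} {h : (α × ℕ) × ℕ → ℕ} (hg : PolyTime g)
    (hb : PolyTime b) (hh : PolyTime h) (h0 : ∀ a, F a 0 = g a)
    (hs : ∀ a i, F a (i + 1) = h ((a, i), F a i)) {B : α → ℕ} (hB : PolyBdd B)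
    (hbd : ∀ a, ∀ i ≤ b a, F a i ≤ B a) :
    PolyTime fun a => F a (b a) := by
  have key : ∀ a i, Nat.rec (motive := fun _ => ℕ) (g a) (fun i x => h ((a, i), x)) i = F a i := by
    intro a i
    induction i with
    | zero => exact (h0 a).symm
    | succ i ih => rw [hs, ← ih]
  have := natRec hg hb hh hB (fun a i hi => by rw [key]; exact hbd a i hi)
  simpa only [key] using this

theorem add {f g : α → ℕ} (hf : PolyTime f) (hg : PolyTime g) : PolyTime fun a => f a + g a :=
  of_recurrence (F := fun a i => f a + i) hf hg var₀.succ (fun _ => rfl) (fun _ _ => rfl)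
    (hf.1.add hg.1) (fun a i _ => by omega)

theorem pred {f : α → ℕ} (hf : PolyTime f) : PolyTime fun a => f a - 1 :=
  of_recurrence (F := fun _ i => i - 1) zero hf var₁ (fun _ => rfl) (fun _ _ => rfl)
    hf.1 (fun a i _ => by omega)

theorem sub {f g : α → ℕ} (hf : PolyTime f) (hg : PolyTime g) : PolyTime fun a => f a - g a :=
  of_recurrence (F := fun a i => f a - i) hf hg (pred var₀) (fun _ => rfl) (fun _ _ => rfl)
    hf.1 (fun a i _ => by omega)

theorem mul {f g : α → ℕ} (hf : PolyTime f) (hg : PolyTime g) : PolyTime fun a => f a * g a :=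
  of_recurrence (F := fun a i => f a * i) zero hg (add var₀ hf.weaken.weaken) (fun _ => rfl)
    (fun _ _ => rfl) (hf.1.mul hg.1) (fun _ _ hi => Nat.mul_le_mul_left _ hi)

theorem sum {b : α → ℕ} {g : α → ℕ → ℕ} (hb : PolyTime b)
    (hg : PolyTime fun c : α × ℕ => g c.1 c.2) :
    PolyTime fun a => ∑ i ∈ Finset.range (b a), g a i := by
  obtain ⟨U, hU, hle⟩ := hg.1.exists_bound_forall_le hb.1
  refine of_recurrence (F := fun a n => ∑ i ∈ Finset.range n, g a i) zero hb (add var₀ hg.weaken)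
    (fun _ => rfl) (fun a i => Finset.sum_range_succ (g a) i) (hb.1.mul hU) fun a n hn => ?_
  calc ∑ i ∈ Finset.range n, g a i ≤ ∑ _i ∈ Finset.range n, U a :=
        Finset.sum_le_sum fun i hi => hle a i (by grind)
    _ ≤ b a * U a := by simpa using Nat.mul_le_mul_right _ hn

theorem ite_zero {c f g : α → ℕ} (hc : PolyTime c) (hf : PolyTime f) (hg : PolyTime g) :
    PolyTime fun a => if c a = 0 then f a else g a :=
  of_recurrence (F := fun a i => if i = 0 then f a else g a) hf hc (hg.weaken.weaken) (fun _ => rfl)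
    (fun _ _ => by simp) (hf.1.add hg.1) (fun a i _ => by split <;> omega)

theorem iterate {f : List A → ℕ → ℕ} (hf : PolyTime fun c : List A × ℕ => f c.1 c.2)
    (hlen : ∀ w i, f w i ≤ w.length) {g b : α → ℕ} (hg : PolyTime g) (hb : PolyTime b) :
    PolyTime fun a => (f (Ctx.word a))^[b a] (g a) :=
  of_recurrence (F := fun a n => (f (Ctx.word a))^[n] (g a)) hg hb (comp_word hf var₀)
    (fun _ => rfl) (fun a i => by rw [Function.iterate_succ_apply']; rfl)
    (hg.1.add PolyBdd.wordLength) (fun a i _ => by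
      rcases i with _ | i
      · simp
      · rw [Function.iterate_succ_apply']
        exact (hlen _ _).trans (Nat.le_add_left _ _))

end PolyTime

/-! ### Properties decidable in polynomial time -/

open Classical in
/-- The truth value of a proposition as a number. -/
noncomputable def ind (p : Prop) : ℕ := if p then 1 else 0

@[simp] theorem ind_eq_zero {p : Prop} : ind p = 0 ↔ ¬ p := by simp [ind]

theorem ind_of_true {p : Prop} (h : p) : ind p = 1 := by simp [ind, h]

theorem ind_of_false {p : Prop} (h : ¬ p) : ind p = 0 := by simp [ind, h]

/-- The property `p` can be decided in polynomial time. -/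
def PolyTimePred {A α : Type} [Inhabited A] [Ctx A α] (p : α → Prop) : Prop :=
  PolyTime fun a => ind (p a)

namespace PolyTimePred

variable {A α β : Type} [Inhabited A] [Ctx A α] [Ctx A β] {p q : α → Prop}

theorem of_zero {c : α → ℕ} (hc : PolyTime c) (h : ∀ a, p a ↔ c a = 0) : PolyTimePred p := by
  have := PolyTime.ite_zero hc (PolyTime.const 1) (PolyTime.const 0)
  unfold PolyTimePred
  convert this using 2 with a
  by_cases hp : p a
  · rw [ind_of_true hp, if_pos ((h a).1 hp)]
  · rw [ind_of_false hp, if_neg fun h' => hp ((h a).2 h')]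

theorem not (hp : PolyTimePred p) : PolyTimePred fun a => ¬ p a :=
  of_zero hp fun a => by by_cases h : p a <;> simp [h]

theorem and (hp : PolyTimePred p) (hq : PolyTimePred q) : PolyTimePred fun a => p a ∧ q a :=
  of_zero (hp.not.add hq.not) fun a => by by_cases h : p a <;> by_cases h' : q a <;> simp [h, h']

theorem congr (hp : PolyTimePred p) (h : ∀ a, q a ↔ p a) : PolyTimePred q := by
  have : q = p := funext fun a => propext (h a)
  rwa [this]

theorem or (hp : PolyTimePred p) (hq : PolyTimePred q) : PolyTimePred fun a => p a ∨ q a :=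
  (hp.not.and hq.not).not.congr fun a => by tauto

theorem imp (hp : PolyTimePred p) (hq : PolyTimePred q) : PolyTimePred fun a => p a → q a :=
  (hp.not.or hq).congr fun a => by tauto

theorem iff (hp : PolyTimePred p) (hq : PolyTimePred q) : PolyTimePred fun a => p a ↔ q a :=
  ((hp.imp hq).and (hq.imp hp)).congr fun a => by tauto

theorem const (r : Prop) : PolyTimePred fun _ : α => r := by
  unfold PolyTimePred
  exact PolyTime.const _

theorem le {f g : α → ℕ} (hf : PolyTime f) (hg : PolyTime g) : PolyTimePred fun a => f a ≤ g a :=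
  of_zero (hf.sub hg) fun a => by omega

theorem lt {f g : α → ℕ} (hf : PolyTime f) (hg : PolyTime g) : PolyTimePred fun a => f a < g a :=
  le hf.succ hg

theorem eq {f g : α → ℕ} (hf : PolyTime f) (hg : PolyTime g) : PolyTimePred fun a => f a = g a :=
  ((le hf hg).and (le hg hf)).congr fun a => by omega

theorem letter (P : Option A → Prop) {f : α → ℕ} (hf : PolyTime f) :
    PolyTimePred fun a => P (Ctx.word a)[f a]? := by
  classical
  have := PolyTime.letter (fun o => decide (P o)) hf
  unfold PolyTimePred
  convert this using 2 with a
  simp [ind]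

theorem forall_lt {b : α → ℕ} {r : α → ℕ → Prop} (hb : PolyTime b)
    (hr : PolyTimePred fun c : α × ℕ => r c.1 c.2) :
    PolyTimePred fun a => ∀ i < b a, r a i := by
  refine of_zero (PolyTime.sum (g := fun a i => ind (¬ r a i)) hb hr.not) fun a => ?_
  simp

theorem exists_lt {b : α → ℕ} {r : α → ℕ → Prop} (hb : PolyTime b)
    (hr : PolyTimePred fun c : α × ℕ => r c.1 c.2) :
    PolyTimePred fun a => ∃ i < b a, r a i :=
  (forall_lt (r := fun a i => ¬ r a i) hb hr.not).not.congr fun a => by push Not; rfl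

theorem forall_finite {X : Type} [Finite X] {r : X → α → Prop} (h : ∀ x, PolyTimePred (r x)) :
    PolyTimePred fun a => ∀ x, r x a := by
  have := Fintype.ofFinite X
  classical
  have key : ∀ s : Finset X, PolyTimePred fun a => ∀ x ∈ s, r x a := by
    intro s
    induction s using Finset.induction_on with
    | empty => exact (const True).congr fun a => by simp
    | insert x s _ ih => exact ((h x).and ih).congr fun a => by simp
  exact (key Finset.univ).congr fun a => by simp

end PolyTimePred

theorem PolyTime.ite {A α : Type} [Inhabited A] [Ctx A α] {p : α → Prop} (hp : PolyTimePred p)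
    {f g : α → ℕ} (hf : PolyTime f) (hg : PolyTime g) [∀ a, Decidable (p a)] :
    PolyTime fun a => if p a then f a else g a := by
  convert PolyTime.ite_zero hp hg hf using 2 with a
  by_cases h : p a <;> simp [h]

theorem PolyTimePred.tm2ComputableInPolyTime {A : Type} [Inhabited A] [Finite A]
    {V : List A → Prop} (hV : PolyTimePred V) {α : Type} (ea : α → List A) (f : α → Bool)
    (hf : ∀ a, f a = true ↔ V (ea a)) :
    Nonempty (Turing.TM2ComputableInPolyTime ea encodeBool f) := by
  obtain ⟨p, T, ⟨Q, hQ⟩, hp⟩ := hV.2 [] 0 (by simp)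
  refine Prog.tm2ComputableInPolyTime (.seq p (.seq (.clear 0) (.move 2 0))) ea f
    (Q + (2 * Polynomial.X + 1 + 1)) fun a => ?_
  have hrun := hp (ea a) (fun _ => 0) rfl fun _ _ => rfl
  rw [Ctx.word_list, Prog.config_zero_zero] at hrun
  have hclear := Prog.run_clear 0 (Prog.config (ea a) 0 (update (fun _ => 0) 0 (ind (V (ea a)))))
  have hmove := Prog.Run.move 2 0
    (update (Prog.config (ea a) 0 (update (fun _ => 0) 0 (ind (V (ea a))))) 0 [])
  have houtput : Prog.moveTop 2 0
      (update (Prog.config (ea a) 0 (update (fun _ => 0) 0 (ind (V (ea a))))) 0 []) =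
        update (fun _ => []) 0 (if f a then [default] else []) := by
    funext k
    by_cases hV : V (ea a)
    · rcases k with _ | _ | _ | k <;>
        simp [Prog.moveTop, Prog.config, Prog.unary, ind, (hf a).2 hV, hV]
    · rcases k with _ | _ | _ | k <;>
        simp [Prog.moveTop, Prog.config, Prog.unary, ind, hV, hf]
  rw [houtput] at hmove
  refine (hrun.seq (hclear.seq hmove)).mono ?_
  have hT := hQ (ea a)
  simp only [Ctx.size, Ctx.word_list, Ctx.val_list, List.sum_nil, add_zero] at hT
  simp only [Prog.config, List.drop_zero, Polynomial.eval_add, Polynomial.eval_mul,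
    Polynomial.eval_ofNat, Polynomial.eval_X, Polynomial.eval_one]
  omega

/-- The least number with property `p`, or `b` if there is none below `b`. It is written as a sum
because sums of polynomially many terms are computable in polynomial time. -/
noncomputable def leastBelow (b : ℕ) (p : ℕ → Prop) : ℕ :=
  ∑ i ∈ Finset.range b, ind (∀ j < i + 1, ¬ p j)

theorem leastBelow_eq {b n : ℕ} {p : ℕ → Prop} (hn : n ≤ b) (h : ∀ j < n, ¬ p j) (hp : p n) :
    leastBelow b p = n := by
  have : ∀ i ∈ Finset.range b, ind (∀ j < i + 1, ¬ p j) = if i < n then 1 else 0 := by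
    intro i _
    by_cases hi : i < n
    · rw [if_pos hi, ind_of_true fun j hj => h j (by omega)]
    · rw [if_neg hi, ind_of_false fun h' => h' n (by omega) hp]
  rw [leastBelow, Finset.sum_congr rfl this, ← Finset.sum_filter]
  have hf : (Finset.range b).filter (· < n) = Finset.range n := by
    ext i; simp; omega
  simp [hf]

theorem PolyTime.leastBelow {A α : Type} [Inhabited A] [Ctx A α] {b : α → ℕ} {p : α → ℕ → Prop}
    (hb : PolyTime b) (hp : PolyTimePred fun c : α × ℕ => p c.1 c.2) :
    PolyTime fun a => leastBelow (b a) (p a) := by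
  refine PolyTime.sum (g := fun a i => ind (∀ j < i + 1, ¬ p a j)) hb ?_
  refine PolyTimePred.forall_lt (r := fun (c : α × ℕ) j => ¬ p c.1 j) var₀.succ
    (PolyTimePred.not ?_)
  exact PolyTime.weaken_under hp

/-! ### Reading encoded objects at a position of a word -/

section Parse

variable {Δ : Type}

instance : Inhabited (Γ' ⊕ Δ) := ⟨Sum.inl default⟩

/-- The symbol at position `i` is `γ`. -/
def LetterAt (w : List (Γ' ⊕ Δ)) (i : ℕ) (γ : Γ') : Prop := w[i]? = some (Sum.inl γ)

/-- The word `l` occurs at position `i`. -/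
def OccursAt (w : List (Γ' ⊕ Δ)) : ℕ → List Γ' → Prop
  | _, [] => True
  | i, a :: l => LetterAt w i a ∧ OccursAt w (i + 1) l

theorem occursAt_append {w : List (Γ' ⊕ Δ)} {i : ℕ} {l₁ l₂ : List Γ'} :
    OccursAt w i (l₁ ++ l₂) ↔ OccursAt w i l₁ ∧ OccursAt w (i + l₁.length) l₂ := by
  induction l₁ generalizing i with
  | nil => simp [OccursAt]
  | cons a l ih => simp [OccursAt, ih, and_assoc, Nat.add_assoc, Nat.add_comm 1]

theorem OccursAt.le_length {w : List (Γ' ⊕ Δ)} {i : ℕ} {l : List Γ'} (h : OccursAt w i l)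
    (hl : l ≠ []) :
    i + l.length ≤ w.length := by
  induction l generalizing i with
  | nil => exact absurd rfl hl
  | cons a l ih =>
    have h1 : i < w.length := (List.getElem?_eq_some_iff.1 h.1).1
    rcases l with _ | ⟨b, l⟩
    · simpa using h1
    · have := ih h.2 (by simp)
      simp at this ⊢
      omega

theorem occursAt_of_append (l : List Γ') (u v : List (Γ' ⊕ Δ)) :
    OccursAt (u ++ (l.map Sum.inl ++ v)) u.length l := by
  induction l generalizing u with
  | nil => trivial
  | cons a l ih =>
    refine ⟨by simp [LetterAt], ?_⟩
    have := ih (u ++ [Sum.inl a])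
    simpa using this

/-- At an occurrence of the word `e`, the function `skip` gives the position after it; the word `e`
does not start with a closing bracket, so that it is told apart from the end of a list. -/
structure Skips (Δ : Type) (skip : List (Γ' ⊕ Δ) → ℕ → ℕ) (e : List Γ') : Prop where
  ne_nil : e ≠ []
  head_ne : e.head? ≠ some Γ'.ket
  eq : ∀ w i, OccursAt w i e → skip w i = i + e.length

theorem OccursAt.not_ket {w : List (Γ' ⊕ Δ)} {i : ℕ} {l : List Γ'} (h : OccursAt w i l)
    (hl : l ≠ []) (hk : l.head? ≠ some Γ'.ket) : ¬ LetterAt w i Γ'.ket := by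
  rcases l with _ | ⟨a, l⟩
  · exact absurd rfl hl
  · have := h.1
    unfold LetterAt at *
    rw [this]
    simpa using hk

theorem Skips.append {s₁ s₂ : List (Γ' ⊕ Δ) → ℕ → ℕ} {e₁ e₂ : List Γ'} (h₁ : Skips Δ s₁ e₁)
    (h₂ : Skips Δ s₂ e₂) : Skips Δ (fun w i => s₂ w (s₁ w i)) (e₁ ++ e₂) where
  ne_nil := by simp [h₁.ne_nil]
  head_ne := by
    have := h₁.ne_nil
    have := h₁.head_ne
    rcases e₁ with _ | ⟨a, l⟩
    · contradiction
    · simpa using this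
  eq w i h := by
    rw [occursAt_append] at h
    rw [h₁.eq w i h.1, h₂.eq w _ h.2, List.length_append, Nat.add_assoc]

theorem Skips.split {s : List (Γ' ⊕ Δ) → ℕ → ℕ} {e₁ e₂ : List Γ'} (h : Skips Δ s e₁)
    {w : List (Γ' ⊕ Δ)} {i : ℕ} (h' : OccursAt w i (e₁ ++ e₂)) :
    OccursAt w i e₁ ∧ OccursAt w (s w i) e₂ := by
  rw [occursAt_append] at h'
  rw [h.eq w i h'.1]
  exact h'

/-- The position after one symbol. -/
def skipOne (_ : List (Γ' ⊕ Δ)) (i : ℕ) : ℕ := i + 1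

theorem skips_skipOne (b : Bool) : Skips Δ skipOne [Γ'.bit b] :=
  ⟨by simp, by simp, fun _ _ _ => rfl⟩

/-- The number written at position `i`. -/
noncomputable def numAt (w : List (Γ' ⊕ Δ)) (i : ℕ) : ℕ :=
  leastBelow w.length fun j => ¬ LetterAt w (i + j) (Γ'.bit true)

/-- The position after a number. -/
noncomputable def skipNat (w : List (Γ' ⊕ Δ)) (i : ℕ) : ℕ := i + numAt w i + 1

theorem encNat_ne_nil (n : ℕ) : encNat n ≠ [] := by simp [encNat]

@[simp] theorem length_encNat (n : ℕ) : (encNat n).length = n + 1 := by simp [encNat]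

theorem forall_letterAt_of_occursAt_replicate {w : List (Γ' ⊕ Δ)} {i n : ℕ} {γ : Γ'}
    (h : OccursAt w i (List.replicate n γ)) :
    ∀ j < n, LetterAt w (i + j) γ := by
  induction n generalizing i with
  | zero => simp
  | succ n ih =>
    intro j hj
    rcases j with _ | j
    · exact h.1
    · have := ih h.2 j (by omega)
      rwa [Nat.add_assoc, Nat.add_comm 1 j] at this

theorem numAt_eq {w : List (Γ' ⊕ Δ)} {i n : ℕ} (h : OccursAt w i (encNat n)) : numAt w i = n := by
  have hl := h.le_length (encNat_ne_nil n)
  rw [length_encNat] at hl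
  unfold encNat at h
  rw [occursAt_append, List.length_replicate] at h
  refine leastBelow_eq (by omega)
    (fun j hj => not_not.2 (forall_letterAt_of_occursAt_replicate h.1 j hj)) ?_
  have := h.2.1
  unfold LetterAt at *
  rw [this]
  simp

theorem skips_skipNat (n : ℕ) : Skips Δ skipNat (encNat n) where
  ne_nil := encNat_ne_nil n
  head_ne := by cases n <;> simp [encNat, List.replicate_succ]
  eq w i h := by rw [skipNat, numAt_eq h, length_encNat, Nat.add_assoc]

/-- The position of the `j`-th item of the list at position `i`. -/
def nthAt (skip : List (Γ' ⊕ Δ) → ℕ → ℕ) (w : List (Γ' ⊕ Δ)) (i j : ℕ) : ℕ :=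
  (fun x => min (skip w x) w.length)^[j] (i + 1)

/-- The length of the list at position `i`. -/
noncomputable def countAt (skip : List (Γ' ⊕ Δ) → ℕ → ℕ) (w : List (Γ' ⊕ Δ)) (i : ℕ) : ℕ :=
  leastBelow w.length fun j => LetterAt w (nthAt skip w i j) Γ'.ket

/-- The position after a list. -/
noncomputable def skipList (skip : List (Γ' ⊕ Δ) → ℕ → ℕ) (w : List (Γ' ⊕ Δ)) (i : ℕ) : ℕ :=
  nthAt skip w i (countAt skip w i) + 1

section EncodedList

variable {α : Type} {e : α → List Γ'} {l : List α} {skip : List (Γ' ⊕ Δ) → ℕ → ℕ}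
  {w : List (Γ' ⊕ Δ)} {i : ℕ}

theorem length_encList : (encList e l).length = (l.flatMap e).length + 2 := by
  simp [encList]

theorem occursAt_flatMap_drop (h : OccursAt w i (encList e l)) (j : ℕ) :
    OccursAt w (i + 1 + ((l.take j).flatMap e).length) ((l.drop j).flatMap e ++ [Γ'.ket]) := by
  rw [encList, List.append_assoc, occursAt_append] at h
  have h2 := h.2
  rw [← List.take_append_drop j l, List.flatMap_append, List.append_assoc, occursAt_append] at h2
  exact h2.2

theorem nthAt_eq (hs : ∀ x ∈ l, Skips Δ skip (e x)) (h : OccursAt w i (encList e l)) {j : ℕ}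
    (hj : j ≤ l.length) : nthAt skip w i j = i + 1 + ((l.take j).flatMap e).length := by
  induction j with
  | zero => simp [nthAt]
  | succ j ih =>
    have ih := ih (by omega)
    have h1 := occursAt_flatMap_drop h j
    rw [List.drop_eq_getElem_cons hj, List.flatMap_cons, List.append_assoc, occursAt_append] at h1
    have hx := hs l[j] (List.getElem_mem _)
    have hlen := h1.1.le_length hx.ne_nil
    unfold nthAt at ih ⊢
    rw [Function.iterate_succ_apply', ih, hx.eq w _ h1.1, min_eq_left hlen,
      List.take_succ_eq_append_getElem hj, List.flatMap_append, List.length_append,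
      List.flatMap_singleton]
    omega

theorem occursAt_nthAt (hs : ∀ x ∈ l, Skips Δ skip (e x)) (h : OccursAt w i (encList e l)) {j : ℕ}
    (hj : j < l.length) : OccursAt w (nthAt skip w i j) (e l[j]) := by
  have h1 := occursAt_flatMap_drop h j
  rw [List.drop_eq_getElem_cons hj, List.flatMap_cons, List.append_assoc, occursAt_append] at h1
  rw [nthAt_eq hs h hj.le]
  exact h1.1

theorem length_le_flatMap (hs : ∀ x ∈ l, e x ≠ []) : l.length ≤ (l.flatMap e).length := by
  induction l with
  | nil => simp
  | cons a l ih =>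
    have h1 := ih fun x hx => hs x (List.mem_cons_of_mem _ hx)
    have h2 := List.length_pos_iff.2 (hs a List.mem_cons_self)
    simp only [List.flatMap_cons, List.length_append, List.length_cons]
    omega

theorem encList_ne_nil : encList e l ≠ [] := by simp [encList]

theorem countAt_eq (hs : ∀ x ∈ l, Skips Δ skip (e x)) (h : OccursAt w i (encList e l)) :
    countAt skip w i = l.length := by
  refine leastBelow_eq ?_ (fun j hj => ?_) ?_
  · have h1 := h.le_length encList_ne_nil
    rw [length_encList] at h1
    have h2 := length_le_flatMap (e := e) fun x hx => (hs x hx).ne_nil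
    omega
  · have hx := hs l[j] (List.getElem_mem _)
    exact (occursAt_nthAt hs h hj).not_ket hx.ne_nil hx.head_ne
  · have h1 := occursAt_flatMap_drop h l.length
    rw [nthAt_eq hs h le_rfl]
    simp only [List.drop_length, List.flatMap_nil, List.nil_append] at h1
    exact h1.1

theorem skips_skipList (hs : ∀ x ∈ l, Skips Δ skip (e x)) :
    Skips Δ (skipList skip) (encList e l) where
  ne_nil := encList_ne_nil
  head_ne := by simp [encList]
  eq w i h := by
    rw [skipList, countAt_eq hs h, nthAt_eq hs h le_rfl, length_encList, List.take_length]
    omega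

end EncodedList

theorem skips_encSubset {m : ℕ} (s : Finset (Fin m)) : Skips Δ (skipList skipOne) (encSubset s) :=
  skips_skipList fun _ _ => skips_skipOne _

/-- The `q`-th bit of the bit string at position `i`. -/
def BitAt (w : List (Γ' ⊕ Δ)) (i q : ℕ) : Prop := LetterAt w (nthAt skipOne w i q) (Γ'.bit true)

theorem bitAt_iff {m : ℕ} {s : Finset (Fin m)} {w : List (Γ' ⊕ Δ)} {i : ℕ}
    (h : OccursAt w i (encSubset s)) (q : Fin m) : BitAt w i q ↔ q ∈ s := by
  have := (occursAt_nthAt (skip := skipOne) (fun _ _ => skips_skipOne _) h (j := q) (by simp)).1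
  unfold BitAt
  unfold LetterAt at *
  rw [this]
  simp

theorem occursAt_nthAt_finRange {n : ℕ} {e : Fin n → List Γ'} {skip : List (Γ' ⊕ Δ) → ℕ → ℕ}
    {w : List (Γ' ⊕ Δ)} {i : ℕ} (hs : ∀ x, Skips Δ skip (e x))
    (h : OccursAt w i (encList e (List.finRange n))) (q : Fin n) :
    OccursAt w (nthAt skip w i q) (e q) := by
  simpa using occursAt_nthAt (fun x _ => hs x) h (j := q) (by simp)

variable {α : Type} [Ctx (Γ' ⊕ Δ) α] {f g : α → ℕ} {skip : List (Γ' ⊕ Δ) → ℕ → ℕ}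

theorem PolyTimePred.letterAt (γ : Γ') (hf : PolyTime f) :
    PolyTimePred fun a => LetterAt (Ctx.word a) (f a) γ :=
  PolyTimePred.letter (fun o => o = some (Sum.inl γ)) hf

theorem PolyTime.numAt (hf : PolyTime f) : PolyTime fun a => numAt (Ctx.word a) (f a) :=
  PolyTime.leastBelow (p := fun a j => ¬ LetterAt (Ctx.word a) (f a + j) (Γ'.bit true)) wordLength
    (PolyTimePred.not (PolyTimePred.letterAt _ (hf.weaken.add var₀)))

/-- `skip` is computable in polynomial time. -/
def PolyTimeSkip (skip : List (Γ' ⊕ Δ) → ℕ → ℕ) : Prop :=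
  PolyTime fun c : List (Γ' ⊕ Δ) × ℕ => skip c.1 c.2

theorem PolyTimeSkip.polyTime (h : PolyTimeSkip skip) (hf : PolyTime f) :
    PolyTime fun a => skip (Ctx.word a) (f a) :=
  PolyTime.comp_word h hf

theorem PolyTimeSkip.one : PolyTimeSkip (skipOne (Δ := Δ)) := PolyTime.var₀.succ

theorem PolyTimeSkip.nat : PolyTimeSkip (skipNat (Δ := Δ)) :=
  (PolyTime.var₀.add (PolyTime.numAt PolyTime.var₀)).succ

theorem PolyTime.nthAt (h : PolyTimeSkip skip) (hf : PolyTime f) (hg : PolyTime g) :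
    PolyTime fun a => nthAt skip (Ctx.word a) (f a) (g a) :=
  PolyTime.iterate (f := fun w x => min (skip w x) w.length)
    ((PolyTime.ite (PolyTimePred.le h PolyTime.wordLength) h PolyTime.wordLength :
      PolyTime fun c : List (Γ' ⊕ Δ) × ℕ => if skip c.1 c.2 ≤ c.1.length then skip c.1 c.2
        else c.1.length)) (fun _ _ => min_le_right _ _) hf.succ hg

theorem PolyTime.countAt (h : PolyTimeSkip skip) (hf : PolyTime f) :
    PolyTime fun a => countAt skip (Ctx.word a) (f a) :=
  PolyTime.leastBelow (p := fun a j =>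
    LetterAt (Ctx.word a) (TemporalLearning.nthAt skip (Ctx.word a) (f a) j)
    Γ'.ket) wordLength (PolyTimePred.letterAt _ (PolyTime.nthAt h hf.weaken var₀))

theorem PolyTimeSkip.list (h : PolyTimeSkip skip) : PolyTimeSkip (skipList skip) :=
  (PolyTime.nthAt h PolyTime.var₀ (PolyTime.countAt h PolyTime.var₀)).succ

theorem PolyTimePred.bitAt (hf : PolyTime f) (hg : PolyTime g) :
    PolyTimePred fun a => BitAt (Ctx.word a) (f a) (g a) :=
  PolyTimePred.letterAt _ (PolyTime.nthAt PolyTimeSkip.one hf hg)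

end Parse

/-! ### Path formulas -/

/-- The semantics of weak until; release and globally are expressed through it. -/
def weakSem (f g : ℕ → Prop) : Prop := untilSem f g ∨ ∀ i, f i

theorem untilSem_true {f : ℕ → Prop} : untilSem (fun _ => True) f ↔ ∃ i, f i := by
  simp [untilSem]

theorem weakSem_false {f : ℕ → Prop} : weakSem f (fun _ => False) ↔ ∀ i, f i := by
  simp [weakSem, untilSem]

theorem releaseSem_and_exists_iff {f g : ℕ → Prop} :
    releaseSem f g ∧ (∃ i, f i) ↔ untilSem g fun i => f i ∧ g i := by
  classical
  unfold releaseSem untilSem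
  push Not
  constructor
  · rintro ⟨h, hf⟩
    have hg : ∀ j ≤ Nat.find hf, g j := by
      intro j hj
      by_contra hgj
      obtain ⟨l, hl, hfl⟩ := h j hgj
      exact Nat.find_min hf (by omega) hfl
    exact ⟨Nat.find hf, ⟨Nat.find_spec hf, hg _ le_rfl⟩, fun j hj => hg j hj.le⟩
  · rintro ⟨i, ⟨hf, hg⟩, hlt⟩
    refine ⟨fun j hj => ⟨i, ?_, hf⟩, i, hf⟩
    by_contra hij
    rcases Nat.lt_or_ge j i with h | h
    · exact hj (hlt j h)
    · exact hj ((show j = i by omega) ▸ hg)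

theorem releaseSem_iff_weakSem {f g : ℕ → Prop} :
    releaseSem f g ↔ weakSem g fun i => f i ∧ g i := by
  by_cases hf : ∃ i, f i
  · constructor
    · exact fun h => Or.inl (releaseSem_and_exists_iff.1 ⟨h, hf⟩)
    · rintro (h | h)
      · exact (releaseSem_and_exists_iff.2 h).1
      · rintro ⟨i, hi, -⟩
        exact hi (h i)
  · have hrelease : releaseSem f g ↔ ∀ i, g i := by
      unfold releaseSem untilSem
      push Not at hf ⊢
      constructor
      · intro h i
        by_contra hi
        obtain ⟨j, -, hj⟩ := h i hi
        exact hf j hj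
      · exact fun h i hi => absurd (h i) hi
    rw [hrelease]
    constructor
    · exact Or.inr
    · rintro (⟨i, hi, -⟩ | h)
      · exact absurd ⟨i, hi.1⟩ hf
      · exact h

theorem untilSem_succ {f g : ℕ → Prop} (h : f 0) (h' : untilSem (fun i => f (i + 1))
    (fun i => g (i + 1))) : untilSem f g := by
  obtain ⟨i, hi, hlt⟩ := h'
  refine ⟨i + 1, hi, fun j hj => ?_⟩
  rcases j with _ | j
  · exact h
  · exact hlt j (by omega)

theorem weakSem_tail {f g : ℕ → Prop} (h0 : ¬ g 0) (h : weakSem f g) :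
    f 0 ∧ weakSem (fun i => f (i + 1)) (fun i => g (i + 1)) := by
  rcases h with ⟨i, hi, hlt⟩ | h
  · rcases i with _ | i
    · exact absurd hi h0
    · exact ⟨hlt 0 (by omega), Or.inl ⟨i, hi, fun j hj => hlt (j + 1) (by omega)⟩⟩
  · exact ⟨h 0, Or.inr fun i => h (i + 1)⟩

/-! ### Strategies and fixed points -/

namespace CGS

variable {k : ℕ} {P : Type} (C : CGS k P)

/-- The coalition `A` can force the next state into `S`. -/
def pre (A : Finset (Fin k)) (S : C.Q → Prop) (q : C.Q) : Prop :=
  ∃ α : (a : Fin k) → a ∈ A → Fin (C.d q a), ∀ q' ∈ C.succ A q α, S q'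

variable {C}

theorem pre_mono {A : Finset (Fin k)} {S T : C.Q → Prop} (h : ∀ q, S q → T q) {q : C.Q}
    (hq : C.pre A S q) : C.pre A T q :=
  let ⟨α, hα⟩ := hq
  ⟨α, fun q' hq' => h q' (hα q' hq')⟩

theorem succ_nonempty (A : Finset (Fin k)) (q : C.Q) (α : (a : Fin k) → a ∈ A → Fin (C.d q a)) :
    (C.succ A q α).Nonempty := by
  classical
  exact ⟨_, fun a => if h : a ∈ A then α a h else ⟨0, C.d_pos q a⟩,
    fun a ha => by simp [ha], rfl⟩

/-- The play from `q` in which the next state is chosen from the history and the current state; each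
position is stored together with its history. -/
def play (next : List C.Q → C.Q → C.Q) (q : C.Q) : ℕ → List C.Q × C.Q
  | 0 => ([], q)
  | i + 1 => ((play next q i).1 ++ [(play next q i).2],
      next (play next q i).1 (play next q i).2)

theorem play_fst (next : List C.Q → C.Q → C.Q) (q : C.Q) (i : ℕ) :
    (play next q i).1 = (List.range i).map fun j => (play next q j).2 := by
  induction i with
  | zero => rfl
  | succ i ih => rw [List.range_succ, List.map_append, ← ih]; rfl

theorem exists_mem_out_of_next {A : Finset (Fin k)} (s : (a : Fin k) → a ∈ A → C.Strategy a)
    (q : C.Q) (next : List C.Q → C.Q → C.Q)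
    (hn : ∀ h x, next h x ∈ C.succ A x fun a ha => s a ha h x) :
    ∃ ρ ∈ C.out A s q, ∀ i, ρ (i + 1) = next ((List.range i).map ρ) (ρ i) := by
  have key : ∀ i, (play next q (i + 1)).2 =
      next ((List.range i).map fun j => (play next q j).2) (play next q i).2 := by
    intro i
    rw [← play_fst]
    rfl
  refine ⟨fun i => (play next q i).2, ⟨rfl, fun i => ?_⟩, key⟩
  beta_reduce
  rw [key]
  exact hn _ _

theorem enforces_next {A : Finset (Fin k)} {S : C.Q → Prop} {q : C.Q} :
    C.Enforces A q {ρ | S (ρ 1)} ↔ C.pre A S q := by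
  classical
  constructor
  · rintro ⟨s, hs⟩
    refine ⟨fun a ha => s a ha [] q, fun q' hq' => ?_⟩
    obtain ⟨ρ, hρ, hnext⟩ := exists_mem_out_of_next s q
      (fun h x => if h = [] ∧ x = q then q' else (succ_nonempty A x fun a ha => s a ha h x).some)
      (fun h x => by
        split_ifs with hx
        · obtain ⟨rfl, rfl⟩ := hx
          exact hq'
        · exact (succ_nonempty A x fun a ha => s a ha h x).some_mem)
    have h1 := hnext 0
    rw [hρ.1] at h1
    simp only [List.range_zero, List.map_nil, true_and, if_true, zero_add] at h1
    have h2 : S (ρ 1) := hs ρ hρ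
    rwa [h1] at h2
  · rintro ⟨α, hα⟩
    refine ⟨fun a ha _ x => if h : x = q then h ▸ α a ha else ⟨0, C.d_pos x a⟩, fun ρ hρ => ?_⟩
    have h0 := hρ.1
    subst h0
    have := hρ.2 0
    simp only [dite_true] at this
    exact hα _ this

theorem out_tail {A : Finset (Fin k)} {s : (a : Fin k) → a ∈ A → C.Strategy a} {q : C.Q}
    {ρ : ℕ → C.Q} (hρ : ρ ∈ C.out A s q) :
    (fun i => ρ (i + 1)) ∈ C.out A (fun a ha h x => s a ha (q :: h) x) (ρ 1) := by
  refine ⟨rfl, fun i => ?_⟩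
  have := hρ.2 (i + 1)
  rw [List.range_succ_eq_map, List.map_cons, hρ.1, List.map_map] at this
  exact this

theorem out_cons {A : Finset (Fin k)} {s : (a : Fin k) → a ∈ A → C.Strategy a} {q q' : C.Q}
    (hq' : q' ∈ C.succ A q fun a ha => s a ha [] q) {ρ : ℕ → C.Q}
    (hρ : ρ ∈ C.out A (fun a ha h x => s a ha (q :: h) x) q') :
    (fun i => Nat.casesOn i q ρ) ∈ C.out A s q := by
  refine ⟨rfl, fun i => ?_⟩
  rcases i with _ | i
  · have : ρ 0 = q' := hρ.1
    simpa [this] using hq'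
  · have := hρ.2 i
    rw [List.range_succ_eq_map, List.map_cons, List.map_map]
    exact this

theorem enforces_until_of_pre {A : Finset (Fin k)} {S T : C.Q → Prop} {q : C.Q} (hS : S q)
    (h : C.pre A (fun q' => C.Enforces A q' {ρ | untilSem (fun i => S (ρ i)) fun i => T (ρ i)}) q) :
    C.Enforces A q {ρ | untilSem (fun i => S (ρ i)) fun i => T (ρ i)} := by
  classical
  obtain ⟨α, hα⟩ := h
  choose s hs using hα
  let dflt : (a : Fin k) → a ∈ A → C.Strategy a := fun a _ _ x => ⟨0, C.d_pos x a⟩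
  let r : C.Q → (a : Fin k) → a ∈ A → C.Strategy a := fun q' =>
    if h : q' ∈ C.succ A q α then s q' h else dflt
  refine ⟨fun a ha h x => match h with
    | [] => if h : x = q then h ▸ α a ha else ⟨0, C.d_pos x a⟩
    | _ :: h' => r ((h' ++ [x]).head (by simp)) a ha h' x, fun ρ hρ => ?_⟩
  have h0 := hρ.1
  subst h0
  have h1 : ρ 1 ∈ C.succ A (ρ 0) α := by
    have := hρ.2 0
    simpa using this
  have h2 : (fun i => ρ (i + 1)) ∈ C.out A (r (ρ 1)) (ρ 1) := by
    refine ⟨rfl, fun i => ?_⟩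
    have h3 := (out_tail hρ).2 i
    have h4 : ((List.range i).map (fun i => ρ (i + 1)) ++ [ρ (i + 1)]).head (by simp) = ρ 1 := by
      rcases i with _ | i
      · rfl
      · simp [List.range_succ_eq_map]
    simp only [h4] at h3
    exact h3
  simp only [r, h1, dite_true] at h2
  exact untilSem_succ hS (hs _ h1 _ h2)

theorem of_enforces_until {A : Finset (Fin k)} {S T Z : C.Q → Prop} {q : C.Q}
    (h : C.Enforces A q {ρ | untilSem (fun i => S (ρ i)) fun i => T (ρ i)})
    (hZ : ∀ x, T x ∨ S x ∧ C.pre A Z x → Z x) : Z q := by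
  obtain ⟨s, hs⟩ := h
  by_contra hq
  have hescape : ∀ (h : List C.Q) (x : C.Q), ∃ y ∈ C.succ A x fun a ha => s a ha h x,
      S x ∧ ¬ Z x → ¬ Z y := by
    intro h x
    by_cases hx : S x ∧ ¬ Z x
    · by_contra! hcon
      refine hx.2 (hZ x (Or.inr ⟨hx.1, fun a ha => s a ha h x, fun y hy => ?_⟩))
      exact (hcon y hy).2
    · obtain ⟨y, hy⟩ := succ_nonempty A x fun a ha => s a ha h x
      exact ⟨y, hy, fun h => absurd h hx⟩
  choose next hsucc hnotMem using hescape
  obtain ⟨ρ, hρ, hnext⟩ := exists_mem_out_of_next s q next hsucc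
  obtain ⟨i, hi, hlt⟩ := hs ρ hρ
  have havoid : ∀ j ≤ i, ¬ Z (ρ j) := by
    intro j
    induction j with
    | zero => intro _; rwa [hρ.1]
    | succ j ih =>
      intro hj
      rw [hnext]
      exact hnotMem _ _ ⟨hlt j hj, ih (by omega)⟩
  exact havoid i le_rfl (hZ _ (Or.inl hi))

theorem enforces_until {A : Finset (Fin k)} {S T : C.Q → Prop} {q : C.Q} :
    C.Enforces A q {ρ | untilSem (fun i => S (ρ i)) fun i => T (ρ i)} ↔
      ∀ Z : C.Q → Prop, (∀ x, T x ∨ S x ∧ C.pre A Z x → Z x) → Z q := by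
  refine ⟨fun h Z hZ => of_enforces_until h hZ, fun h => ?_⟩
  refine h (fun x => C.Enforces A x {ρ | untilSem (fun i => S (ρ i)) fun i => T (ρ i)}) ?_
  rintro x (hT | ⟨hS, hpre⟩)
  · exact ⟨fun a _ _ x => ⟨0, C.d_pos x a⟩, fun ρ hρ =>
      ⟨0, by beta_reduce; rw [hρ.1]; exact hT, fun j hj => absurd hj (by omega)⟩⟩
  · exact enforces_until_of_pre hS hpre

theorem pre_of_enforces_weak {A : Finset (Fin k)} {S T : C.Q → Prop} {x : C.Q} (hT : ¬ T x)
    (h : C.Enforces A x {ρ | weakSem (fun i => S (ρ i)) fun i => T (ρ i)}) :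
    S x ∧
      C.pre A (fun y => C.Enforces A y {ρ | weakSem (fun i => S (ρ i)) fun i => T (ρ i)}) x := by
  obtain ⟨s, hs⟩ := h
  refine ⟨?_, fun a ha => s a ha [] x, fun y hy => ?_⟩
  · obtain ⟨ρ, hρ, -⟩ := exists_mem_out_of_next s x _
      (fun h y => (succ_nonempty A y fun a ha => s a ha h y).some_mem)
    have := (weakSem_tail (by rw [hρ.1]; exact hT) (hs ρ hρ)).1
    rwa [hρ.1] at this
  · refine ⟨fun a ha h z => s a ha (x :: h) z, fun ρ hρ => ?_⟩
    exact (weakSem_tail hT (hs _ (out_cons hy hρ))).2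

theorem enforces_weak_of_invariant {A : Finset (Fin k)} {S T Z : C.Q → Prop} {q : C.Q}
    (hZ : ∀ x, Z x → T x ∨ S x ∧ C.pre A Z x) (hq : Z q) :
    C.Enforces A q {ρ | weakSem (fun i => S (ρ i)) fun i => T (ρ i)} := by
  classical
  have hstay : ∀ x : C.Q, ∃ α : (a : Fin k) → a ∈ A → Fin (C.d x a),
      Z x → ¬ T x → ∀ y ∈ C.succ A x α, Z y := by
    intro x
    by_cases hx : Z x ∧ ¬ T x
    · obtain ⟨α, hα⟩ := ((hZ x hx.1).resolve_left hx.2).2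
      exact ⟨α, fun _ _ => hα⟩
    · exact ⟨fun a _ => ⟨0, C.d_pos x a⟩, fun h h' => absurd ⟨h, h'⟩ hx⟩
  choose α hα using hstay
  refine ⟨fun a ha _ x => α x a ha, fun ρ hρ => ?_⟩
  have hinv : ∀ i, (∀ j < i, ¬ T (ρ j)) → Z (ρ i) := by
    intro i
    induction i with
    | zero => intro _; rwa [hρ.1]
    | succ i ih =>
      intro h
      exact hα (ρ i) (ih fun j hj => h j (by omega)) (h i (by omega)) _ (hρ.2 i)
  by_cases hT : ∃ i, T (ρ i)
  · refine Or.inl ⟨Nat.find hT, Nat.find_spec hT, fun j hj => ?_⟩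
    exact ((hZ _ (hinv j fun l hl => Nat.find_min hT (by omega))).resolve_left
      (Nat.find_min hT hj)).1
  · push Not at hT
    exact Or.inr fun i => ((hZ _ (hinv i fun j _ => hT j)).resolve_left (hT i)).1

theorem enforces_weak {A : Finset (Fin k)} {S T : C.Q → Prop} {q : C.Q} :
    C.Enforces A q {ρ | weakSem (fun i => S (ρ i)) fun i => T (ρ i)} ↔
      ∃ Z : C.Q → Prop, (∀ x, Z x → T x ∨ S x ∧ C.pre A Z x) ∧ Z q := by
  constructor
  · intro h
    refine ⟨fun x => C.Enforces A x {ρ | weakSem (fun i => S (ρ i)) fun i => T (ρ i)}, ?_, h⟩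
    exact fun x hx => or_iff_not_imp_left.2 fun hT => pre_of_enforces_weak hT hx
  · rintro ⟨Z, hZ, hq⟩
    exact enforces_weak_of_invariant hZ hq

end CGS

section Iterate

variable {α : Type*} [Finite α] {H : Set α → Set α}

theorem isFixedPt_iterate_empty (hH : Monotone H) :
    Function.IsFixedPt H (H^[Nat.card α] ∅) := by
  have hmono : Monotone fun i => H^[i] ∅ := hH.monotone_iterate_of_le_map (Set.empty_subset _)
  have hbound (i : ℕ) : (H^[i] ∅).ncard ≤ Nat.card α := Set.ncard_le_card _
  have heq_of_ncard {i : ℕ} (h : (H^[i] ∅).ncard = (H^[i + 1] ∅).ncard) :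
      H^[i] ∅ = H^[i + 1] ∅ :=
    Set.eq_of_subset_of_ncard_le (hmono i.le_succ) h.ge (Set.toFinite _)
  have hstable : (H^[Nat.card α + 1] ∅).ncard = (H^[Nat.card α] ∅).ncard := by
    refine Nat.stabilises_of_monotone (fun i j hij => Set.ncard_le_ncard (hmono hij)) hbound
      (fun i h => ?_) (Nat.le_succ _)
    change (H^[i + 1] ∅).ncard = (H^[i + 1 + 1] ∅).ncard
    rw [Function.iterate_succ_apply' H (i + 1), ← heq_of_ncard h,
      ← Function.iterate_succ_apply' H i, ← heq_of_ncard h]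
  rw [Function.IsFixedPt, ← Function.iterate_succ_apply' H]
  exact (heq_of_ncard hstable.symm).symm

theorem mem_iterate_empty_iff (hH : Monotone H) {q : α} :
    q ∈ H^[Nat.card α] ∅ ↔ ∀ Z : Set α, H Z ⊆ Z → q ∈ Z := by
  refine ⟨fun h Z hZ => ?_, fun h => h _ (isFixedPt_iterate_empty hH).le⟩
  have hsub : ∀ i, H^[i] ∅ ⊆ Z := by
    intro i
    induction i with
    | zero => exact Set.empty_subset _
    | succ i ih =>
      rw [Function.iterate_succ_apply']
      exact (hH ih).trans hZ
  exact hsub _ h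

theorem mem_iterate_univ_iff (hH : Monotone H) {q : α} :
    q ∈ H^[Nat.card α] Set.univ ↔ ∃ Z : Set α, Z ⊆ H Z ∧ q ∈ Z := by
  have hH' : Monotone fun Z : Set α => (H Zᶜ)ᶜ :=
    fun Z W h => Set.compl_subset_compl.2 (hH (Set.compl_subset_compl.2 h))
  have hi : ∀ i, (fun Z : Set α => (H Zᶜ)ᶜ)^[i] ∅ = (H^[i] Set.univ)ᶜ := by
    intro i
    induction i with
    | zero => simp
    | succ i ih => rw [Function.iterate_succ_apply', Function.iterate_succ_apply', ih, compl_compl]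
  have := mem_iterate_empty_iff hH' (q := q)
  rw [hi, Set.mem_compl_iff] at this
  rw [← not_iff_not, this]
  push Not
  constructor
  · intro h Z hZ hq
    exact h Zᶜ (by rw [compl_compl]; exact Set.compl_subset_compl.2 hZ) hq
  · intro h Z hZ
    by_contra hq
    exact h Zᶜ (Set.compl_subset_comm.1 hZ) hq

end Iterate

/-- The outermost operators of `ATL^k` formulas. -/
inductive NodeOp (k : ℕ)
  | prop
  | neg
  | lg (o : BinLg)
  | un (A : Finset (Fin k)) (o : UnTp)
  | tp (A : Finset (Fin k)) (o : BinTp)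

namespace NodeOp

variable {k : ℕ}

/-- The formula with the given outermost operator; unused arguments are ignored. -/
def toFormula {P : Type} (p : P) (φ ψ : ATL k P) : NodeOp k → ATL k P
  | prop => .prop p
  | neg => .neg φ
  | lg o => .lg o φ ψ
  | un A o => .un A o φ
  | tp A o => .tp A o φ ψ

/-- The truth value at the start of the iteration. -/
def start : NodeOp k → Prop
  | un _ .G => True
  | tp _ .R => True
  | tp _ .W => True
  | _ => False

/-- One step of the iteration, from the truth values of the proposition and of the operands at a
state, and from whether the coalition can force the left operand, or the current iterate, in one
step. -/
def step (lab φ ψ : Prop) (preφ preZ : Finset (Fin k) → Prop) : NodeOp k → Prop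
  | prop => lab
  | neg => ¬ φ
  | lg o => o.eval φ ψ
  | un A .X => preφ A
  | un A .F => φ ∨ preZ A
  | un A .G => φ ∧ preZ A
  | tp A .U => ψ ∨ (φ ∧ preZ A)
  | tp A .R => ψ ∧ (φ ∨ preZ A)
  | tp A .W => ψ ∨ (φ ∧ preZ A)
  | tp A .M => ψ ∧ (φ ∨ preZ A)

end NodeOp

namespace CGS

variable {k : ℕ} {P : Type} (C : CGS k P)

/-- The fixed-point iterates for an operator, whose proposition and operands have the truth values
`lab`, `φ` and `ψ`. -/
def iter (op : NodeOp k) (lab φ ψ : C.Q → Prop) : ℕ → C.Q → Prop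
  | 0 => fun _ => op.start
  | i + 1 => fun q => op.step (lab q) (φ q) (ψ q) (fun A => C.pre A φ q)
      fun A => C.pre A (iter op lab φ ψ i) q

/-- The operator on sets of states whose least and greatest fixed points are the states from which
the coalition `A` enforces `S U T` and `S W T`, respectively. -/
def expand (A : Finset (Fin k)) (S T : C.Q → Prop) (Z : Set C.Q) : Set C.Q :=
  {q | T q ∨ S q ∧ C.pre A (· ∈ Z) q}

variable {C} {A : Finset (Fin k)} {S T : C.Q → Prop}

theorem expand_mono : Monotone (C.expand A S T) := fun _ _ h _ hq =>
  hq.imp_right fun hq => ⟨hq.1, pre_mono (fun _ hx => h hx) hq.2⟩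

theorem iterate_expand {Z : ℕ → C.Q → Prop}
    (hs : ∀ i q, Z (i + 1) q ↔ T q ∨ S q ∧ C.pre A (Z i) q) (i : ℕ) :
    (C.expand A S T)^[i] {q | Z 0 q} = {q | Z i q} := by
  induction i with
  | zero => rfl
  | succ i ih =>
    rw [Function.iterate_succ_apply', ih]
    exact Set.ext fun q => (hs i q).symm

theorem numStates_iff_enforces_until {Z : ℕ → C.Q → Prop} (h0 : ∀ q, ¬ Z 0 q)
    (hs : ∀ i q, Z (i + 1) q ↔ T q ∨ S q ∧ C.pre A (Z i) q) (q : C.Q) :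
    Z C.numStates q ↔ C.Enforces A q {ρ | untilSem (fun i => S (ρ i)) fun i => T (ρ i)} := by
  have hiter := iterate_expand hs (Nat.card C.Q)
  rw [Set.eq_empty_of_forall_notMem (s := {q | Z 0 q}) h0] at hiter
  have hfix := mem_iterate_empty_iff (expand_mono (A := A) (S := S) (T := T)) (q := q)
  rw [hiter, Nat.card_fin] at hfix
  rw [enforces_until]
  exact hfix

theorem numStates_iff_enforces_weak {Z : ℕ → C.Q → Prop} (h0 : ∀ q, Z 0 q)
    (hs : ∀ i q, Z (i + 1) q ↔ T q ∨ S q ∧ C.pre A (Z i) q) (q : C.Q) :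
    Z C.numStates q ↔ C.Enforces A q {ρ | weakSem (fun i => S (ρ i)) fun i => T (ρ i)} := by
  have hiter := iterate_expand hs (Nat.card C.Q)
  rw [Set.eq_univ_of_forall (s := {q | Z 0 q}) h0] at hiter
  have hfix := mem_iterate_univ_iff (expand_mono (A := A) (S := S) (T := T)) (q := q)
  rw [hiter, Nat.card_fin] at hfix
  rw [enforces_weak]
  exact hfix

theorem iter_of_pos (op : NodeOp k) (lab φ ψ : C.Q → Prop) {i : ℕ} (hi : 0 < i) (q : C.Q) :
    C.iter op lab φ ψ i q ↔ op.step (lab q) (φ q) (ψ q) (fun A => C.pre A φ q)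
      fun A => C.pre A (C.iter op lab φ ψ (i - 1)) q := by
  obtain ⟨i, rfl⟩ := Nat.exists_eq_succ_of_ne_zero hi.ne'
  rfl

theorem iter_numStates (op : NodeOp k) (p : P) (φ ψ : ATL k P) (q : C.Q) :
    C.iter op (fun q => p ∈ C.label q) (φ.SatAt C.label C.Enforces) (ψ.SatAt C.label C.Enforces)
      C.numStates q ↔ (op.toFormula p φ ψ).SatAt C.label C.Enforces q := by
  have hpos : 0 < C.numStates := q.pos
  cases op with
  | prop => exact iter_of_pos _ _ _ _ hpos q
  | neg => exact iter_of_pos _ _ _ _ hpos q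
  | lg o => exact iter_of_pos _ _ _ _ hpos q
  | un A o =>
    cases o with
    | X => exact (iter_of_pos _ _ _ _ hpos q).trans enforces_next.symm
    | F =>
      refine (numStates_iff_enforces_until (A := A) (S := fun _ => True)
        (T := φ.SatAt C.label C.Enforces) (fun _ h => h) (fun i q => ?_) q).trans ?_
      · simp only [true_and]; rfl
      · simp only [untilSem_true]; rfl
    | G =>
      refine (numStates_iff_enforces_weak (A := A) (S := φ.SatAt C.label C.Enforces)
        (T := fun _ => False) (fun _ => trivial) (fun i q => ?_) q).trans ?_
      · simp only [false_or]; rfl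
      · simp only [weakSem_false]; rfl
  | tp A o =>
    cases o with
    | U =>
      exact numStates_iff_enforces_until (A := A) (fun _ h => h) (fun i q => Iff.rfl) q
    | R =>
      refine (numStates_iff_enforces_weak (A := A) (S := ψ.SatAt C.label C.Enforces)
        (T := fun q => φ.SatAt C.label C.Enforces q ∧ ψ.SatAt C.label C.Enforces q)
        (fun _ => trivial) (fun i q => ?_) q).trans ?_
      · simp only [iter, NodeOp.step]; tauto
      · simp only [← releaseSem_iff_weakSem]; rfl
    | W =>
      exact numStates_iff_enforces_weak (A := A) (fun _ => trivial) (fun i q => Iff.rfl) q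
    | M =>
      refine (numStates_iff_enforces_until (A := A) (S := ψ.SatAt C.label C.Enforces)
        (T := fun q => φ.SatAt C.label C.Enforces q ∧ ψ.SatAt C.label C.Enforces q)
        (fun _ h => h) (fun i q => ?_) q).trans ?_
      · simp only [iter, NodeOp.step]; tauto
      · simp only [← releaseSem_and_exists_iff]; rfl

end CGS

/-! ### Sub-formulas -/

namespace NodeOp

variable {k : ℕ}

/-- The operator is a proposition. -/
def IsProp : NodeOp k → Prop
  | prop => True
  | _ => False

/-- The operator is binary. -/
def IsBin : NodeOp k → Prop
  | lg _ => True
  | tp _ _ => True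
  | _ => False

/-- The operator is allowed in the fragment. -/
def InFragment (Ut : Set UnOp) (Bt : Set BinTp) (Bl : Set BinLg) : NodeOp k → Prop
  | prop => True
  | neg => UnOp.neg ∈ Ut
  | lg o => o ∈ Bl
  | un _ o => UnOp.tp o ∈ Ut
  | tp _ o => o ∈ Bt

theorem eq_prop_of_isProp {op : NodeOp k} (h : op.IsProp) : op = prop := by
  cases op <;> first | rfl | exact absurd h id

theorem step_congr {op : NodeOp k} (h : ¬ op.IsProp) (lab lab' φ ψ : Prop)
    (preφ preZ : Finset (Fin k) → Prop) :
    op.step lab φ ψ preφ preZ = op.step lab' φ ψ preφ preZ := by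
  cases op with
  | prop => exact absurd trivial h
  | un A o | tp A o => cases o <;> rfl
  | _ => rfl

end NodeOp

theorem CGS.iter_congr {k : ℕ} {P : Type} (C : CGS k P) {op : NodeOp k} (h : ¬ op.IsProp)
    (lab lab' φ ψ : C.Q → Prop) (i : ℕ) : C.iter op lab φ ψ i = C.iter op lab' φ ψ i := by
  induction i with
  | zero => rfl
  | succ i ih =>
    funext q
    rw [iter, iter, ih]
    exact NodeOp.step_congr h _ _ _ _ _ _

namespace ATL

section Operators

variable {k : ℕ} {P : Type}

/-- The outermost operator. -/
def op : ATL k P → NodeOp k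
  | prop _ => .prop
  | neg _ => .neg
  | lg o _ _ => .lg o
  | un A o _ => .un A o
  | tp A o _ _ => .tp A o

/-- The left or only operand; a proposition is its own operand. -/
def left : ATL k P → ATL k P
  | prop p => prop p
  | neg φ => φ
  | lg _ φ _ => φ
  | un _ _ φ => φ
  | tp _ _ φ _ => φ

/-- The right or only operand; a proposition is its own operand. -/
def right : ATL k P → ATL k P
  | prop p => prop p
  | neg φ => φ
  | lg _ _ φ => φ
  | un _ _ φ => φ
  | tp _ _ _ φ => φ

theorem exists_eq_prop {φ : ATL k P} (h : φ.op.IsProp) : ∃ p, φ = prop p := by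
  cases φ <;> first | exact ⟨_, rfl⟩ | exact absurd h id

theorem sizeOf_left_lt [SizeOf P] {φ : ATL k P} (h : ¬ φ.op.IsProp) :
    sizeOf φ.left < sizeOf φ := by
  cases φ <;> simp [left, op, NodeOp.IsProp] at h ⊢ <;> omega

theorem sizeOf_right_lt [SizeOf P] {φ : ATL k P} (h : ¬ φ.op.IsProp) :
    sizeOf φ.right < sizeOf φ := by
  cases φ <;> simp [right, op, NodeOp.IsProp] at h ⊢

theorem isBin_iff (φ : ATL k P) : φ.isBin = true ↔ φ.op.IsBin := by
  cases φ <;> simp [isBin, op, NodeOp.IsBin]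

theorem InFragment.op {Ut : Set UnOp} {Bt : Set BinTp} {Bl : Set BinLg} {φ : ATL k P}
    (h : φ.InFragment Ut Bt Bl) : φ.op.InFragment Ut Bt Bl := by
  cases φ with
  | prop p => trivial
  | _ => exact h.1

theorem op_toFormula (op : NodeOp k) (p : P) (φ ψ : ATL k P) : (op.toFormula p φ ψ).op = op := by
  cases op <;> rfl

theorem toFormula_op {φ : ATL k P} (h : ¬ φ.op.IsProp) (p : P) :
    φ.op.toFormula p φ.left φ.right = φ := by
  cases φ <;> first | rfl | exact absurd trivial h

end Operators

variable {k : ℕ} {P : Type} [DecidableEq P]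

theorem self_mem_subF (φ : ATL k P) : φ ∈ φ.subF := by
  cases φ <;> simp [subF]

theorem subF_subset {φ ψ : ATL k P} (h : ψ ∈ φ.subF) : ψ.subF ⊆ φ.subF := by
  induction φ with
  | prop p =>
    simp only [subF, Finset.mem_singleton] at h
    rw [h]
  | neg φ ih | un A o φ ih =>
    simp only [subF, Finset.mem_insert] at h
    rcases h with rfl | h
    · rfl
    · exact (ih h).trans (Finset.subset_insert _ _)
  | lg o φ χ ih₁ ih₂ | tp A o φ χ ih₁ ih₂ =>
    simp only [subF, Finset.mem_insert, Finset.mem_union] at h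
    rcases h with rfl | h | h
    · rfl
    · exact ((ih₁ h).trans Finset.subset_union_left).trans (Finset.subset_insert _ _)
    · exact ((ih₂ h).trans Finset.subset_union_right).trans (Finset.subset_insert _ _)

theorem InFragment.of_mem_subF {Ut : Set UnOp} {Bt : Set BinTp} {Bl : Set BinLg} {φ ψ : ATL k P}
    (h : φ.InFragment Ut Bt Bl) (hψ : ψ ∈ φ.subF) : ψ.InFragment Ut Bt Bl := by
  induction φ with
  | prop p =>
    simp only [subF, Finset.mem_singleton] at hψ
    rwa [hψ]
  | neg φ ih | un A o φ ih =>
    simp only [subF, Finset.mem_insert] at hψ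
    rcases hψ with rfl | hψ
    · exact h
    · exact ih h.2 hψ
  | lg o φ χ ih₁ ih₂ | tp A o φ χ ih₁ ih₂ =>
    simp only [subF, Finset.mem_insert, Finset.mem_union] at hψ
    rcases hψ with rfl | hψ | hψ
    · exact h
    · exact ih₁ h.2.1 hψ
    · exact ih₂ h.2.2 hψ

theorem left_mem_subF {φ ψ : ATL k P} (h : ψ ∈ φ.subF) : ψ.left ∈ φ.subF :=
  subF_subset h (by cases ψ <;> simp [left, subF, self_mem_subF])

theorem right_mem_subF {φ ψ : ATL k P} (h : ψ ∈ φ.subF) : ψ.right ∈ φ.subF :=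
  subF_subset h (by cases ψ <;> simp [right, subF, self_mem_subF])

end ATL

/-! ### Formulas as directed acyclic graphs -/

/-- A sequence of operators with pointers `l` and `r` to their left and right operands; for a
proposition, `l` is its index. -/
structure Dag (k : ℕ) where
  op : ℕ → NodeOp k
  l : ℕ → ℕ
  r : ℕ → ℕ

namespace Dag

variable {k m : ℕ} (D : Dag k)

/-- The pointers of node `i` lead to earlier nodes or to a proposition. -/
def NodeOK (m i : ℕ) : Prop :=
  ((D.op i).IsProp → D.l i < m) ∧ (¬ (D.op i).IsProp → D.l i < i ∧ D.r i < i)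

/-- The proposition with a given index, or proposition `0` if the index is out of range. -/
def propOfIndex (hm : 0 < m) (x : ℕ) : Fin m := if h : x < m then ⟨x, h⟩ else ⟨0, hm⟩

/-- The nodes below `B` represent the formulas `f i`. -/
def Represents (hm : 0 < m) (B : ℕ) (f : ℕ → ATL k (Fin m)) : Prop :=
  ∀ i < B, D.NodeOK m i ∧
    f i = (D.op i).toFormula (propOfIndex hm (D.l i)) (f (D.l i)) (f (D.r i))

/-- The formula that a node represents; pointers that do not lead to an earlier node are replaced
by proposition `0`. -/
def formula (hm : 0 < m) (i : ℕ) : ATL k (Fin m) :=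
  (D.op i).toFormula (propOfIndex hm (D.l i))
    (if _h : D.l i < i then formula hm (D.l i) else .prop ⟨0, hm⟩)
    (if _h : D.r i < i then formula hm (D.r i) else .prop ⟨0, hm⟩)
termination_by i

/-- The truth value at `q` of the proposition that node `i` points to. -/
def Labelled (C : CGS k (Fin m)) (i : ℕ) (q : C.Q) : Prop :=
  ∃ h : D.l i < m, ⟨D.l i, h⟩ ∈ C.label q

/-- The table `T` satisfies the local equations between the truth values of the iterates of the
nodes: `T i j q` is the value at `q` of the `j`-th iterate of node `i`. -/
def TableOK (C : CGS k (Fin m)) (B : ℕ) (T : ℕ → ℕ → C.Q → Prop) : Prop :=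
  ∀ i < B, ∀ q, (T i 0 q ↔ (D.op i).start) ∧ ∀ j < C.numStates, T i (j + 1) q ↔
    (D.op i).step (D.Labelled C i q) (T (D.l i) C.numStates q)
      (T (D.r i) C.numStates q) (fun A => C.pre A (T (D.l i) C.numStates) q)
      (fun A => C.pre A (T i j) q)

variable {D} {hm : 0 < m} {B : ℕ}

theorem represents_formula (h : ∀ i < B, D.NodeOK m i) : D.Represents hm B (D.formula hm) := by
  intro i hi
  refine ⟨h i hi, ?_⟩
  rw [formula]
  by_cases hp : (D.op i).IsProp
  · rw [NodeOp.eq_prop_of_isProp hp]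
    rfl
  · obtain ⟨hl, hr⟩ := (h i hi).2 hp
    rw [dif_pos hl, dif_pos hr]

namespace Represents

variable {f : ℕ → ATL k (Fin m)} (hf : D.Represents hm B f)

include hf

theorem op_eq {i : ℕ} (hi : i < B) : (f i).op = D.op i := by
  rw [(hf i hi).2, ATL.op_toFormula]

theorem subF_subset {i : ℕ} (hi : i < B) : (f i).subF ⊆ (Finset.range B).image f := by
  induction i using Nat.strong_induction_on with
  | _ i ih =>
    have hself : f i ∈ (Finset.range B).image f := Finset.mem_image_of_mem f (by simpa using hi)
    have hl (hp : ¬ (D.op i).IsProp) : (f (D.l i)).subF ⊆ (Finset.range B).image f :=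
      have hlt := ((hf i hi).1.2 hp).1
      ih _ hlt (hlt.trans hi)
    have hr (hp : ¬ (D.op i).IsProp) : (f (D.r i)).subF ⊆ (Finset.range B).image f :=
      have hlt := ((hf i hi).1.2 hp).2
      ih _ hlt (hlt.trans hi)
    have heq := (hf i hi).2
    rw [heq] at hself ⊢
    cases hop : D.op i with
    | prop =>
      rw [hop] at hself
      simpa [NodeOp.toFormula, ATL.subF] using hself
    | neg | un A o =>
      rw [hop] at hself hl
      exact Finset.insert_subset hself (hl id)
    | lg o | tp A o =>
      rw [hop] at hself hl hr
      exact Finset.insert_subset hself (Finset.union_subset (hl id) (hr id))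

theorem size_le {i : ℕ} (hi : i < B) : (f i).size ≤ B :=
  (Finset.card_le_card (hf.subF_subset hi)).trans
    (Finset.card_image_le.trans (Finset.card_range B).le)

theorem numBin_le {i : ℕ} (hi : i < B) :
    (f i).numBin ≤ ∑ i ∈ Finset.range B, ind (D.op i).IsBin := by
  classical
  have hsub : (f i).subF.filter (fun ψ => ψ.isBin) ⊆
      ((Finset.range B).filter fun i => (D.op i).IsBin).image f := by
    intro ψ hψ
    rw [Finset.mem_filter] at hψ
    obtain ⟨j, hj, rfl⟩ := Finset.mem_image.1 (hf.subF_subset hi hψ.1)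
    refine Finset.mem_image_of_mem f (Finset.mem_filter.2 ⟨hj, ?_⟩)
    rw [← hf.op_eq (Finset.mem_range.1 hj), ← ATL.isBin_iff]
    exact hψ.2
  refine ((Finset.card_le_card hsub).trans Finset.card_image_le).trans ?_
  rw [Finset.card_filter]
  refine Finset.sum_le_sum fun i _ => ?_
  unfold ind
  split <;> simp_all

theorem inFragment {Ut : Set UnOp} {Bt : Set BinTp} {Bl : Set BinLg}
    (h : ∀ i < B, (D.op i).InFragment Ut Bt Bl) {i : ℕ} (hi : i < B) :
    (f i).InFragment Ut Bt Bl := by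
  induction i using Nat.strong_induction_on with
  | _ i ih =>
    have hl (hp : ¬ (D.op i).IsProp) : (f (D.l i)).InFragment Ut Bt Bl :=
      have hlt := ((hf i hi).1.2 hp).1
      ih _ hlt (hlt.trans hi)
    have hr (hp : ¬ (D.op i).IsProp) : (f (D.r i)).InFragment Ut Bt Bl :=
      have hlt := ((hf i hi).1.2 hp).2
      ih _ hlt (hlt.trans hi)
    have ho := h i hi
    rw [(hf i hi).2]
    cases hop : D.op i with
    | prop => trivial
    | neg | un A o =>
      rw [hop] at ho hl
      exact ⟨ho, hl id⟩
    | lg o | tp A o =>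
      rw [hop] at ho hl hr
      exact ⟨ho, hl id, hr id⟩

theorem iter_numStates_iff (C : CGS k (Fin m)) {i : ℕ} (hi : i < B) (q : C.Q) :
    C.iter (D.op i) (D.Labelled C i) ((f (D.l i)).SatAt C.label C.Enforces)
      ((f (D.r i)).SatAt C.label C.Enforces) C.numStates q ↔
      (f i).SatAt C.label C.Enforces q := by
  rw [(hf i hi).2, ← CGS.iter_numStates]
  by_cases hp : (D.op i).IsProp
  · have hlt := (hf i hi).1.1 hp
    rw [CGS.iter_of_pos _ _ _ _ q.pos, CGS.iter_of_pos _ _ _ _ q.pos,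
      NodeOp.eq_prop_of_isProp hp]
    simp [NodeOp.step, Labelled, propOfIndex, hlt]
  · rw [C.iter_congr hp]

theorem table_iff {C : CGS k (Fin m)} {T : ℕ → ℕ → C.Q → Prop} (hT : D.TableOK C B T) {i : ℕ}
    (hi : i < B) (q : C.Q) : T i C.numStates q ↔ (f i).SatAt C.label C.Enforces q := by
  induction i using Nat.strong_induction_on generalizing q with
  | _ i ih =>
    have hiter : ∀ j ≤ C.numStates, ∀ q, T i j q ↔
        C.iter (D.op i) (D.Labelled C i) ((f (D.l i)).SatAt C.label C.Enforces)
          ((f (D.r i)).SatAt C.label C.Enforces) j q := by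
      intro j hj
      induction j with
      | zero => exact fun q => (hT i hi q).1
      | succ j ihj =>
        intro q
        have hprev : T i j = _ := funext fun q => propext (ihj (by omega) q)
        rw [(hT i hi q).2 j hj, CGS.iter, ← hprev]
        by_cases hp : (D.op i).IsProp
        · rw [NodeOp.eq_prop_of_isProp hp]
          rfl
        · obtain ⟨hl, hr⟩ := (hf i hi).1.2 hp
          have hleft : T (D.l i) C.numStates = _ :=
            funext fun q => propext (ih _ hl (hl.trans hi) q)
          have hright : T (D.r i) C.numStates = _ :=
            funext fun q => propext (ih _ hr (hr.trans hi) q)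
          rw [hleft, hright]
    rw [hiter _ le_rfl, hf.iter_numStates_iff C hi]

theorem tableOK (C : CGS k (Fin m)) : D.TableOK C B fun i =>
    C.iter (D.op i) (D.Labelled C i) ((f (D.l i)).SatAt C.label C.Enforces)
      ((f (D.r i)).SatAt C.label C.Enforces) := by
  intro i hi q
  refine ⟨Iff.rfl, fun j _ => ?_⟩
  beta_reduce
  rw [CGS.iter]
  by_cases hp : (D.op i).IsProp
  · rw [NodeOp.eq_prop_of_isProp hp]
    rfl
  · obtain ⟨hl, hr⟩ := (hf i hi).1.2 hp
    rw [funext fun q => propext (hf.iter_numStates_iff C (hl.trans hi) q),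
      funext fun q => propext (hf.iter_numStates_iff C (hr.trans hi) q)]

end Represents

end Dag

theorem exists_equiv_fin_monotone {α : Type*} (s : Finset α) (μ : α → ℕ) :
    ∃ e : Fin s.card ≃ s, Monotone fun i => μ (e i) :=
  ⟨(Tuple.sort fun i => μ (s.equivFin.symm i)).trans s.equivFin.symm,
    Tuple.monotone_sort fun i => μ (s.equivFin.symm i)⟩

namespace ATL

variable {k m : ℕ}

/-- The sequence `f` lists the sub-formulas of `φ` by increasing size, with inverse `rank`; it may
contain further propositions. -/
structure Enumerates (φ : ATL k (Fin m)) (B : ℕ) (f : ℕ → ATL k (Fin m))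
    (rank : ATL k (Fin m) → ℕ) : Prop where
  mem_subF {i : ℕ} : ¬ (f i).op.IsProp → f i ∈ φ.subF
  rank_apply {i : ℕ} : ¬ (f i).op.IsProp → rank (f i) = i
  apply_rank {ψ : ATL k (Fin m)} : ψ ∈ φ.subF → f (rank ψ) = ψ
  rank_lt {ψ : ATL k (Fin m)} : ψ ∈ φ.subF → rank ψ < B
  rank_le (ψ : ATL k (Fin m)) : rank ψ ≤ B
  rank_lt_rank {ψ χ : ATL k (Fin m)} :
    ψ ∈ φ.subF → χ ∈ φ.subF → sizeOf ψ < sizeOf χ → rank ψ < rank χ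

theorem exists_enumerates (hm : 0 < m) {φ : ATL k (Fin m)} {B : ℕ} (hB : φ.size ≤ B) :
    ∃ f rank, φ.Enumerates B f rank := by
  obtain ⟨e, he⟩ := exists_equiv_fin_monotone φ.subF fun ψ => sizeOf ψ
  let f : ℕ → ATL k (Fin m) := fun i =>
    if h : i < φ.size then e ⟨i, h⟩ else .prop ⟨0, hm⟩
  let rank : ATL k (Fin m) → ℕ := fun ψ => if h : ψ ∈ φ.subF then e.symm ⟨ψ, h⟩ else 0
  have rank_of_mem {ψ} (h : ψ ∈ φ.subF) : rank ψ = e.symm ⟨ψ, h⟩ := dif_pos h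
  have lt_of_not_isProp {i} (h : ¬ (f i).op.IsProp) : i < φ.size := by
    by_contra hi
    exact h (by simp only [f, dif_neg hi]; trivial)
  have f_of_lt {i} (h : i < φ.size) : f i = e ⟨i, h⟩ := dif_pos h
  have rank_lt {ψ} (h : ψ ∈ φ.subF) : rank ψ < φ.size := rank_of_mem h ▸ (e.symm ⟨ψ, h⟩).isLt
  refine ⟨f, rank, fun h => ?_, fun h => ?_, fun h => ?_, fun h => (rank_lt h).trans_le hB,
    fun ψ => ?_, fun {ψ χ} hψ hχ hlt => ?_⟩
  · rw [f_of_lt (lt_of_not_isProp h)]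
    exact (e _).2
  · rw [f_of_lt (lt_of_not_isProp h), rank_of_mem (e _).2]
    simp
  · rw [f_of_lt (rank_lt h)]
    simp [rank_of_mem h]
  · by_cases h : ψ ∈ φ.subF
    · exact (rank_lt h).le.trans hB
    · simp [rank, h]
  · rw [rank_of_mem hψ, rank_of_mem hχ, Fin.val_fin_lt]
    exact he.reflect_lt (by simpa using hlt)

/-- The left pointer of a formula in a graph: the index of a proposition, otherwise the rank of the
left operand. -/
def leftPointer (rank : ATL k (Fin m) → ℕ) : ATL k (Fin m) → ℕ
  | prop p => p
  | φ => rank φ.left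

theorem leftPointer_of_not_isProp {φ : ATL k (Fin m)} (h : ¬ φ.op.IsProp)
    (rank : ATL k (Fin m) → ℕ) : φ.leftPointer rank = rank φ.left := by
  cases φ <;> first | rfl | exact absurd trivial h

/-- The graph whose node `i` carries the formula `f i`, where the operands are found by `rank`. -/
def toDag (f : ℕ → ATL k (Fin m)) (rank : ATL k (Fin m) → ℕ) : Dag k where
  op i := (f i).op
  l i := (f i).leftPointer rank
  r i := rank (f i).right

namespace Enumerates

variable {φ : ATL k (Fin m)} {B : ℕ} {f : ℕ → ATL k (Fin m)} {rank : ATL k (Fin m) → ℕ}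
  (h : φ.Enumerates B f rank)

include h

theorem represents (hm : 0 < m) : (toDag f rank).Represents hm B f := by
  intro i _
  by_cases hp : (f i).op.IsProp
  · obtain ⟨p, hfi⟩ := exists_eq_prop hp
    refine ⟨⟨fun _ => ?_, fun hnp => absurd hp hnp⟩, ?_⟩ <;>
      simp [toDag, hfi, leftPointer, op, NodeOp.toFormula, Dag.propOfIndex]
  · have hleft := left_mem_subF (h.mem_subF hp)
    have hright := right_mem_subF (h.mem_subF hp)
    have hptr : (toDag f rank).l i = rank (f i).left := leftPointer_of_not_isProp hp rank
    refine ⟨⟨fun hp' => absurd hp' hp, fun _ => ?_⟩, ?_⟩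
    · rw [hptr]
      have hleft_lt := h.rank_lt_rank hleft (h.mem_subF hp) (sizeOf_left_lt hp)
      have hright_lt := h.rank_lt_rank hright (h.mem_subF hp) (sizeOf_right_lt hp)
      rw [h.rank_apply hp] at hleft_lt hright_lt
      exact ⟨hleft_lt, hright_lt⟩
    · rw [hptr, h.apply_rank hleft]
      simp only [toDag]
      rw [h.apply_rank hright, toFormula_op hp]

theorem sum_isBin_le : ∑ i ∈ Finset.range B, ind ((toDag f rank).op i).IsBin ≤ φ.numBin := by
  classical
  have not_isProp {i} (hb : (f i).op.IsBin) : ¬ (f i).op.IsProp := fun hp => by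
    rw [NodeOp.eq_prop_of_isProp hp] at hb
    exact hb
  have hcard : ∑ i ∈ Finset.range B, ind ((toDag f rank).op i).IsBin =
      ((Finset.range B).filter fun i => (f i).op.IsBin).card := by
    rw [Finset.card_filter]
    exact Finset.sum_congr rfl fun i _ => if_congr Iff.rfl rfl rfl
  rw [hcard]
  refine Finset.card_le_card_of_injOn f (fun i hi => ?_) (fun i hi j hj hij => ?_)
  · have hb := (Finset.mem_filter.1 hi).2
    exact Finset.mem_coe.2 (Finset.mem_filter.2 ⟨h.mem_subF (not_isProp hb), (isBin_iff _).2 hb⟩)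
  · rw [← h.rank_apply (not_isProp (Finset.mem_filter.1 hi).2), hij,
      h.rank_apply (not_isProp (Finset.mem_filter.1 hj).2)]

theorem l_le (i : ℕ) : (toDag f rank).l i ≤ m + B := by
  change (f i).leftPointer rank ≤ m + B
  by_cases hp : (f i).op.IsProp
  · obtain ⟨p, hfi⟩ := exists_eq_prop hp
    rw [hfi]
    exact p.2.le.trans (Nat.le_add_right _ _)
  · rw [leftPointer_of_not_isProp hp]
    exact (h.rank_le _).trans (Nat.le_add_left _ _)

theorem op_inFragment {Ut : Set UnOp} {Bt : Set BinTp} {Bl : Set BinLg}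
    (hφ : φ.InFragment Ut Bt Bl) (i : ℕ) : ((toDag f rank).op i).InFragment Ut Bt Bl := by
  change (f i).op.InFragment Ut Bt Bl
  by_cases hp : (f i).op.IsProp
  · rw [NodeOp.eq_prop_of_isProp hp]
    trivial
  · exact (hφ.of_mem_subF (h.mem_subF hp)).op

end Enumerates

theorem exists_represents (hm : 0 < m) {φ : ATL k (Fin m)} {B : ℕ} (hB : φ.size ≤ B) :
    ∃ (D : Dag k) (f : ℕ → ATL k (Fin m)), D.Represents hm B f ∧ (∃ i < B, f i = φ) ∧
      ∑ i ∈ Finset.range B, ind (D.op i).IsBin ≤ φ.numBin ∧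
      (∀ i, D.l i ≤ m + B ∧ D.r i ≤ m + B) ∧
      ∀ Ut Bt Bl, φ.InFragment Ut Bt Bl → ∀ i < B, (D.op i).InFragment Ut Bt Bl := by
  obtain ⟨f, rank, h⟩ := exists_enumerates hm hB
  exact ⟨toDag f rank, f, h.represents hm,
    ⟨rank φ, h.rank_lt φ.self_mem_subF, h.apply_rank φ.self_mem_subF⟩, h.sum_isBin_le,
    fun i => ⟨h.l_le i, (h.rank_le _).trans (Nat.le_add_left _ _)⟩,
    fun _ _ _ hφ i _ => h.op_inFragment hφ i⟩

end ATL

open PolyTime (var₀ var₁ var₂ var₃)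

/-! ### Certificates and their verification -/

instance : Finite UnTp := by
  refine Finite.of_surjective (fun i : Fin 3 => ([.X, .F, .G] : List UnTp)[i]) fun x => ?_
  cases x
  exacts [⟨0, rfl⟩, ⟨1, rfl⟩, ⟨2, rfl⟩]

instance : Finite BinTp := by
  refine Finite.of_surjective (fun i : Fin 4 => ([.U, .R, .W, .M] : List BinTp)[i]) fun x => ?_
  cases x
  exacts [⟨0, rfl⟩, ⟨1, rfl⟩, ⟨2, rfl⟩, ⟨3, rfl⟩]

instance : Finite BinLg := by
  refine Finite.of_surjective (fun i : Fin 10 => ([.or, .and, .impl, .conv, .iff, .nor, .nand,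
    .nimpl, .nconv, .niff] : List BinLg)[i]) fun x => ?_
  cases x
  exacts [⟨0, rfl⟩, ⟨1, rfl⟩, ⟨2, rfl⟩, ⟨3, rfl⟩, ⟨4, rfl⟩, ⟨5, rfl⟩, ⟨6, rfl⟩, ⟨7, rfl⟩,
    ⟨8, rfl⟩, ⟨9, rfl⟩]

instance (k : ℕ) : Finite (NodeOp k) := by
  refine Finite.of_surjective (fun x : Bool ⊕ BinLg ⊕ (Finset (Fin k) × UnTp) ⊕
      (Finset (Fin k) × BinTp) => match x with
    | .inl true => NodeOp.prop
    | .inl false => .neg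
    | .inr (.inl o) => .lg o
    | .inr (.inr (.inl x)) => .un x.1 x.2
    | .inr (.inr (.inr x)) => .tp x.1 x.2) fun x => ?_
  cases x with
  | prop => exact ⟨.inl true, rfl⟩
  | neg => exact ⟨.inl false, rfl⟩
  | lg o => exact ⟨.inr (.inl o), rfl⟩
  | un A o => exact ⟨.inr (.inr (.inl (A, o))), rfl⟩
  | tp A o => exact ⟨.inr (.inr (.inr (A, o))), rfl⟩

/-- The symbols of certificates: an operator, marks that give the two pointers of a node in unary,
and an entry of the table of truth values. -/
structure Cell (k : ℕ) where
  op : NodeOp k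
  l : Prop
  r : Prop
  t : Prop

instance (k : ℕ) : Finite (Cell k) :=
  Finite.of_surjective (fun x : NodeOp k × Prop × Prop × Prop => ⟨x.1, x.2.1, x.2.2.1, x.2.2.2⟩)
    fun x => ⟨(x.op, x.l, x.r, x.t), rfl⟩

/-- Words that consist of an encoded input and a certificate. -/
abbrev CertWord (k : ℕ) : Type := List (Γ' ⊕ Cell k)

/-- The cell at a position, with a default value for positions that hold no cell. -/
def cell {k : ℕ} : Option (Γ' ⊕ Cell k) → Cell k
  | some (Sum.inr c) => c
  | _ => ⟨.prop, False, False, False⟩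

section CellAt

variable {k : ℕ}

/-- The cell for node `i`, step `j`, model `M` and state `q`, in a certificate that starts at
position `L`. The position is the number with digits `i`, `j`, `M`, `q` in base `L`, since the
length `L` of the encoded input exceeds all four indices. -/
def cellAt (w : CertWord k) (L i j M q : ℕ) : Cell k :=
  cell w[L + (((i * L + j) * L + M) * L + q)]?

/-- The directed acyclic graph described by a certificate that starts at position `L`. -/
noncomputable def certDag (w : CertWord k) (L : ℕ) : Dag k where
  op i := (cellAt w L i 0 0 0).op
  l i := ∑ q ∈ Finset.range L, ind (cellAt w L i 0 0 q).l
  r i := ∑ q ∈ Finset.range L, ind (cellAt w L i 0 0 q).r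

variable {α : Type} [Ctx (Γ' ⊕ Cell k) α] {L i : α → ℕ}

theorem PolyTimePred.cellAt (P : Cell k → Prop) {j M q : α → ℕ} (hL : PolyTime L) (hi : PolyTime i)
    (hj : PolyTime j) (hM : PolyTime M) (hq : PolyTime q) :
    PolyTimePred fun a => P (cellAt (Ctx.word a) (L a) (i a) (j a) (M a) (q a)) :=
  PolyTimePred.letter (fun o => P (cell o))
    (hL.add ((((((hi.mul hL).add hj).mul hL).add hM).mul hL).add hq))

theorem PolyTimePred.certDag_op (P : NodeOp k → Prop) (hL : PolyTime L) (hi : PolyTime i) :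
    PolyTimePred fun a => P ((certDag (Ctx.word a) (L a)).op (i a)) :=
  PolyTimePred.cellAt (fun c => P c.op) hL hi (.const 0) (.const 0) (.const 0)

theorem PolyTime.certDag_l (hL : PolyTime L) (hi : PolyTime i) :
    PolyTime fun a => (certDag (Ctx.word a) (L a)).l (i a) :=
  PolyTime.sum (g := fun a q => ind (TemporalLearning.cellAt (Ctx.word a) (L a) (i a) 0 0 q).l) hL
    (PolyTimePred.cellAt (fun c => c.l) hL.weaken hi.weaken (.const 0) (.const 0) var₀)

theorem PolyTime.certDag_r (hL : PolyTime L) (hi : PolyTime i) :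
    PolyTime fun a => (certDag (Ctx.word a) (L a)).r (i a) :=
  PolyTime.sum (g := fun a q => ind (TemporalLearning.cellAt (Ctx.word a) (L a) (i a) 0 0 q).r) hL
    (PolyTimePred.cellAt (fun c => c.r) hL.weaken hi.weaken (.const 0) (.const 0) var₀)

theorem PolyTimePred.binLg {p q : α → Prop} (hp : PolyTimePred p) (hq : PolyTimePred q)
    (o : BinLg) : PolyTimePred fun a => o.eval (p a) (q a) := by
  cases o with
  | or => exact hp.or hq
  | and => exact hp.and hq
  | impl => exact hp.imp hq
  | conv => exact hq.imp hp
  | iff => exact hp.iff hq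
  | nor => exact (hp.or hq).not
  | nand => exact (hp.and hq).not
  | nimpl => exact (hp.imp hq).not
  | nconv => exact (hq.imp hp).not
  | niff => exact (hp.iff hq).not

variable {lab φ ψ : α → Prop} {preφ preZ : α → Finset (Fin k) → Prop}

theorem PolyTimePred.step (hlab : PolyTimePred lab) (hφ : PolyTimePred φ) (hψ : PolyTimePred ψ)
    (hpφ : ∀ A, PolyTimePred fun a => preφ a A) (hpZ : ∀ A, PolyTimePred fun a => preZ a A)
    (op : NodeOp k) :
    PolyTimePred fun a => op.step (lab a) (φ a) (ψ a) (preφ a) (preZ a) := by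
  cases op with
  | prop => exact hlab
  | neg => exact hφ.not
  | lg o => exact hφ.binLg hψ o
  | un A o =>
    cases o with
    | X => exact hpφ A
    | F => exact hφ.or (hpZ A)
    | G => exact hφ.and (hpZ A)
  | tp A o =>
    cases o with
    | U => exact hψ.or (hφ.and (hpZ A))
    | R => exact hψ.and (hφ.or (hpZ A))
    | W => exact hψ.or (hφ.and (hpZ A))
    | M => exact hψ.and (hφ.or (hpZ A))

theorem PolyTimePred.certDag_step (hL : PolyTime L) (hi : PolyTime i) (hlab : PolyTimePred lab)
    (hφ : PolyTimePred φ) (hψ : PolyTimePred ψ) (hpφ : ∀ A, PolyTimePred fun a => preφ a A)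
    (hpZ : ∀ A, PolyTimePred fun a => preZ a A) :
    PolyTimePred fun a =>
      ((certDag (Ctx.word a) (L a)).op (i a)).step (lab a) (φ a) (ψ a) (preφ a) (preZ a) :=
  (PolyTimePred.forall_finite fun op => (PolyTimePred.certDag_op (fun o => o = op) hL hi).imp
    (PolyTimePred.step hlab hφ hψ hpφ hpZ op)).congr fun _ =>
      ⟨fun h _ ho => ho ▸ h, fun h => h _ rfl⟩

theorem PolyTimePred.natCast_le {f : α → ℕ} (hf : PolyTime f) (n : ℕ∞) :
    PolyTimePred fun a => (f a : ℕ∞) ≤ n := by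
  induction n using ENat.recTopCoe with
  | top => exact (PolyTimePred.const True).congr fun a => by simp
  | coe n => exact (PolyTimePred.le hf (.const n)).congr fun a => by simp

end CellAt

/-- A class of encoded models that can be read as concurrent game structures: from the position of
an encoded model in a word one can compute in polynomial time the position after it, its number of
states, its initial states, its labels and the predecessor operators. -/
structure Coding (k : ℕ) (Model : ℕ → Type) (enc : {m : ℕ} → Model m → List Γ') where
  toCGS : {m : ℕ} → Model m → CGS k (Fin m)
  skip : CertWord k → ℕ → ℕ
  numStates : CertWord k → ℕ → ℕ
  init : CertWord k → ℕ → ℕ → Prop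
  label : CertWord k → ℕ → ℕ → ℕ → Prop
  pre : Finset (Fin k) → CertWord k → ℕ → ℕ → (ℕ → Prop) → Prop
  polyTime_skip : PolyTimeSkip skip
  polyTime_numStates : PolyTimeSkip numStates
  polyTime_init : ∀ {α : Type} [Ctx (Γ' ⊕ Cell k) α] {s q : α → ℕ}, PolyTime s → PolyTime q →
    PolyTimePred fun a => init (Ctx.word a) (s a) (q a)
  polyTime_label : ∀ {α : Type} [Ctx (Γ' ⊕ Cell k) α] {s q p : α → ℕ}, PolyTime s → PolyTime q →
    PolyTime p → PolyTimePred fun a => label (Ctx.word a) (s a) (q a) (p a)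
  polyTime_pre : ∀ (A : Finset (Fin k)) {α : Type} [Ctx (Γ' ⊕ Cell k) α] {s q : α → ℕ}
    {Z : α → ℕ → Prop}, PolyTime s → PolyTime q → (PolyTimePred fun c : α × ℕ => Z c.1 c.2) →
    PolyTimePred fun a => pre A (Ctx.word a) (s a) (q a) (Z a)
  skips : ∀ {m : ℕ} (X : Model m), Skips (Cell k) skip (enc X)
  numStates_le : ∀ {m : ℕ} (X : Model m), (toCGS X).numStates ≤ (enc X).length
  numStates_eq : ∀ {m : ℕ} (X : Model m) {w : CertWord k} {s : ℕ}, OccursAt w s (enc X) →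
    numStates w s = (toCGS X).numStates
  init_iff : ∀ {m : ℕ} (X : Model m) {w : CertWord k} {s : ℕ}, OccursAt w s (enc X) →
    ∀ q : (toCGS X).Q, init w s q ↔ q ∈ (toCGS X).init
  label_iff : ∀ {m : ℕ} (X : Model m) {w : CertWord k} {s : ℕ}, OccursAt w s (enc X) →
    ∀ (q : (toCGS X).Q) (p : Fin m), label w s q p ↔ p ∈ (toCGS X).label q
  pre_iff : ∀ {m : ℕ} (X : Model m) {w : CertWord k} {s : ℕ}, OccursAt w s (enc X) →
    ∀ (A : Finset (Fin k)) (q : (toCGS X).Q) (Z : ℕ → Prop),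
      pre A w s q Z ↔ (toCGS X).pre A (fun q' => Z q') q

namespace Coding

variable {k : ℕ} {Model : ℕ → Type} {enc : {m : ℕ} → Model m → List Γ'} (K : Coding k Model enc)

/-- The position of the list of positive models. -/
noncomputable def posStart (w : CertWord k) : ℕ := skipNat w 0

/-- The position of the list of negative models. -/
noncomputable def negStart (w : CertWord k) : ℕ := skipList K.skip w (posStart w)

/-- The position of the bound. -/
noncomputable def boundStart (w : CertWord k) : ℕ := skipList K.skip w (K.negStart w)

/-- The bound on the size of the formula. -/
noncomputable def bound (w : CertWord k) : ℕ := numAt w (K.boundStart w)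

/-- The position of the certificate. -/
noncomputable def certStart (w : CertWord k) : ℕ := skipNat w (K.boundStart w)

/-- The directed acyclic graph given by the certificate. -/
noncomputable def dag (w : CertWord k) : Dag k := certDag w (K.certStart w)

/-- The entry of the table of truth values for node `i`, step `j`, model `M` and state `q`. -/
def entry (w : CertWord k) (i j M q : ℕ) : Prop := (cellAt w (K.certStart w) i j M q).t

/-- The table satisfies the local equations for the model at position `s`, which has number `M`
among all models. -/
def ModelOK (w : CertWord k) (s M : ℕ) : Prop :=
  ∀ i < K.bound w, ∀ q < K.numStates w s,
    (K.entry w i 0 M q ↔ ((K.dag w).op i).start) ∧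
    ∀ j < K.numStates w s, K.entry w i (j + 1) M q ↔
      ((K.dag w).op i).step
        ((K.dag w).l i < numAt w 0 ∧ K.label w s q ((K.dag w).l i))
        (K.entry w ((K.dag w).l i) (K.numStates w s) M q)
        (K.entry w ((K.dag w).r i) (K.numStates w s) M q)
        (fun A => K.pre A w s q fun q' => K.entry w ((K.dag w).l i) (K.numStates w s) M q')
        (fun A => K.pre A w s q fun q' => K.entry w i j M q')

/-- According to the table, node `i` holds at all initial states of the model at position `s`. -/
def Accepts (w : CertWord k) (i s M : ℕ) : Prop :=
  ∀ q < K.numStates w s, K.init w s q → K.entry w i (K.numStates w s) M q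

/-- Every positive model satisfies `P`, a property of its position and its number. -/
def ForallPos (w : CertWord k) (P : ℕ → ℕ → Prop) : Prop :=
  ∀ j < countAt K.skip w (posStart w), P (nthAt K.skip w (posStart w) j) j

/-- Every negative model satisfies `P`, a property of its position and its number. -/
def ForallNeg (w : CertWord k) (P : ℕ → ℕ → Prop) : Prop :=
  ∀ j < countAt K.skip w (K.negStart w),
    P (nthAt K.skip w (K.negStart w) j) (countAt K.skip w (posStart w) + j)

/-- The verifier: the graph represents formulas of the fragment, the table holds their truth
values, and some node holds in the positive but not in the negative models. -/
def Verify (Ut : Set UnOp) (Bt : Set BinTp) (Bl : Set BinLg) (n : ℕ∞) (w : CertWord k) : Prop :=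
  (∀ i < K.bound w, (K.dag w).NodeOK (numAt w 0) i ∧ ((K.dag w).op i).InFragment Ut Bt Bl) ∧
  ((∑ i ∈ Finset.range (K.bound w), ind ((K.dag w).op i).IsBin : ℕ) : ℕ∞) ≤ n ∧
  K.ForallPos w (K.ModelOK w) ∧ K.ForallNeg w (K.ModelOK w) ∧
  ∃ i < K.bound w, K.ForallPos w (K.Accepts w i) ∧ K.ForallNeg w fun s M => ¬ K.Accepts w i s M

section PolyTime

variable {α : Type} [Ctx (Γ' ⊕ Cell k) α] {i s M : α → ℕ}

theorem polyTime_posStart : PolyTime fun a : α => posStart (Ctx.word a) :=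
  PolyTimeSkip.nat.polyTime (.const 0)

theorem polyTime_negStart : PolyTime fun a : α => K.negStart (Ctx.word a) :=
  K.polyTime_skip.list.polyTime polyTime_posStart

theorem polyTime_boundStart : PolyTime fun a : α => K.boundStart (Ctx.word a) :=
  K.polyTime_skip.list.polyTime K.polyTime_negStart

theorem polyTime_bound : PolyTime fun a : α => K.bound (Ctx.word a) :=
  PolyTime.numAt K.polyTime_boundStart

theorem polyTime_certStart : PolyTime fun a : α => K.certStart (Ctx.word a) :=
  PolyTimeSkip.nat.polyTime K.polyTime_boundStart

theorem polyTime_dag_l (hi : PolyTime i) : PolyTime fun a => (K.dag (Ctx.word a)).l (i a) :=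
  PolyTime.certDag_l K.polyTime_certStart hi

theorem polyTime_dag_r (hi : PolyTime i) : PolyTime fun a => (K.dag (Ctx.word a)).r (i a) :=
  PolyTime.certDag_r K.polyTime_certStart hi

theorem polyTime_dag_op (P : NodeOp k → Prop) (hi : PolyTime i) :
    PolyTimePred fun a => P ((K.dag (Ctx.word a)).op (i a)) :=
  PolyTimePred.certDag_op P K.polyTime_certStart hi

theorem polyTime_entry {j q : α → ℕ} (hi : PolyTime i) (hj : PolyTime j) (hM : PolyTime M)
    (hq : PolyTime q) : PolyTimePred fun a => K.entry (Ctx.word a) (i a) (j a) (M a) (q a) :=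
  PolyTimePred.cellAt (fun c => c.t) K.polyTime_certStart hi hj hM hq

theorem polyTime_modelOK (hs : PolyTime s) (hM : PolyTime M) :
    PolyTimePred fun a => K.ModelOK (Ctx.word a) (s a) (M a) := by
  refine PolyTimePred.forall_lt (r := fun a i => ∀ q < K.numStates (Ctx.word a) (s a), _)
    K.polyTime_bound (PolyTimePred.forall_lt (r := fun (c : α × ℕ) q =>
      _ ∧ ∀ j < K.numStates (Ctx.word c) (s c.1), _) (K.polyTime_numStates.polyTime hs.weaken)
      (PolyTimePred.and ?start ?steps))
  case start =>
    exact (K.polyTime_entry var₁ (.const 0) hM.weaken.weaken var₀).iff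
      (K.polyTime_dag_op NodeOp.start var₁)
  case steps =>
    have hs' : PolyTime fun c : ((α × ℕ) × ℕ) × ℕ => s c.1.1.1 := hs.weaken.weaken.weaken
    have hM' : PolyTime fun c : ((α × ℕ) × ℕ) × ℕ => M c.1.1.1 := hM.weaken.weaken.weaken
    have hn : PolyTime fun c : ((α × ℕ) × ℕ) × ℕ => K.numStates (Ctx.word c) (s c.1.1.1) :=
      K.polyTime_numStates.polyTime hs'
    have hl : PolyTime fun c : ((α × ℕ) × ℕ) × ℕ => (K.dag (Ctx.word c)).l c.1.1.2 :=
      K.polyTime_dag_l var₂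
    refine PolyTimePred.forall_lt (r := fun (c : (α × ℕ) × ℕ) j => _)
      (K.polyTime_numStates.polyTime hs.weaken.weaken)
      (PolyTimePred.iff (K.polyTime_entry var₂ var₀.succ hM' var₁) ?_)
    exact PolyTimePred.certDag_step K.polyTime_certStart var₂
      ((PolyTimePred.lt hl (PolyTime.numAt (.const 0))).and (K.polyTime_label hs' var₁ hl))
      (K.polyTime_entry hl hn hM' var₁) (K.polyTime_entry (K.polyTime_dag_r var₂) hn hM' var₁)
      (fun A => K.polyTime_pre A hs' var₁ (K.polyTime_entry hl.weaken hn.weaken hM'.weaken var₀))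
      (fun A => K.polyTime_pre A hs' var₁ (K.polyTime_entry var₃ var₁ hM'.weaken var₀))

theorem polyTime_accepts (hi : PolyTime i) (hs : PolyTime s) (hM : PolyTime M) :
    PolyTimePred fun a => K.Accepts (Ctx.word a) (i a) (s a) (M a) :=
  PolyTimePred.forall_lt (r := fun _ _ => _ → _) (K.polyTime_numStates.polyTime hs)
    ((K.polyTime_init hs.weaken var₀).imp
      (K.polyTime_entry hi.weaken (K.polyTime_numStates.polyTime hs.weaken) hM.weaken var₀))

variable {P : α → ℕ → ℕ → Prop}

theorem polyTime_forallPos (hP : ∀ {s M : α × ℕ → ℕ}, PolyTime s → PolyTime M →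
      PolyTimePred fun c => P c.1 (s c) (M c)) :
    PolyTimePred fun a => K.ForallPos (Ctx.word a) (P a) :=
  PolyTimePred.forall_lt
    (r := fun a j => P a (nthAt K.skip (Ctx.word a) (posStart (Ctx.word a)) j) j)
    (PolyTime.countAt K.polyTime_skip polyTime_posStart)
    (hP (PolyTime.nthAt K.polyTime_skip polyTime_posStart var₀) var₀)

theorem polyTime_forallNeg (hP : ∀ {s M : α × ℕ → ℕ}, PolyTime s → PolyTime M →
      PolyTimePred fun c => P c.1 (s c) (M c)) :
    PolyTimePred fun a => K.ForallNeg (Ctx.word a) (P a) :=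
  PolyTimePred.forall_lt
    (r := fun a j => P a (nthAt K.skip (Ctx.word a) (K.negStart (Ctx.word a)) j)
      (countAt K.skip (Ctx.word a) (posStart (Ctx.word a)) + j))
    (PolyTime.countAt K.polyTime_skip K.polyTime_negStart)
    (hP (PolyTime.nthAt K.polyTime_skip K.polyTime_negStart var₀)
      ((PolyTime.countAt K.polyTime_skip polyTime_posStart).add var₀))

theorem polyTime_nodeOK (hi : PolyTime i) :
    PolyTimePred fun a => (K.dag (Ctx.word a)).NodeOK (numAt (Ctx.word a) 0) (i a) :=
  ((K.polyTime_dag_op NodeOp.IsProp hi).imp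
    (PolyTimePred.lt (K.polyTime_dag_l hi) (PolyTime.numAt (.const 0)))).and
    ((K.polyTime_dag_op NodeOp.IsProp hi).not.imp
      ((PolyTimePred.lt (K.polyTime_dag_l hi) hi).and (PolyTimePred.lt (K.polyTime_dag_r hi) hi)))

theorem polyTime_verify (Ut : Set UnOp) (Bt : Set BinTp) (Bl : Set BinLg) (n : ℕ∞) :
    PolyTimePred (K.Verify Ut Bt Bl n) := by
  refine PolyTimePred.and ?_ (PolyTimePred.and ?_ (PolyTimePred.and ?_ (PolyTimePred.and ?_ ?_)))
  · exact PolyTimePred.forall_lt (r := fun w i => _ ∧ _) K.polyTime_bound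
      ((K.polyTime_nodeOK var₀).and (K.polyTime_dag_op (NodeOp.InFragment Ut Bt Bl) var₀))
  · exact PolyTimePred.natCast_le (PolyTime.sum (g := fun w i => ind ((K.dag w).op i).IsBin)
      K.polyTime_bound (K.polyTime_dag_op NodeOp.IsBin var₀)) n
  · exact K.polyTime_forallPos (P := K.ModelOK) K.polyTime_modelOK
  · exact K.polyTime_forallNeg (P := K.ModelOK) K.polyTime_modelOK
  · exact PolyTimePred.exists_lt (r := fun w i => _ ∧ _) K.polyTime_bound
      ((K.polyTime_forallPos (P := fun c : CertWord k × ℕ => K.Accepts c.1 c.2)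
        (K.polyTime_accepts var₁)).and
      (K.polyTime_forallNeg (P := fun (c : CertWord k × ℕ) s M => ¬ K.Accepts c.1 c.2 s M)
        fun hs hM => (K.polyTime_accepts var₁ hs hM).not))

end PolyTime

end Coding

/-! ### Correctness of the verifier -/

namespace Dag

variable {k m : ℕ} {D D' : Dag k} {b : ℕ}

theorem NodeOK.congr {i : ℕ} (h : D.NodeOK m i) (hop : D'.op i = D.op i) (hl : D'.l i = D.l i)
    (hr : D'.r i = D.r i) : D'.NodeOK m i := by
  unfold NodeOK at h ⊢
  rwa [hop, hl, hr]

theorem TableOK.congr {C : CGS k (Fin m)} {B : ℕ} {T T' : ℕ → ℕ → C.Q → Prop}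
    (h : D.TableOK C B T) (hB : B ≤ b)
    (hD : ∀ i < b, D'.op i = D.op i ∧ D'.l i = D.l i ∧ D'.r i = D.r i)
    (hptr : ∀ i < B, D.l i < b ∧ D.r i < b)
    (hT : ∀ i < b, ∀ j ≤ C.numStates, T' i j = T i j) : D'.TableOK C B T' := by
  intro i hi q
  have hib := hi.trans_le hB
  obtain ⟨hop, hl, hr⟩ := hD i hib
  obtain ⟨hstart, hsteps⟩ := h i hi q
  unfold Labelled at hsteps ⊢
  rw [hop, hl, hr, hT i hib 0 (Nat.zero_le _), hT _ (hptr i hi).1 _ le_rfl,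
    hT _ (hptr i hi).2 _ le_rfl]
  refine ⟨hstart, fun j hj => ?_⟩
  rw [hT i hib _ hj, hT i hib _ hj.le]
  exact hsteps j hj

end Dag

theorem mul_add_lt_mul {a b c L : ℕ} (ha : a < c) (hb : b < L) : a * L + b < c * L :=
  calc a * L + b < a * L + L := Nat.add_lt_add_left hb _
    _ = (a + 1) * L := (Nat.succ_mul a L).symm
    _ ≤ c * L := Nat.mul_le_mul_right L ha

theorem sum_ind_lt {L n : ℕ} (h : n ≤ L) : ∑ q ∈ Finset.range L, ind (q < n) = n := by
  have hfilter : (Finset.range L).filter (· < n) = Finset.range n := by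
    ext i
    simp only [Finset.mem_filter, Finset.mem_range]
    omega
  calc ∑ q ∈ Finset.range L, ind (q < n) = ∑ q ∈ Finset.range L, if q < n then 1 else 0 :=
        Finset.sum_congr rfl fun q _ => by by_cases hq : q < n <;> simp [ind, hq]
    _ = ((Finset.range L).filter (· < n)).card := (Finset.card_filter _ _).symm
    _ = n := by rw [hfilter, Finset.card_range]

section Certificate

variable {k : ℕ} {l : List Γ'} {g : ℕ → ℕ → ℕ → ℕ → Cell k}

/-- The certificate of length `L ^ 4` with cells `g i j M q`, ordered by the number with digits
`i`, `j`, `M`, `q` in base `L`. -/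
def certificate (L : ℕ) (g : ℕ → ℕ → ℕ → ℕ → Cell k) : List (Cell k) :=
  (List.range (L ^ 4)).map fun t => g (t / L / L / L) (t / L / L % L) (t / L % L) (t % L)

/-- The word that consists of the input `l` and the certificate with cells `g`. -/
def certWord (l : List Γ') (g : ℕ → ℕ → ℕ → ℕ → Cell k) : CertWord k :=
  l.map Sum.inl ++ (certificate l.length g).map Sum.inr

theorem cellAt_certWord {i j M q : ℕ} (hi : i < l.length) (hj : j < l.length) (hM : M < l.length)
    (hq : q < l.length) : cellAt (certWord l g) l.length i j M q = g i j M q := by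
  set L := l.length with hL
  have hlt : ((i * L + j) * L + M) * L + q < L ^ 4 := by
    rw [show L ^ 4 = ((L * L) * L) * L by ring]
    exact mul_add_lt_mul (mul_add_lt_mul (mul_add_lt_mul hi hj) hM) hq
  have hdigits : ∀ a b, b < L → (a * L + b) / L = a ∧ (a * L + b) % L = b := fun a b hb => by
    rw [Nat.mul_comm, Nat.mul_add_div (by omega), Nat.mul_add_mod, Nat.div_eq_of_lt hb,
      Nat.mod_eq_of_lt hb]
    exact ⟨rfl, rfl⟩
  rw [cellAt, certWord, List.getElem?_append_right (by simp [hL])]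
  simp only [List.length_map, ← hL, Nat.add_sub_cancel_left, certificate, List.map_map]
  rw [List.getElem?_map, List.getElem?_range hlt]
  simp only [Option.map_some, Function.comp, cell, (hdigits _ _ hq).1, (hdigits _ _ hq).2,
    (hdigits _ _ hM).1, (hdigits _ _ hM).2, (hdigits _ _ hj).1, (hdigits _ _ hj).2]

theorem certDag_certWord {D : Dag k} {T : ℕ → ℕ → ℕ → ℕ → Prop}
    (hg : ∀ i j M q, g i j M q = ⟨D.op i, q < D.l i, q < D.r i, T i j M q⟩) {i : ℕ}
    (hi : i < l.length) (hl : D.l i ≤ l.length) (hr : D.r i ≤ l.length) :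
    (certDag (certWord l g) l.length).op i = D.op i ∧
      (certDag (certWord l g) l.length).l i = D.l i ∧
      (certDag (certWord l g) l.length).r i = D.r i := by
  have hpos : 0 < l.length := by omega
  have hcell {q : ℕ} (hq : q < l.length) : cellAt (certWord l g) l.length i 0 0 q =
      ⟨D.op i, q < D.l i, q < D.r i, T i 0 0 q⟩ :=
    (cellAt_certWord hi hpos hpos hq).trans (hg i 0 0 q)
  refine ⟨congrArg Cell.op (hcell hpos), ?_, ?_⟩
  · refine (Finset.sum_congr rfl fun q hq => ?_).trans (sum_ind_lt hl)
    rw [hcell (Finset.mem_range.1 hq)]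
  · refine (Finset.sum_congr rfl fun q hq => ?_).trans (sum_ind_lt hr)
    rw [hcell (Finset.mem_range.1 hq)]

theorem exists_certificate (l : List Γ') {D : Dag k} (T : ℕ → ℕ → ℕ → ℕ → Prop)
    (hD : ∀ i, D.l i ≤ l.length ∧ D.r i ≤ l.length) :
    ∃ c : List (Cell k), c.length = l.length ^ 4 ∧
      (∀ i < l.length,
        (certDag (l.map Sum.inl ++ c.map Sum.inr) l.length).op i = D.op i ∧
        (certDag (l.map Sum.inl ++ c.map Sum.inr) l.length).l i = D.l i ∧
        (certDag (l.map Sum.inl ++ c.map Sum.inr) l.length).r i = D.r i) ∧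
      ∀ i < l.length, ∀ j < l.length, ∀ M < l.length, ∀ q < l.length,
        ((cellAt (l.map Sum.inl ++ c.map Sum.inr) l.length i j M q).t ↔ T i j M q) :=
  ⟨certificate l.length fun i j M q => ⟨D.op i, q < D.l i, q < D.r i, T i j M q⟩,
    by rw [certificate, List.length_map, List.length_range],
    fun i hi => certDag_certWord (fun _ _ _ _ => rfl) hi (hD i).1 (hD i).2,
    fun _ hi _ hj _ hM _ hq => by
      have h := congrArg Cell.t (cellAt_certWord (g := fun i j M q =>
        (⟨D.op i, q < D.l i, q < D.r i, T i j M q⟩ : Cell k)) hi hj hM hq)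
      exact iff_of_eq h⟩

end Certificate

theorem length_le_length_flatMap {α β : Type} {l : List α} {e : α → List β} {a : α}
    (ha : a ∈ l) : (e a).length ≤ (l.flatMap e).length := by
  rw [List.length_flatMap]
  exact List.single_le_sum (fun _ _ => Nat.zero_le _) _ (List.mem_map_of_mem ha)

theorem Sample.length_encode {Model : ℕ → Type} (enc : {m : ℕ} → Model m → List Γ')
    (x : Sample Model) :
    (x.encode enc).length =
      x.numProp + (x.pos.flatMap enc).length + (x.neg.flatMap enc).length + x.bound + 6 := by
  simp only [Sample.encode, List.length_append, length_encNat, length_encList]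
  omega

theorem forall_getElem?_append {α : Type} {l l' : List α} {P : ℕ → α → Prop} :
    (∀ i a, (l ++ l')[i]? = some a → P i a) ↔
      (∀ i a, l[i]? = some a → P i a) ∧ ∀ i a, l'[i]? = some a → P (l.length + i) a := by
  refine ⟨fun h => ⟨fun i a ha => h i a ?_, fun i a ha => h _ a ?_⟩, fun ⟨h, h'⟩ i a ha => ?_⟩
  · rw [List.getElem?_append_left (List.getElem?_eq_some_iff.1 ha).1, ha]
  · rw [List.getElem?_append_right (Nat.le_add_right _ _), Nat.add_sub_cancel_left, ha]
  · rcases lt_or_ge i l.length with hi | hi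
    · exact h i a (by rwa [List.getElem?_append_left hi] at ha)
    · obtain ⟨j, rfl⟩ := Nat.exists_eq_add_of_le hi
      exact h' j a (by rwa [List.getElem?_append_right hi, Nat.add_sub_cancel_left] at ha)

namespace Coding

variable {k : ℕ} {Model : ℕ → Type} {enc : {m : ℕ} → Model m → List Γ'} (K : Coding k Model enc)
  {Ut : Set UnOp} {Bt : Set BinTp} {Bl : Set BinLg} {n : ℕ∞} {x : Sample Model}

section Parse

variable {w : CertWord k} (h : OccursAt w 0 (x.encode enc))
include h

theorem numAt_zero : numAt w 0 = x.numProp := by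
  rw [Sample.encode, List.append_assoc, List.append_assoc] at h
  exact numAt_eq ((skips_skipNat _).split h).1

theorem occursAt_posStart : OccursAt w (posStart w)
    (encList enc x.pos ++ (encList enc x.neg ++ encNat x.bound)) := by
  rw [Sample.encode, List.append_assoc, List.append_assoc] at h
  exact ((skips_skipNat _).split h).2

theorem occursAt_pos : OccursAt w (posStart w) (encList enc x.pos) :=
  (occursAt_append.1 (occursAt_posStart h)).1

theorem occursAt_negStart :
    OccursAt w (K.negStart w) (encList enc x.neg ++ encNat x.bound) :=
  ((skips_skipList fun X _ => K.skips X).split (occursAt_posStart h)).2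

theorem occursAt_neg : OccursAt w (K.negStart w) (encList enc x.neg) :=
  (occursAt_append.1 (K.occursAt_negStart h)).1

theorem occursAt_bound : OccursAt w (K.boundStart w) (encNat x.bound) :=
  ((skips_skipList fun X _ => K.skips X).split (K.occursAt_negStart h)).2

theorem bound_eq : K.bound w = x.bound := numAt_eq (K.occursAt_bound h)

theorem certStart_eq : K.certStart w = (x.encode enc).length := by
  have hskips (l : List (Model x.numProp)) : Skips (Cell k) (skipList K.skip) (encList enc l) :=
    skips_skipList fun X _ => K.skips X
  have hend := ((((skips_skipNat x.numProp).append (hskips x.pos)).append (hskips x.neg)).append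
    (skips_skipNat x.bound)).eq w 0 h
  rwa [Nat.zero_add] at hend

variable {P : ℕ → ℕ → Prop} {Q : Model x.numProp → ℕ → Prop}

theorem forallPos_iff (hPQ : ∀ X s M, OccursAt w s (enc X) → (P s M ↔ Q X M)) :
    K.ForallPos w P ↔ ∀ M X, x.pos[M]? = some X → Q X M := by
  rw [ForallPos, countAt_eq (fun X _ => K.skips X) (occursAt_pos h)]
  have hnth {M : ℕ} (hM : M < x.pos.length) :=
    hPQ _ _ M (occursAt_nthAt (fun X _ => K.skips X) (occursAt_pos h) hM)
  refine ⟨fun H M X hX => ?_, fun H M hM => (hnth hM).2 (H M _ (List.getElem?_eq_getElem hM))⟩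
  obtain ⟨hM, rfl⟩ := List.getElem?_eq_some_iff.1 hX
  exact (hnth hM).1 (H M hM)

theorem forallNeg_iff (hPQ : ∀ X s M, OccursAt w s (enc X) → (P s M ↔ Q X M)) :
    K.ForallNeg w P ↔ ∀ M X, x.neg[M]? = some X → Q X (x.pos.length + M) := by
  rw [ForallNeg, countAt_eq (fun X _ => K.skips X) (occursAt_pos h),
    countAt_eq (fun X _ => K.skips X) (K.occursAt_neg h)]
  have hnth {M : ℕ} (hM : M < x.neg.length) :=
    hPQ _ _ (x.pos.length + M) (occursAt_nthAt (fun X _ => K.skips X) (K.occursAt_neg h) hM)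
  refine ⟨fun H M X hX => ?_, fun H M hM => (hnth hM).2 (H M _ (List.getElem?_eq_getElem hM))⟩
  obtain ⟨hM, rfl⟩ := List.getElem?_eq_some_iff.1 hX
  exact (hnth hM).1 (H M hM)

theorem modelOK_iff {X : Model x.numProp} {s M : ℕ} (hs : OccursAt w s (enc X)) :
    K.ModelOK w s M ↔
      (K.dag w).TableOK (K.toCGS X) x.bound fun i j q => K.entry w i j M q := by
  unfold ModelOK Dag.TableOK Dag.Labelled
  rw [K.bound_eq h, numAt_zero h, K.numStates_eq X hs]
  refine forall₂_congr fun _ _ => ⟨fun H q => ?_, fun H q hq => ?_⟩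
  · simpa only [← K.pre_iff X hs, ← K.label_iff X hs, exists_prop] using H q q.2
  · simpa only [← K.pre_iff X hs, ← K.label_iff X hs, exists_prop] using H ⟨q, hq⟩

omit h in
theorem accepts_iff {X : Model x.numProp} {i s M : ℕ} (hs : OccursAt w s (enc X)) :
    K.Accepts w i s M ↔
      ∀ q ∈ (K.toCGS X).init, K.entry w i (K.toCGS X).numStates M q := by
  rw [Accepts, K.numStates_eq X hs]
  exact ⟨fun H q hq => H q q.2 ((K.init_iff X hs q).2 hq),
    fun H q hq hi => H ⟨q, hq⟩ ((K.init_iff X hs ⟨q, hq⟩).1 hi)⟩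

end Parse

/-- The condition that the verifier checks, for an input `x`, a directed acyclic graph `D` and the
tables `T i j M q` of truth values; the negative models are numbered after the positive ones. -/
structure Certifies (Ut : Set UnOp) (Bt : Set BinTp) (Bl : Set BinLg) (n : ℕ∞) (x : Sample Model)
    (D : Dag k) (T : ℕ → ℕ → ℕ → ℕ → Prop) : Prop where
  node : ∀ i < x.bound, D.NodeOK x.numProp i ∧ (D.op i).InFragment Ut Bt Bl
  sum_isBin_le : ((∑ i ∈ Finset.range x.bound, ind (D.op i).IsBin : ℕ) : ℕ∞) ≤ n
  tableOK : ∀ M X, (x.pos ++ x.neg)[M]? = some X →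
    D.TableOK (K.toCGS X) x.bound fun i j q => T i j M q
  exists_separating : ∃ i < x.bound,
    (∀ M X, x.pos[M]? = some X → ∀ q ∈ (K.toCGS X).init, T i (K.toCGS X).numStates M q) ∧
    ∀ M X, x.neg[M]? = some X →
      ¬ ∀ q ∈ (K.toCGS X).init, T i (K.toCGS X).numStates (x.pos.length + M) q

theorem verify_iff_certifies {w : CertWord k} (h : OccursAt w 0 (x.encode enc)) :
    K.Verify Ut Bt Bl n w ↔ K.Certifies Ut Bt Bl n x (K.dag w) (K.entry w) := by
  rw [Verify, K.bound_eq h, numAt_zero h,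
    K.forallPos_iff h fun X s M => K.modelOK_iff h (X := X) (s := s) (M := M),
    K.forallNeg_iff h fun X s M => K.modelOK_iff h (X := X) (s := s) (M := M)]
  have hsep (i : ℕ) := and_congr
    (K.forallPos_iff h (P := K.Accepts w i) fun X s M => K.accepts_iff (X := X))
    (K.forallNeg_iff h (P := fun s M => ¬ K.Accepts w i s M) fun X s M hs =>
      not_congr (K.accepts_iff (X := X) hs))
  simp only [hsep]
  exact ⟨fun ⟨hnode, hbin, hpos, hneg, hsep⟩ =>
      ⟨hnode, hbin, forall_getElem?_append.2 ⟨hpos, hneg⟩, hsep⟩,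
    fun ⟨hnode, hbin, htable, hsep⟩ => ⟨hnode, hbin, (forall_getElem?_append.1 htable).1,
      (forall_getElem?_append.1 htable).2, hsep⟩⟩

/-- There is a formula for the learning problem with input `x`. -/
def Learnable (Ut : Set UnOp) (Bt : Set BinTp) (Bl : Set BinLg) (n : ℕ∞) (x : Sample Model) :
    Prop :=
  ∃ φ : ATL k (Fin x.numProp), φ.InFragment Ut Bt Bl ∧ φ.size ≤ x.bound ∧ (φ.numBin : ℕ∞) ≤ n ∧
    (∀ X ∈ x.pos, (K.toCGS X).Sat φ) ∧ ∀ X ∈ x.neg, ¬ (K.toCGS X).Sat φ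

variable {K} {D : Dag k} {T : ℕ → ℕ → ℕ → ℕ → Prop}

theorem Certifies.learnable (h : K.Certifies Ut Bt Bl n x D T) : K.Learnable Ut Bt Bl n x := by
  obtain ⟨i, hi, hpos, hneg⟩ := h.exists_separating
  obtain ⟨htable_pos, htable_neg⟩ := forall_getElem?_append.1 h.tableOK
  have hf := Dag.represents_formula (hm := x.numProp_pos) fun i hi => (h.node i hi).1
  refine ⟨_, hf.inFragment (fun i hi => (h.node i hi).2) hi, hf.size_le hi,
    (Nat.cast_le.2 (hf.numBin_le hi)).trans h.sum_isBin_le, fun X hX => ?_, fun X hX hsat => ?_⟩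
  · obtain ⟨M, hM⟩ := List.mem_iff_getElem?.1 hX
    exact fun q hq => (hf.table_iff (htable_pos M X hM) hi q).1 (hpos M X hM q hq)
  · obtain ⟨M, hM⟩ := List.mem_iff_getElem?.1 hX
    exact hneg M X hM fun q hq => (hf.table_iff (htable_neg M X hM) hi q).2 (hsat q hq)

theorem Learnable.exists_certifies (h : K.Learnable Ut Bt Bl n x) :
    ∃ D T, K.Certifies Ut Bt Bl n x D T ∧
      ∀ i, D.l i ≤ x.numProp + x.bound ∧ D.r i ≤ x.numProp + x.bound := by
  obtain ⟨φ, hφ, hsize, hbin, hpos, hneg⟩ := h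
  obtain ⟨D, f, hf, ⟨i₀, hi₀, rfl⟩, hsum, hptr, hfrag⟩ := ATL.exists_represents x.numProp_pos hsize
  let value (X : Model x.numProp) (i : ℕ) : ℕ → (K.toCGS X).Q → Prop :=
    (K.toCGS X).iter (D.op i) (D.Labelled (K.toCGS X) i)
      ((f (D.l i)).SatAt (K.toCGS X).label (K.toCGS X).Enforces)
      ((f (D.r i)).SatAt (K.toCGS X).label (K.toCGS X).Enforces)
  let T (i j M q : ℕ) : Prop := ∃ X, (x.pos ++ x.neg)[M]? = some X ∧
    ∃ hq : q < (K.toCGS X).numStates, value X i j ⟨q, hq⟩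
  have T_eq (M X) (hX : (x.pos ++ x.neg)[M]? = some X) :
      (fun i j (q : (K.toCGS X).Q) => T i j M q) = value X := by
    funext i j q
    simp [T, hX]
  have htable (M X) (hX : (x.pos ++ x.neg)[M]? = some X) :
      D.TableOK (K.toCGS X) x.bound fun i j q => T i j M q := by
    rw [T_eq M X hX]
    exact hf.tableOK (K.toCGS X)
  obtain ⟨htable_pos, htable_neg⟩ := forall_getElem?_append.1 htable
  refine ⟨D, T, ⟨fun i hi => ⟨(hf i hi).1, hfrag Ut Bt Bl hφ i hi⟩,
    (Nat.cast_le.2 hsum).trans hbin, htable, i₀, hi₀, fun M X hX q hq => ?_, fun M X hX hT => ?_⟩,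
    hptr⟩
  · exact (hf.table_iff (htable_pos M X hX) hi₀ q).2 (hpos X (List.mem_of_getElem? hX) q hq)
  · exact hneg X (List.mem_of_getElem? hX) fun q hq =>
      (hf.table_iff (htable_neg M X hX) hi₀ q).1 (hT q hq)

theorem Certifies.congr (h : K.Certifies Ut Bt Bl n x D T) {D' : Dag k}
    {T' : ℕ → ℕ → ℕ → ℕ → Prop} {L : ℕ} (hB : x.bound ≤ L) (hlen : (x.pos ++ x.neg).length ≤ L)
    (hstates : ∀ X ∈ x.pos ++ x.neg, (K.toCGS X).numStates < L)
    (hptr : ∀ i < x.bound, D.l i < L ∧ D.r i < L)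
    (hD : ∀ i < L, D'.op i = D.op i ∧ D'.l i = D.l i ∧ D'.r i = D.r i)
    (hT : ∀ i < L, ∀ j < L, ∀ M < L, ∀ q < L, (T' i j M q ↔ T i j M q)) :
    K.Certifies Ut Bt Bl n x D' T' := by
  have hop (i) (hi : i < x.bound) : D'.op i = D.op i := (hD i (hi.trans_le hB)).1
  have T_eq (M X) (hX : (x.pos ++ x.neg)[M]? = some X) (i) (hi : i < L) (j)
      (hj : j ≤ (K.toCGS X).numStates) :
      (fun q : (K.toCGS X).Q => T' i j M q) = fun q : (K.toCGS X).Q => T i j M q := by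
    have hXL := hstates X (List.mem_of_getElem? hX)
    exact funext fun q => propext (hT i hi j (hj.trans_lt hXL) M
      ((List.getElem?_eq_some_iff.1 hX).1.trans_le hlen) q (q.2.trans hXL))
  obtain ⟨T_eq_pos, T_eq_neg⟩ := forall_getElem?_append.1 T_eq
  obtain ⟨i₀, hi₀, hpos, hneg⟩ := h.exists_separating
  refine ⟨fun i hi => ?_, ?_, fun M X hX => ?_, i₀, hi₀, fun M X hX q hq => ?_,
    fun M X hX hT' => hneg M X hX fun q hq => ?_⟩
  · obtain ⟨hop, hl, hr⟩ := hD i (hi.trans_le hB)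
    exact ⟨(h.node i hi).1.congr hop hl hr, hop ▸ (h.node i hi).2⟩
  · rw [Finset.sum_congr rfl fun i hi => by rw [hop i (Finset.mem_range.1 hi)]]
    exact h.sum_isBin_le
  · exact (h.tableOK M X hX).congr hB hD hptr (T_eq M X hX)
  · exact (congrFun (T_eq_pos M X hX i₀ (hi₀.trans_le hB) _ le_rfl) q).mpr (hpos M X hX q hq)
  · exact (congrFun (T_eq_neg M X hX i₀ (hi₀.trans_le hB) _ le_rfl) q).mp (hT' q hq)

variable (K)

include K in
theorem length_append_lt (x : Sample Model) :
    (x.pos ++ x.neg).length < (x.encode enc).length := by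
  have hpos := length_le_flatMap (l := x.pos) (e := enc) fun X _ => (K.skips X).ne_nil
  have hneg := length_le_flatMap (l := x.neg) (e := enc) fun X _ => (K.skips X).ne_nil
  rw [Sample.length_encode, List.length_append]
  omega

theorem numStates_lt {X : Model x.numProp} (hX : X ∈ x.pos ++ x.neg) :
    (K.toCGS X).numStates < (x.encode enc).length := by
  have hle := (K.numStates_le X).trans (length_le_length_flatMap (e := enc) hX)
  rw [List.flatMap_append, List.length_append] at hle
  rw [Sample.length_encode]
  omega

theorem exists_verify_iff_learnable :
    (∃ c : List (Cell k), c.length ≤ (x.encode enc).length ^ 4 ∧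
      K.Verify Ut Bt Bl n ((x.encode enc).map Sum.inl ++ c.map Sum.inr)) ↔
    K.Learnable Ut Bt Bl n x := by
  have hverify (c : List (Cell k)) := K.verify_iff_certifies (Ut := Ut) (Bt := Bt) (Bl := Bl)
    (n := n) (occursAt_of_append (x.encode enc) [] (c.map Sum.inr))
  refine ⟨fun ⟨c, _, hc⟩ => ((hverify c).1 hc).learnable, fun h => ?_⟩
  obtain ⟨D, T, hDT, hptr⟩ := h.exists_certifies
  have hlt : x.numProp + x.bound < (x.encode enc).length := by
    rw [Sample.length_encode]
    omega
  have hptr' (i) : D.l i < (x.encode enc).length ∧ D.r i < (x.encode enc).length :=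
    ⟨(hptr i).1.trans_lt hlt, (hptr i).2.trans_lt hlt⟩
  obtain ⟨c, hlen, hD, hT⟩ :=
    exists_certificate (x.encode enc) T fun i => ⟨(hptr' i).1.le, (hptr' i).2.le⟩
  have hstart := K.certStart_eq (occursAt_of_append (x.encode enc) [] (c.map Sum.inr))
  refine ⟨c, hlen.le, (hverify c).2 (hDT.congr (L := (x.encode enc).length) (by omega)
    (K.length_append_lt x).le (fun X hX => K.numStates_lt hX) (fun i _ => hptr' i) ?_ ?_)⟩
  · rw [dag, hstart]
    exact hD
  · unfold entry
    rw [hstart]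
    exact hT

theorem inNP (L : DecisionProblem) (Ut : Set UnOp) (Bt : Set BinTp) (Bl : Set BinLg) (n : ℕ∞)
    (toSample : L.Input → Sample Model) (henc : ∀ x, L.encode x = (toSample x).encode enc)
    (hyes : ∀ x, x ∈ L.yes ↔ K.Learnable Ut Bt Bl n (toSample x))
    (hlen : ∃ q : Polynomial ℕ, ∀ x, (L.encode x).length ≤ q.eval (L.size x)) : L.InNP := by
  classical
  have := Fintype.ofFinite (Cell k)
  refine ⟨hlen, Cell k, this, Polynomial.X ^ 4,
    fun y => decide (K.Verify Ut Bt Bl n (L.encodePair y)), ?_, fun x => ?_⟩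
  · exact (K.polyTime_verify Ut Bt Bl n).tm2ComputableInPolyTime _ _ fun y => decide_eq_true_iff
  · simp only [decide_eq_true_eq, Polynomial.eval_pow, Polynomial.eval_X,
      DecisionProblem.encodePair, henc]
    exact (hyes x).trans K.exists_verify_iff_learnable.symm

end Coding

/-! ### Reading encoded models -/

section BitTable

variable {Δ : Type}

/-- The `q`-th bit string of the list at position `i` represents a set that contains `p`. -/
def MemNthAt (w : List (Γ' ⊕ Δ)) (i q p : ℕ) : Prop := BitAt w (nthAt (skipList skipOne) w i q) p

theorem memNthAt_iff {m i q : ℕ} {w : List (Γ' ⊕ Δ)} {l : List (Finset (Fin m))}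
    (h : OccursAt w i (encList encSubset l)) (hq : q < l.length) (p : Fin m) :
    MemNthAt w i q p ↔ p ∈ l[q] :=
  bitAt_iff (occursAt_nthAt (fun _ _ => skips_encSubset _) h hq) p

theorem memNthAt_finRange_iff {m N i : ℕ} {w : List (Γ' ⊕ Δ)} {s : Fin N → Finset (Fin m)}
    (h : OccursAt w i (encList (fun q => encSubset (s q)) (List.finRange N))) (q : Fin N)
    (p : Fin m) : MemNthAt w i q p ↔ p ∈ s q :=
  bitAt_iff (occursAt_nthAt_finRange (fun _ => skips_encSubset _) h q) p

theorem PolyTimePred.memNthAt {α : Type} [Ctx (Γ' ⊕ Δ) α] {i q p : α → ℕ} (hi : PolyTime i)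
    (hq : PolyTime q) (hp : PolyTime p) :
    PolyTimePred fun a => MemNthAt (Ctx.word a) (i a) (q a) (p a) :=
  PolyTimePred.bitAt (PolyTime.nthAt PolyTimeSkip.one.list hi hq) hp

end BitTable

section Header

variable {Δ : Type}

/-- The part that the encodings of Kripke structures and of concurrent game structures have in
common: the number of states, the initial states and the labels. -/
def encHeader {m N : ℕ} (init : Finset (Fin N)) (label : Fin N → Finset (Fin m)) : List Γ' :=
  encNat N ++ encSubset init ++ encList (fun q => encSubset (label q)) (List.finRange N)

/-- The position of the initial states of the structure at position `s`. -/
noncomputable def initStart (w : List (Γ' ⊕ Δ)) (s : ℕ) : ℕ := skipNat w s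

/-- The position of the labels of the structure at position `s`. -/
noncomputable def labelStart (w : List (Γ' ⊕ Δ)) (s : ℕ) : ℕ := skipList skipOne w (initStart w s)

/-- The position after the header of the structure at position `s`. -/
noncomputable def transStart (w : List (Γ' ⊕ Δ)) (s : ℕ) : ℕ :=
  skipList (skipList skipOne) w (labelStart w s)

theorem skips_encHeader {m N : ℕ} (init : Finset (Fin N)) (label : Fin N → Finset (Fin m)) :
    Skips Δ transStart (encHeader init label) :=
  ((skips_skipNat N).append (skips_encSubset init)).append
    (skips_skipList fun q _ => skips_encSubset (label q))

variable {m N : ℕ} {init : Finset (Fin N)} {label : Fin N → Finset (Fin m)} {e : List Γ'}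
  {w : List (Γ' ⊕ Δ)} {s : ℕ}

theorem occursAt_of_header (h : OccursAt w s (encHeader init label ++ e)) :
    OccursAt w s (encNat N) ∧ OccursAt w (initStart w s) (encSubset init) ∧
      OccursAt w (labelStart w s) (encList (fun q => encSubset (label q)) (List.finRange N)) ∧
      OccursAt w (transStart w s) e := by
  rw [encHeader, List.append_assoc, List.append_assoc] at h
  obtain ⟨hN, h⟩ := (skips_skipNat _).split h
  obtain ⟨hinit, h⟩ := (skips_encSubset _).split h
  exact ⟨hN, hinit, (skips_skipList fun q _ => skips_encSubset _).split h⟩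

theorem numAt_header (h : OccursAt w s (encHeader init label ++ e)) : numAt w s = N :=
  numAt_eq (occursAt_of_header h).1

theorem bitAt_header_iff (h : OccursAt w s (encHeader init label ++ e)) (q : Fin N) :
    BitAt w (initStart w s) q ↔ q ∈ init :=
  bitAt_iff (occursAt_of_header h).2.1 q

theorem memNthAt_header_iff (h : OccursAt w s (encHeader init label ++ e)) (q : Fin N)
    (p : Fin m) : MemNthAt w (labelStart w s) q p ↔ p ∈ label q :=
  memNthAt_finRange_iff (occursAt_of_header h).2.2.1 q p

theorem PolyTimeSkip.comp {f g : List (Γ' ⊕ Δ) → ℕ → ℕ} (hf : PolyTimeSkip f)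
    (hg : PolyTimeSkip g) : PolyTimeSkip fun w i => g w (f w i) := hg.polyTime hf

theorem PolyTimeSkip.initStart : PolyTimeSkip (initStart (Δ := Δ)) := PolyTimeSkip.nat

theorem PolyTimeSkip.labelStart : PolyTimeSkip (labelStart (Δ := Δ)) :=
  PolyTimeSkip.initStart.comp PolyTimeSkip.one.list

theorem PolyTimeSkip.transStart : PolyTimeSkip (transStart (Δ := Δ)) :=
  PolyTimeSkip.labelStart.comp PolyTimeSkip.one.list.list

theorem PolyTimeSkip.numAt : PolyTimeSkip (numAt (Δ := Δ)) := PolyTime.numAt var₀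

end Header

namespace CGS

theorem pre_iff {k : ℕ} {P : Type} {C : CGS k P} {A : Finset (Fin k)} {S : C.Q → Prop} {q : C.Q} :
    C.pre A S q ↔ ∃ β : (a : Fin k) → Fin (C.d q a), ∀ β' : (a : Fin k) → Fin (C.d q a),
      (∀ a ∈ A, β' a = β a) → S (C.δ q β') := by
  classical
  constructor
  · rintro ⟨α, hα⟩
    refine ⟨fun a => if h : a ∈ A then α a h else ⟨0, C.d_pos q a⟩, fun β' hβ' => ?_⟩
    exact hα _ ⟨β', fun a ha => (hβ' a ha).trans (dif_pos ha), rfl⟩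
  · rintro ⟨β, hβ⟩
    refine ⟨fun a _ => β a, ?_⟩
    rintro _ ⟨β', hβ', rfl⟩
    exact hβ β' hβ'

section Rows

variable {Δ : Type}

/-- The position after a line of the transition table. -/
noncomputable def skipRow (w : List (Γ' ⊕ Δ)) (i : ℕ) : ℕ :=
  skipNat w (skipList skipNat w (skipNat w i))

/-- The action of agent `a` in the line at position `i`. -/
noncomputable def rowAction (a : ℕ) (w : List (Γ' ⊕ Δ)) (i : ℕ) : ℕ :=
  numAt w (nthAt skipNat w (skipNat w i) a)

/-- The next state in the line at position `i`. -/
noncomputable def rowNext (w : List (Γ' ⊕ Δ)) (i : ℕ) : ℕ :=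
  numAt w (skipList skipNat w (skipNat w i))

/-- The position of the list of lines for state `q` of the structure at position `s`. -/
noncomputable def rowsStart (w : List (Γ' ⊕ Δ)) (s q : ℕ) : ℕ :=
  nthAt (skipList skipRow) w (skipList (skipList skipNat) w (transStart w s)) q

theorem polyTimeSkip_skipRow : PolyTimeSkip (skipRow (Δ := Δ)) :=
  (PolyTimeSkip.nat.comp PolyTimeSkip.nat.list).comp PolyTimeSkip.nat

theorem polyTimeSkip_rowAction (a : ℕ) : PolyTimeSkip (rowAction (Δ := Δ) a) :=
  PolyTime.numAt (PolyTime.nthAt PolyTimeSkip.nat (PolyTimeSkip.nat.polyTime var₀) (.const a))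

theorem polyTimeSkip_rowNext : PolyTimeSkip (rowNext (Δ := Δ)) :=
  PolyTime.numAt (PolyTimeSkip.nat.list.polyTime (PolyTimeSkip.nat.polyTime var₀))

theorem polyTime_rowsStart {α : Type} [Ctx (Γ' ⊕ Δ) α] {s q : α → ℕ} (hs : PolyTime s)
    (hq : PolyTime q) : PolyTime fun a => rowsStart (Ctx.word a) (s a) (q a) :=
  PolyTime.nthAt polyTimeSkip_skipRow.list
    (PolyTimeSkip.nat.list.list.polyTime (PolyTimeSkip.transStart.polyTime hs)) hq

variable {k m : ℕ} {C : CGS k (Fin m)} {q : C.Q} {w : List (Γ' ⊕ Δ)}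

theorem skips_encodeRow (α : (a : Fin k) → Fin (C.d q a)) :
    Skips Δ skipRow (C.encodeRow q α) :=
  ((skips_skipNat _).append (skips_skipList fun _ _ => skips_skipNat _)).append (skips_skipNat _)

theorem rowAction_eq {α : (a : Fin k) → Fin (C.d q a)} {i : ℕ}
    (h : OccursAt w i (C.encodeRow q α)) (a : Fin k) : rowAction a w i = α a := by
  rw [encodeRow, List.append_assoc] at h
  have hacts := ((skips_skipList fun a _ => skips_skipNat _).split
    ((skips_skipNat _).split h).2).1
  exact numAt_eq (occursAt_nthAt_finRange (fun a => skips_skipNat _) hacts a)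

theorem rowNext_eq {α : (a : Fin k) → Fin (C.d q a)} {i : ℕ}
    (h : OccursAt w i (C.encodeRow q α)) : rowNext w i = C.δ q α := by
  rw [encodeRow, List.append_assoc] at h
  exact numAt_eq ((skips_skipList fun a _ => skips_skipNat _).split
    ((skips_skipNat _).split h).2).2

theorem occursAt_header {s : ℕ} (h : OccursAt w s C.encode) :
    OccursAt w s (encHeader C.init C.label ++
      (encList (fun q => encList (fun a => encNat (C.d q a)) (List.finRange k))
        (List.finRange C.numStates) ++
      encList (fun q => encList (fun j => C.encodeRow q (finPiFinEquiv.symm j))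
        (List.finRange (∏ a, C.d q a))) (List.finRange C.numStates))) := by
  rwa [encode, List.append_assoc] at h

theorem occursAt_rowsStart {s : ℕ} (h : OccursAt w s C.encode) (q : C.Q) :
    OccursAt w (rowsStart w s q) (encList (fun j => C.encodeRow q (finPiFinEquiv.symm j))
      (List.finRange (∏ a, C.d q a))) := by
  have htrans := (occursAt_of_header (occursAt_header h)).2.2.2
  have hrows := ((skips_skipList fun q _ => skips_skipList fun a _ => skips_skipNat _).split
    htrans).2
  exact occursAt_nthAt_finRange (fun q => skips_skipList fun j _ => skips_encodeRow _) hrows q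

theorem countAt_rowsStart {s : ℕ} (h : OccursAt w s C.encode) (q : C.Q) :
    countAt skipRow w (rowsStart w s q) = ∏ a, C.d q a := by
  rw [countAt_eq (fun j _ => skips_encodeRow _) (occursAt_rowsStart h q), List.length_finRange]

theorem occursAt_row {s : ℕ} (h : OccursAt w s C.encode) (q : C.Q) (j : Fin (∏ a, C.d q a)) :
    OccursAt w (nthAt skipRow w (rowsStart w s q) j) (C.encodeRow q (finPiFinEquiv.symm j)) :=
  occursAt_nthAt_finRange (fun _ => skips_encodeRow _) (occursAt_rowsStart h q) j

end Rows

section PreAt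

variable {Δ : Type} {k : ℕ}

/-- The predecessor operator of the structure at position `s`: some line for state `q` fixes
actions of the coalition `A` such that all lines for `q` with the same actions of `A` lead
to `Z`. -/
def PreAt (A : Finset (Fin k)) (w : List (Γ' ⊕ Δ)) (s q : ℕ) (Z : ℕ → Prop) : Prop :=
  ∃ j < countAt skipRow w (rowsStart w s q), ∀ j' < countAt skipRow w (rowsStart w s q),
    (∀ a : Fin k, a ∈ A → rowAction a w (nthAt skipRow w (rowsStart w s q) j') =
      rowAction a w (nthAt skipRow w (rowsStart w s q) j)) →
    Z (rowNext w (nthAt skipRow w (rowsStart w s q) j'))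

theorem polyTimePred_preAt (A : Finset (Fin k)) {α : Type} [Ctx (Γ' ⊕ Δ) α] {s q : α → ℕ}
    {Z : α → ℕ → Prop} (hs : PolyTime s) (hq : PolyTime q)
    (hZ : PolyTimePred fun c : α × ℕ => Z c.1 c.2) :
    PolyTimePred fun a => PreAt A (Ctx.word a) (s a) (q a) (Z a) := by
  have hrows := polyTime_rowsStart hs hq
  have hrow₀ := PolyTime.nthAt polyTimeSkip_skipRow hrows.weaken.weaken var₀
  have hrow₁ := PolyTime.nthAt polyTimeSkip_skipRow hrows.weaken.weaken var₁
  refine PolyTimePred.exists_lt (r := fun a j => ∀ j' < countAt skipRow (Ctx.word a)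
    (rowsStart (Ctx.word a) (s a) (q a)), _) (PolyTime.countAt polyTimeSkip_skipRow hrows) ?_
  refine PolyTimePred.forall_lt (r := fun (c : α × ℕ) j' => _ → _)
    (PolyTime.countAt polyTimeSkip_skipRow hrows.weaken) (PolyTimePred.imp ?_ ?_)
  · exact PolyTimePred.forall_finite fun a => PolyTimePred.imp (PolyTimePred.const _)
      (PolyTimePred.eq ((polyTimeSkip_rowAction a).polyTime hrow₀)
        ((polyTimeSkip_rowAction a).polyTime hrow₁))
  · exact PolyTime.bind (PolyTime.weaken_under (PolyTime.weaken_under hZ))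
      (polyTimeSkip_rowNext.polyTime hrow₀)

theorem preAt_iff {m : ℕ} {C : CGS k (Fin m)} {w : List (Γ' ⊕ Δ)} {s : ℕ}
    (h : OccursAt w s C.encode) {A : Finset (Fin k)} {q : C.Q} {Z : ℕ → Prop} :
    PreAt A w s q Z ↔ C.pre A (fun q' => Z q') q := by
  rw [PreAt, countAt_rowsStart h q, pre_iff]
  constructor
  · rintro ⟨j, hj, H⟩
    refine ⟨finPiFinEquiv.symm ⟨j, hj⟩, fun β' hβ' => ?_⟩
    obtain ⟨j', rfl⟩ := finPiFinEquiv.symm.surjective β'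
    rw [← rowNext_eq (occursAt_row h q j')]
    refine H j' j'.2 fun a ha => ?_
    rw [rowAction_eq (occursAt_row h q j'), rowAction_eq (occursAt_row h q ⟨j, hj⟩), hβ' a ha]
  · rintro ⟨β, hβ⟩
    obtain ⟨j, rfl⟩ := finPiFinEquiv.symm.surjective β
    refine ⟨j, j.2, fun j' hj' H => ?_⟩
    rw [rowNext_eq (occursAt_row h q ⟨j', hj'⟩)]
    refine hβ _ fun a ha => Fin.ext ?_
    rw [← rowAction_eq (occursAt_row h q ⟨j', hj'⟩), ← rowAction_eq (occursAt_row h q j), H a ha]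

end PreAt

/-- Concurrent game structures, read from their encodings. -/
noncomputable def coding (k : ℕ) : Coding k (fun m => CGS k (Fin m)) CGS.encode where
  toCGS C := C
  skip w s := skipList (skipList skipRow) w (skipList (skipList skipNat) w (transStart w s))
  numStates := numAt
  init w s q := BitAt w (initStart w s) q
  label w s := MemNthAt w (labelStart w s)
  pre := PreAt
  polyTime_skip := (PolyTimeSkip.transStart.comp PolyTimeSkip.nat.list.list).comp
    polyTimeSkip_skipRow.list.list
  polyTime_numStates := PolyTimeSkip.numAt
  polyTime_init hs hq := PolyTimePred.bitAt (PolyTimeSkip.initStart.polyTime hs) hq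
  polyTime_label hs hq hp := PolyTimePred.memNthAt (PolyTimeSkip.labelStart.polyTime hs) hq hp
  polyTime_pre A _ _ _ _ _ hs hq hZ := polyTimePred_preAt A hs hq hZ
  skips C := ((skips_encHeader C.init C.label).append
    (skips_skipList fun q _ => skips_skipList fun a _ => skips_skipNat _)).append
      (skips_skipList fun q _ => skips_skipList fun j _ => skips_encodeRow _)
  numStates_le C := by
    simp only [encode, List.length_append, length_encNat]
    omega
  numStates_eq _ _ _ h := numAt_header (occursAt_header h)
  init_iff _ _ _ h := bitAt_header_iff (occursAt_header h)
  label_iff _ _ _ h := memNthAt_header_iff (occursAt_header h)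
  pre_iff _ _ _ h _ _ _ := preAt_iff h

end CGS

/-! ### Kripke structures -/

namespace Kripke

variable {P : Type} (K : Kripke P)

/-- A Kripke structure as a game structure with one agent, who chooses the successor. -/
noncomputable abbrev toCGS : CGS 1 P where
  numStates := K.numStates
  init := K.init
  label := K.label
  d q _ := (K.succ q).card
  d_pos q _ := (K.succ_nonempty q).card_pos
  δ q β := (K.succ q).equivFin.symm (β 0)

variable {K} {q : K.Q}

theorem exists_toCGS_δ_iff {q' : K.Q} :
    (∃ β : (a : Fin 1) → Fin (K.toCGS.d q a), K.toCGS.δ q β = q') ↔ q' ∈ K.succ q := by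
  constructor
  · rintro ⟨β, rfl⟩
    exact ((K.succ q).equivFin.symm (β 0)).2
  · exact fun h => ⟨fun _ => (K.succ q).equivFin ⟨q', h⟩, by simp [toCGS]⟩

theorem mem_succ_of_mem_toCGS_succ {A : Finset (Fin 1)} {q' : K.Q}
    {α : (a : Fin 1) → a ∈ A → Fin (K.toCGS.d q a)} (h : q' ∈ K.toCGS.succ A q α) :
    q' ∈ K.succ q :=
  let ⟨β, _, h⟩ := h
  exists_toCGS_δ_iff.1 ⟨β, h⟩

theorem enforces_empty_iff {S : Set (ℕ → K.Q)} :
    K.toCGS.Enforces ∅ q S ↔ ∀ ρ ∈ K.out q, ρ ∈ S := by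
  have hout : ∀ s, K.toCGS.out ∅ s q = K.out q := fun s => by
    refine Set.ext fun ρ => and_congr Iff.rfl (forall_congr' fun i => ?_)
    refine Iff.trans ?_ exists_toCGS_δ_iff
    exact exists_congr fun β => by simp
  constructor
  · rintro ⟨s, hs⟩
    rwa [hout] at hs
  · intro h
    refine ⟨fun a ha => absurd ha (Finset.notMem_empty a), ?_⟩
    rwa [hout]

theorem exists_mem_of_enforces_univ {S : Set (ℕ → K.Q)}
    (h : K.toCGS.Enforces Finset.univ q S) : ∃ ρ ∈ K.out q, ρ ∈ S := by
  obtain ⟨s, hs⟩ := h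
  choose next hnext using fun (h : List K.Q) (x : K.Q) =>
    K.toCGS.succ_nonempty Finset.univ x fun a ha => s a ha h x
  obtain ⟨ρ, hρ, -⟩ := CGS.exists_mem_out_of_next s q next hnext
  exact ⟨ρ, ⟨hρ.1, fun i => mem_succ_of_mem_toCGS_succ (hρ.2 i)⟩, hs ρ hρ⟩

/-- The strategy that, after a history of length `i`, moves to `ρ (i + 1)` if it can. -/
noncomputable def followStrategy (ρ : ℕ → K.Q) (a : Fin 1) (_ : a ∈ Finset.univ) :
    K.toCGS.Strategy a := by
  classical
  exact fun h x => if hmem : ρ (h.length + 1) ∈ K.succ x then (K.succ x).equivFin ⟨_, hmem⟩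
    else ⟨0, (K.succ_nonempty x).card_pos⟩

theorem eq_of_mem_out_followStrategy {ρ ρ' : ℕ → K.Q} (hρ : ρ ∈ K.out q)
    (hρ' : ρ' ∈ K.toCGS.out Finset.univ (followStrategy ρ) q) : ρ' = ρ := by
  funext i
  induction i with
  | zero => exact hρ'.1.trans hρ.1.symm
  | succ i ih =>
    obtain ⟨γ, hγ, hnext⟩ := hρ'.2 i
    have hmem : ρ (((List.range i).map ρ').length + 1) ∈ K.succ (ρ' i) := by
      rw [ih, List.length_map, List.length_range]
      exact hρ.2 i
    have hγ₀ : γ 0 = (K.succ (ρ' i)).equivFin ⟨_, hmem⟩ :=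
      (hγ 0 (Finset.mem_univ 0)).trans (dif_pos hmem)
    rw [← hnext]
    change ((K.succ (ρ' i)).equivFin.symm (γ 0) : K.Q) = ρ (i + 1)
    simp only [hγ₀, Equiv.symm_apply_apply, List.length_map, List.length_range]

theorem enforces_univ_iff {S : Set (ℕ → K.Q)} :
    K.toCGS.Enforces Finset.univ q S ↔ ∃ ρ ∈ K.out q, ρ ∈ S := by
  refine ⟨exists_mem_of_enforces_univ, ?_⟩
  rintro ⟨ρ, hρ, hS⟩
  exact ⟨followStrategy ρ, fun ρ' hρ' => eq_of_mem_out_followStrategy hρ hρ' ▸ hS⟩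

theorem coalition_eq_empty_or_univ (A : Finset (Fin 1)) : A = ∅ ∨ A = Finset.univ := by
  revert A
  decide

theorem quant_eq_enforces : K.Quant = K.toCGS.Enforces := by
  funext A q S
  refine propext ?_
  unfold Quant
  rcases coalition_eq_empty_or_univ A with rfl | rfl
  · simp only [true_and, enforces_empty_iff, or_iff_left_iff_imp]
    rintro ⟨h, -⟩
    exact absurd h (by decide)
  · simp only [true_and, enforces_univ_iff, or_iff_right_iff_imp]
    rintro ⟨h, -⟩
    exact absurd h (by decide)

theorem sat_toCGS_iff (φ : CTL P) : K.toCGS.Sat φ ↔ K.Sat φ := by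
  unfold CGS.Sat Sat
  rw [quant_eq_enforces]

theorem pre_empty_iff {S : K.Q → Prop} : K.toCGS.pre ∅ S q ↔ ∀ q' ∈ K.succ q, S q' := by
  refine CGS.pre_iff.trans ?_
  constructor
  · rintro ⟨_, h⟩ q' hq'
    obtain ⟨β, rfl⟩ := exists_toCGS_δ_iff.2 hq'
    exact h β (by simp)
  · exact fun h => ⟨fun a => ⟨0, K.toCGS.d_pos q a⟩, fun β' _ =>
      h _ (exists_toCGS_δ_iff.1 ⟨β', rfl⟩)⟩

theorem pre_univ_iff {S : K.Q → Prop} :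
    K.toCGS.pre Finset.univ S q ↔ ∃ q' ∈ K.succ q, S q' := by
  refine CGS.pre_iff.trans ?_
  constructor
  · exact fun ⟨β, h⟩ => ⟨_, exists_toCGS_δ_iff.1 ⟨β, rfl⟩, h β fun _ _ => rfl⟩
  · rintro ⟨q', hq', h⟩
    obtain ⟨β, rfl⟩ := exists_toCGS_δ_iff.2 hq'
    refine ⟨β, fun β' hβ' => ?_⟩
    rwa [funext fun a => hβ' a (Finset.mem_univ a)]

section PreAt

variable {Δ : Type}

/-- In the Kripke structure at position `s`, state `q'` is a successor of `q`. -/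
def SuccAt (w : List (Γ' ⊕ Δ)) (s : ℕ) : ℕ → ℕ → Prop := MemNthAt w (transStart w s)

/-- The predecessor operator of the Kripke structure at position `s`. -/
def PreAt (A : Finset (Fin 1)) (w : List (Γ' ⊕ Δ)) (s q : ℕ) (Z : ℕ → Prop) : Prop :=
  (A = ∅ ∧ ∀ q' < numAt w s, SuccAt w s q q' → Z q') ∨
    (A = Finset.univ ∧ ∃ q' < numAt w s, SuccAt w s q q' ∧ Z q')

section PolyTime

variable {α : Type} [Ctx (Γ' ⊕ Δ) α] {s q : α → ℕ}

theorem polyTimePred_succAt {q' : α → ℕ} (hs : PolyTime s) (hq : PolyTime q) (hq' : PolyTime q') :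
    PolyTimePred fun a => SuccAt (Ctx.word a) (s a) (q a) (q' a) :=
  PolyTimePred.memNthAt (PolyTimeSkip.transStart.polyTime hs) hq hq'

theorem polyTimePred_preAt (A : Finset (Fin 1)) {Z : α → ℕ → Prop} (hs : PolyTime s)
    (hq : PolyTime q) (hZ : PolyTimePred fun c : α × ℕ => Z c.1 c.2) :
    PolyTimePred fun a => PreAt A (Ctx.word a) (s a) (q a) (Z a) := by
  have hsucc := polyTimePred_succAt hs.weaken hq.weaken var₀
  refine ((PolyTimePred.const _).and ?_).or ((PolyTimePred.const _).and ?_)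
  · exact PolyTimePred.forall_lt (r := fun a q' => SuccAt (Ctx.word a) (s a) (q a) q' → Z a q')
      (PolyTime.numAt hs) (hsucc.imp hZ)
  · exact PolyTimePred.exists_lt (r := fun a q' => SuccAt (Ctx.word a) (s a) (q a) q' ∧ Z a q')
      (PolyTime.numAt hs) (hsucc.and hZ)

end PolyTime

variable {m s : ℕ} {K : Kripke (Fin m)} {w : List (Γ' ⊕ Δ)}

theorem succAt_iff (h : OccursAt w s K.encode) (q q' : K.Q) :
    SuccAt w s q q' ↔ q' ∈ K.succ q :=
  memNthAt_finRange_iff (occursAt_of_header h).2.2.2 q q'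

theorem preAt_iff (h : OccursAt w s K.encode) {A : Finset (Fin 1)} {q : K.Q} {Z : ℕ → Prop} :
    PreAt A w s q Z ↔ K.toCGS.pre A (fun q' => Z q') q := by
  have hsucc : ∀ q' : K.Q, SuccAt w s q q' ↔ _ := succAt_iff h q
  have hne : (∅ : Finset (Fin 1)) ≠ Finset.univ := by decide
  rw [PreAt, numAt_header h]
  rcases coalition_eq_empty_or_univ A with rfl | rfl
  · simp only [hne, true_and, false_and, or_false]
    refine Iff.trans ?_ pre_empty_iff.symm
    exact ⟨fun H q' hq' => H q' q'.2 ((hsucc q').2 hq'),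
      fun H q' hq' h' => H ⟨q', hq'⟩ ((hsucc ⟨q', hq'⟩).1 h')⟩
  · simp only [hne.symm, true_and, false_and, false_or]
    refine Iff.trans ?_ pre_univ_iff.symm
    exact ⟨fun ⟨q', hq', h', H⟩ => ⟨⟨q', hq'⟩, (hsucc ⟨q', hq'⟩).1 h', H⟩,
      fun ⟨q', h', H⟩ => ⟨q', q'.2, (hsucc q').2 h', H⟩⟩

end PreAt

/-- Kripke structures, read from their encodings. -/
noncomputable def coding : Coding 1 (fun m => Kripke (Fin m)) Kripke.encode where
  toCGS K := K.toCGS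
  skip w s := skipList (skipList skipOne) w (transStart w s)
  numStates := numAt
  init w s q := BitAt w (initStart w s) q
  label w s := MemNthAt w (labelStart w s)
  pre := PreAt
  polyTime_skip := PolyTimeSkip.transStart.comp PolyTimeSkip.one.list.list
  polyTime_numStates := PolyTimeSkip.numAt
  polyTime_init hs hq := PolyTimePred.bitAt (PolyTimeSkip.initStart.polyTime hs) hq
  polyTime_label hs hq hp := PolyTimePred.memNthAt (PolyTimeSkip.labelStart.polyTime hs) hq hp
  polyTime_pre A _ _ _ _ _ hs hq hZ := polyTimePred_preAt A hs hq hZ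
  skips K := (skips_encHeader K.init K.label).append (skips_skipList fun q _ => skips_encSubset _)
  numStates_le K := by
    simp only [encode, List.length_append, length_encNat]
    omega
  numStates_eq _ _ _ h := numAt_header h
  init_iff _ _ _ h := bitAt_header_iff h
  label_iff _ _ _ h := memNthAt_header_iff h
  pre_iff _ _ _ h _ _ _ := preAt_iff h

end Kripke

/-! ### LTL as the logic of game structures without agents -/

namespace LTL

variable {P : Type}

/-- An LTL formula as a state formula for game structures without agents. -/
def toATL : LTL P → ATL 0 P
  | prop p => .prop p
  | un .neg φ => .neg φ.toATL
  | un (.tp o) φ => .un ∅ o φ.toATL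
  | tp o φ ψ => .tp ∅ o φ.toATL ψ.toATL
  | lg o φ ψ => .lg o φ.toATL ψ.toATL

/-- The inverse of `toATL`. -/
def ofATL : ATL 0 P → LTL P
  | .prop p => prop p
  | .neg φ => un .neg (ofATL φ)
  | .un _ o φ => un (.tp o) (ofATL φ)
  | .tp _ o φ ψ => tp o (ofATL φ) (ofATL ψ)
  | .lg o φ ψ => lg o (ofATL φ) (ofATL ψ)

theorem ofATL_toATL (φ : LTL P) : ofATL φ.toATL = φ := by
  induction φ with
  | prop p => rfl
  | un o φ ih => cases o <;> simp [toATL, ofATL, ih]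
  | tp o φ ψ ih₁ ih₂ | lg o φ ψ ih₁ ih₂ => simp [toATL, ofATL, ih₁, ih₂]

theorem toATL_ofATL (φ : ATL 0 P) : (ofATL φ).toATL = φ := by
  induction φ with
  | prop p => rfl
  | neg φ ih => simp [toATL, ofATL, ih]
  | un A o φ ih => simp [toATL, ofATL, ih, Subsingleton.elim A ∅]
  | tp A o φ ψ ih₁ ih₂ => simp [toATL, ofATL, ih₁, ih₂, Subsingleton.elim A ∅]
  | lg o φ ψ ih₁ ih₂ => simp [toATL, ofATL, ih₁, ih₂]

theorem toATL_injective : Function.Injective (toATL (P := P)) :=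
  Function.LeftInverse.injective ofATL_toATL

theorem inFragment_toATL_iff {Ut : Set UnOp} {Bt : Set BinTp} {Bl : Set BinLg} (φ : LTL P) :
    φ.toATL.InFragment Ut Bt Bl ↔ φ.InFragment Ut Bt Bl := by
  induction φ with
  | prop p => rfl
  | un o φ ih => cases o <;> simp [toATL, InFragment, ATL.InFragment, ih]
  | tp o φ ψ ih₁ ih₂ | lg o φ ψ ih₁ ih₂ => simp [toATL, InFragment, ATL.InFragment, ih₁, ih₂]

theorem isBin_toATL (φ : LTL P) : φ.toATL.isBin = φ.isBin := by
  cases φ with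
  | un o φ => cases o <;> rfl
  | _ => rfl

variable [DecidableEq P]

theorem subF_toATL (φ : LTL P) : φ.toATL.subF = φ.subF.image toATL := by
  induction φ with
  | prop p => rfl
  | un o φ ih => cases o <;> simp [toATL, subF, ATL.subF, ih]
  | tp o φ ψ ih₁ ih₂ | lg o φ ψ ih₁ ih₂ =>
    simp [toATL, subF, ATL.subF, ih₁, ih₂, Finset.image_union]

theorem size_toATL (φ : LTL P) : φ.toATL.size = φ.size := by
  rw [ATL.size, subF_toATL, Finset.card_image_of_injective _ toATL_injective, size]

theorem numBin_toATL (φ : LTL P) : φ.toATL.numBin = φ.numBin := by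
  rw [ATL.numBin, subF_toATL, Finset.filter_image,
    Finset.card_image_of_injective _ toATL_injective, numBin]
  simp only [isBin_toATL]

end LTL

namespace UPWord

variable {P : Type} (x : UPWord P)

theorem length_v_pos : 0 < x.v.length := List.length_pos_of_ne_nil x.v_ne

theorem size_pos : 0 < x.size := Nat.add_pos_right _ x.length_v_pos

/-- The position after `q`, where the end of the period is followed by its start. -/
def next (q : ℕ) : ℕ := if q + 1 < x.size then q + 1 else x.u.length

theorem next_lt (q : ℕ) : x.next q < x.size := by
  have := x.length_v_pos
  unfold next
  split_ifs with h
  · exact h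
  · unfold size
    omega

/-- An ultimately periodic word as a game structure without agents. -/
abbrev toCGS : CGS 0 P where
  numStates := x.size
  init := {⟨0, x.size_pos⟩}
  label q := x.word q
  d _ a := a.elim0
  d_pos _ a := a.elim0
  δ q _ := ⟨x.next q, x.next_lt q⟩

/-- The state at position `i`. -/
def state (i : ℕ) : x.toCGS.Q :=
  ⟨if i < x.u.length then i else x.u.length + (i - x.u.length) % x.v.length, by
    have := Nat.mod_lt (i - x.u.length) x.length_v_pos
    split_ifs <;> simp only [size] <;> omega⟩

theorem coe_state (i : ℕ) : (x.state i : ℕ) =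
    if i < x.u.length then i else x.u.length + (i - x.u.length) % x.v.length := rfl

theorem word_state (i : ℕ) : x.word (x.state i) = x.word i := by
  unfold state word
  dsimp only
  by_cases h : i < x.u.length <;> simp [h]

theorem state_succ (i : ℕ) : (x.state (i + 1) : ℕ) = x.next (x.state i) := by
  have hv := x.length_v_pos
  rw [coe_state, coe_state, next, size]
  rcases lt_trichotomy (i + 1) x.u.length with h | h | h
  · rw [if_pos h, if_pos (by omega : i < x.u.length), if_pos (by omega)]
  · rw [if_neg (by omega), if_pos (by omega : i < x.u.length), if_pos (by omega)]
    simp [h]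
  · rw [if_neg (by omega), if_neg (by omega : ¬ i < x.u.length)]
    obtain ⟨t, rfl⟩ := Nat.exists_eq_add_of_le (show x.u.length ≤ i by omega)
    rw [show x.u.length + t + 1 - x.u.length = t + 1 by omega, Nat.add_sub_cancel_left]
    have ht := Nat.mod_lt t hv
    rw [← Nat.mod_add_mod]
    split_ifs with h'
    · rw [Nat.mod_eq_of_lt (by omega)]
      omega
    · rw [show t % x.v.length + 1 = x.v.length by omega, Nat.mod_self, Nat.add_zero]

theorem mem_out_iff {s : (a : Fin 0) → a ∈ (∅ : Finset (Fin 0)) → x.toCGS.Strategy a} {i : ℕ}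
    {ρ : ℕ → x.toCGS.Q} :
    ρ ∈ x.toCGS.out ∅ s (x.state i) ↔ ρ = fun j => x.state (i + j) := by
  constructor
  · rintro ⟨h0, h⟩
    funext j
    induction j with
    | zero => exact h0
    | succ j ih =>
      obtain ⟨β, -, hβ⟩ := h j
      rw [← hβ, ih]
      exact Fin.ext (x.state_succ (i + j)).symm
  · rintro rfl
    exact ⟨rfl, fun j => ⟨fun a => a.elim0, fun a => a.elim0, Fin.ext (x.state_succ (i + j)).symm⟩⟩

theorem enforces_iff {i : ℕ} {S : Set (ℕ → x.toCGS.Q)} :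
    x.toCGS.Enforces ∅ (x.state i) S ↔ (fun j => x.state (i + j)) ∈ S := by
  constructor
  · exact fun ⟨s, hs⟩ => hs _ ((mem_out_iff x).2 rfl)
  · intro h
    refine ⟨fun a => a.elim0, fun ρ hρ => ?_⟩
    rwa [(mem_out_iff x).1 hρ]

theorem satAt_toATL_iff (φ : LTL P) (i : ℕ) :
    φ.toATL.SatAt x.toCGS.label x.toCGS.Enforces (x.state i) ↔ φ.Sat fun j => x.word (i + j) := by
  have hshift {φ : LTL P} (i : ℕ)
      (ih : ∀ i, φ.toATL.SatAt x.toCGS.label x.toCGS.Enforces (x.state i) ↔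
        φ.Sat fun j => x.word (i + j)) :
      (fun j => φ.toATL.SatAt x.toCGS.label x.toCGS.Enforces (x.state (i + j))) =
        fun j => φ.Sat fun l => x.word (i + (j + l)) :=
    funext fun j => propext ((ih _).trans (by simp only [Nat.add_assoc]))
  induction φ generalizing i with
  | prop p =>
    change p ∈ x.word (x.state i) ↔ _
    rw [word_state]
    rfl
  | un o φ ih =>
    cases o with
    | neg => exact not_congr (iff_of_eq (congrFun (hshift i ih) 0))
    | tp o => exact (enforces_iff x).trans (iff_of_eq (congrArg o.eval (hshift i ih)))
  | tp o φ ψ ih₁ ih₂ =>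
    exact (enforces_iff x).trans (iff_of_eq (congrArg₂ o.eval (hshift i ih₁) (hshift i ih₂)))
  | lg o φ ψ ih₁ ih₂ => exact iff_of_eq (congrArg₂ o.eval (propext (ih₁ i)) (propext (ih₂ i)))

theorem sat_toATL_iff (φ : LTL P) : x.toCGS.Sat φ.toATL ↔ φ.Sat x.word := by
  have hzero : x.state 0 = ⟨0, x.size_pos⟩ := by
    refine Fin.ext ?_
    unfold state
    dsimp only
    split_ifs with h
    · rfl
    · simp [Nat.eq_zero_of_not_pos h]
  unfold CGS.Sat
  simp only [Finset.mem_singleton, forall_eq]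
  rw [← hzero]
  simpa using x.satAt_toATL_iff φ 0

theorem pre_toCGS_iff {A : Finset (Fin 0)} {S : x.toCGS.Q → Prop} {q : x.toCGS.Q} :
    x.toCGS.pre A S q ↔ S ⟨x.next q, x.next_lt q⟩ :=
  CGS.pre_iff.trans ⟨fun ⟨β, h⟩ => h β fun _ _ => rfl, fun h => ⟨fun a => a.elim0, fun _ _ => h⟩⟩

section Reading

variable {Δ : Type}

/-- The position of the period of the word at position `s`. -/
noncomputable def periodStart (w : List (Γ' ⊕ Δ)) (s : ℕ) : ℕ := skipList (skipList skipOne) w s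

/-- The length of the list of letters at position `s`. -/
noncomputable def numLetters (w : List (Γ' ⊕ Δ)) (s : ℕ) : ℕ := countAt (skipList skipOne) w s

/-- The number of positions of the word at position `s`. -/
noncomputable def sizeAt (w : List (Γ' ⊕ Δ)) (s : ℕ) : ℕ :=
  numLetters w s + numLetters w (periodStart w s)

/-- The letter at position `q` of the word at position `s` contains `p`. -/
def LabelAt (w : List (Γ' ⊕ Δ)) (s q p : ℕ) : Prop :=
  (q < numLetters w s ∧ MemNthAt w s q p) ∨
    (¬ q < numLetters w s ∧ MemNthAt w (periodStart w s) (q - numLetters w s) p)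

/-- The predecessor operator of the word at position `s`. -/
def PreAt (w : List (Γ' ⊕ Δ)) (s q : ℕ) (Z : ℕ → Prop) : Prop :=
  (q + 1 < sizeAt w s ∧ Z (q + 1)) ∨ (¬ q + 1 < sizeAt w s ∧ Z (numLetters w s))

theorem polyTimeSkip_periodStart : PolyTimeSkip (periodStart (Δ := Δ)) := PolyTimeSkip.one.list.list

theorem polyTimeSkip_numLetters : PolyTimeSkip (numLetters (Δ := Δ)) :=
  PolyTime.countAt PolyTimeSkip.one.list var₀

theorem polyTimeSkip_sizeAt : PolyTimeSkip (sizeAt (Δ := Δ)) :=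
  PolyTime.add polyTimeSkip_numLetters (polyTimeSkip_periodStart.comp polyTimeSkip_numLetters)

variable {m s : ℕ} {w : List (Γ' ⊕ Δ)}

theorem numLetters_eq {l : List (Finset (Fin m))} (h : OccursAt w s (encList encSubset l)) :
    numLetters w s = l.length :=
  countAt_eq (fun _ _ => skips_encSubset _) h

variable {x : UPWord (Fin m)} (h : OccursAt w s x.encode)
include h

theorem occursAt_encode :
    OccursAt w s (encList encSubset x.u) ∧ OccursAt w (periodStart w s) (encList encSubset x.v) :=
  (skips_skipList fun _ _ => skips_encSubset _).split h

theorem sizeAt_eq : sizeAt w s = x.size := by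
  rw [sizeAt, numLetters_eq (occursAt_encode h).1, numLetters_eq (occursAt_encode h).2, size]

theorem labelAt_iff (q : x.toCGS.Q) (p : Fin m) : LabelAt w s q p ↔ p ∈ x.word q := by
  obtain ⟨hu, hv⟩ := occursAt_encode h
  have hq : (q : ℕ) < x.u.length + x.v.length := q.2
  rw [LabelAt, numLetters_eq hu, UPWord.word]
  by_cases hlt : (q : ℕ) < x.u.length
  · simp [hlt, memNthAt_iff hu hlt]
  · have hsub : (q : ℕ) - x.u.length < x.v.length := by omega
    simp [hlt, memNthAt_iff hv hsub, Nat.mod_eq_of_lt hsub]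

theorem preAt_iff {A : Finset (Fin 0)} {q : x.toCGS.Q} {Z : ℕ → Prop} :
    PreAt w s q Z ↔ x.toCGS.pre A (fun q' => Z q') q := by
  refine Iff.trans ?_ x.pre_toCGS_iff.symm
  rw [PreAt, sizeAt_eq h, numLetters_eq (occursAt_encode h).1]
  unfold next
  by_cases hlt : (q : ℕ) + 1 < x.size <;> simp [hlt]

end Reading

section PolyTime

variable {Δ α : Type} [Ctx (Γ' ⊕ Δ) α] {s q : α → ℕ} (hs : PolyTime s) (hq : PolyTime q)
include hs hq

theorem polyTimePred_labelAt {p : α → ℕ} (hp : PolyTime p) :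
    PolyTimePred fun a => LabelAt (Ctx.word a) (s a) (q a) (p a) :=
  have hu := polyTimeSkip_numLetters.polyTime hs
  ((PolyTimePred.lt hq hu).and (PolyTimePred.memNthAt hs hq hp)).or
    ((PolyTimePred.lt hq hu).not.and
      (PolyTimePred.memNthAt (polyTimeSkip_periodStart.polyTime hs) (PolyTime.sub hq hu) hp))

theorem polyTimePred_preAt {Z : α → ℕ → Prop} (hZ : PolyTimePred fun c : α × ℕ => Z c.1 c.2) :
    PolyTimePred fun a => PreAt (Ctx.word a) (s a) (q a) (Z a) :=
  have hlt := PolyTimePred.lt hq.succ (polyTimeSkip_sizeAt.polyTime hs)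
  (hlt.and (PolyTime.bind hZ hq.succ)).or
    (hlt.not.and (PolyTime.bind hZ (polyTimeSkip_numLetters.polyTime hs)))

end PolyTime

/-- Ultimately periodic words, read from their encodings. -/
noncomputable def coding : Coding 0 (fun m => UPWord (Fin m)) UPWord.encode where
  toCGS x := x.toCGS
  skip w s := periodStart w (periodStart w s)
  numStates := sizeAt
  init _ _ q := q = 0
  label := LabelAt
  pre _ := PreAt
  polyTime_skip := polyTimeSkip_periodStart.comp polyTimeSkip_periodStart
  polyTime_numStates := polyTimeSkip_sizeAt
  polyTime_init _ hq := PolyTimePred.eq hq (.const 0)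
  polyTime_label hs hq hp := polyTimePred_labelAt hs hq hp
  polyTime_pre _ _ _ _ _ _ hs hq hZ := polyTimePred_preAt hs hq hZ
  skips _ := (skips_skipList fun _ _ => skips_encSubset _).append
    (skips_skipList fun _ _ => skips_encSubset _)
  numStates_le x := by
    have hu := length_le_flatMap (l := x.u) (e := encSubset) fun _ _ => encList_ne_nil
    have hv := length_le_flatMap (l := x.v) (e := encSubset) fun _ _ => encList_ne_nil
    simp only [encode, List.length_append, length_encList, size]
    omega
  numStates_eq _ _ _ h := sizeAt_eq h
  init_iff _ _ _ _ q := by rw [Finset.mem_singleton, Fin.ext_iff]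
  label_iff _ _ _ h := labelAt_iff h
  pre_iff _ _ _ h _ _ _ := preAt_iff h

end UPWord

/-! ### The length of encodings -/

theorem length_encList_eq_sum {α : Type} (e : α → List Γ') (l : List α) :
    (encList e l).length = (l.map fun x => (e x).length).sum + 2 := by
  rw [length_encList, List.length_flatMap]

theorem length_encList_finRange {n : ℕ} (e : Fin n → List Γ') :
    (encList e (List.finRange n)).length = ∑ i, (e i).length + 2 := by
  rw [length_encList_eq_sum, Fin.sum_univ_def]

theorem length_encSubset {m : ℕ} (s : Finset (Fin m)) : (encSubset s).length = m + 2 := by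
  simp [encSubset, length_encList_finRange]

theorem length_encList_encSubset {m : ℕ} (l : List (Finset (Fin m))) :
    (encList encSubset l).length = l.length * (m + 2) + 2 := by
  simp [length_encList_eq_sum, length_encSubset]

theorem UPWord.length_encode_le {m : ℕ} (x : UPWord (Fin m)) :
    x.encode.length ≤ (x.size + m + 4) ^ 2 := by
  simp only [encode, List.length_append, length_encList_encSubset, size]
  nlinarith

theorem Kripke.numStates_add_le_size {m : ℕ} (K : Kripke (Fin m)) : K.numStates + m ≤ K.size := by
  have hcard : ∑ _q : K.Q, 1 ≤ ∑ q, (K.succ q).card :=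
    Finset.sum_le_sum fun q _ => (K.succ_nonempty q).card_pos
  simpa [size] using hcard

theorem Kripke.length_encode_le {m : ℕ} (K : Kripke (Fin m)) :
    K.encode.length ≤ (K.size + m + 7) ^ 2 := by
  have hN := K.numStates_add_le_size
  simp only [encode, List.length_append, length_encList_finRange, length_encSubset, length_encNat,
    Finset.sum_const, Finset.card_univ, Fintype.card_fin, smul_eq_mul]
  nlinarith

namespace CGS

variable {k m : ℕ} (C : CGS k (Fin m))

/-- The number of pairs of a state and a joint action available there, that is, of lines of the
transition table. -/
def numMoves : ℕ := ∑ q, ∏ a, C.d q a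

theorem size_eq_numMoves_add : C.size = C.numMoves + m := by rw [size, numMoves, Fintype.card_fin]

theorem numStates_le_numMoves : C.numStates ≤ C.numMoves := by
  have hprod : ∑ _q : C.Q, 1 ≤ ∑ q, ∏ a, C.d q a :=
    Finset.sum_le_sum fun q _ => Finset.prod_pos fun a _ => C.d_pos q a
  simpa [numMoves] using hprod

theorem d_le_numMoves (q : C.Q) (a : Fin k) : C.d q a ≤ C.numMoves :=
  (Nat.le_of_dvd (Finset.prod_pos fun a _ => C.d_pos q a)
    (Finset.dvd_prod_of_mem _ (Finset.mem_univ a))).trans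
    (Finset.single_le_sum (f := fun q => ∏ a, C.d q a) (fun _ _ => Nat.zero_le _)
      (Finset.mem_univ q))

theorem length_encodeRow_le (q : C.Q) (α : (a : Fin k) → Fin (C.d q a)) :
    (C.encodeRow q α).length ≤ 2 * C.numMoves + 4 + k * (C.numMoves + 1) := by
  have hacts : ∑ a, ((α a : ℕ) + 1) ≤ ∑ _a : Fin k, (C.numMoves + 1) :=
    Finset.sum_le_sum fun a _ => Nat.add_le_add_right ((α a).2.le.trans (C.d_le_numMoves q a)) 1
  simp only [Finset.sum_const, Finset.card_univ, Fintype.card_fin, smul_eq_mul] at hacts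
  have hN := C.numStates_le_numMoves
  have hq := q.2
  have hδ := (C.δ q α).2
  simp only [encodeRow, List.length_append, length_encNat, length_encList_finRange]
  omega

theorem sum_length_actions_le :
    ∑ q, (∑ a, (C.d q a + 1) + 2) ≤ C.numMoves * (k * (C.numMoves + 1) + 2) :=
  calc ∑ q, (∑ a, (C.d q a + 1) + 2) ≤ ∑ _q : C.Q, (∑ _a : Fin k, (C.numMoves + 1) + 2) := by
        gcongr with q _ a
        exact C.d_le_numMoves q a
    _ = C.numStates * (k * (C.numMoves + 1) + 2) := by simp
    _ ≤ C.numMoves * (k * (C.numMoves + 1) + 2) := by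
        gcongr
        exact C.numStates_le_numMoves

theorem sum_length_rows_le :
    ∑ q, (∑ j : Fin (∏ a, C.d q a), (C.encodeRow q (finPiFinEquiv.symm j)).length + 2) ≤
      C.numMoves * (2 * C.numMoves + 4 + k * (C.numMoves + 1)) + 2 * C.numMoves :=
  calc _ ≤ ∑ q, (∑ _j : Fin (∏ a, C.d q a), (2 * C.numMoves + 4 + k * (C.numMoves + 1)) + 2) := by
        gcongr
        exact C.length_encodeRow_le _ _
    _ = C.numMoves * (2 * C.numMoves + 4 + k * (C.numMoves + 1)) + 2 * C.numStates := by
        simp only [Finset.sum_add_distrib, Finset.sum_const, Finset.card_univ, Fintype.card_fin,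
          smul_eq_mul, ← Finset.sum_mul, numMoves]
        ring
    _ ≤ C.numMoves * (2 * C.numMoves + 4 + k * (C.numMoves + 1)) + 2 * C.numMoves := by
        gcongr
        exact C.numStates_le_numMoves

theorem length_encode_le : C.encode.length ≤ (C.size + m + (k + 10)) ^ 3 := by
  have hN := C.numStates_le_numMoves
  have hacts := C.sum_length_actions_le
  have hrows := C.sum_length_rows_le
  have hlabels := Nat.mul_le_mul_right (m + 2) hN
  rw [size_eq_numMoves_add]
  generalize C.numMoves = s at *
  calc C.encode.length ≤ s + 1 + (s + 2) + (s * (m + 2) + 2) + (s * (k * (s + 1) + 2) + 2) +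
        (s * (2 * s + 4 + k * (s + 1)) + 2 * s + 2) := by
        simp only [encode, List.length_append, length_encList_finRange, length_encSubset,
          length_encNat, Finset.sum_const, Finset.card_univ, Fintype.card_fin, smul_eq_mul]
        omega
    _ ≤ (s + m + m + (k + 10)) ^ 3 := by
        rw [← Nat.cast_le (α := ℤ), ← sub_nonneg]
        push_cast
        ring_nf
        positivity

end CGS

theorem sum_map_le_mul {α : Type} {l : List α} {f g : α → ℕ} {b c : ℕ} (hf : ∀ x ∈ l, f x ≤ b)
    (hg : ∀ x ∈ l, 1 ≤ g x) (hc : (l.map g).sum ≤ c) : (l.map f).sum ≤ c * b :=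
  calc (l.map f).sum ≤ (l.map fun x => g x * b).sum :=
        List.sum_le_sum fun x hx => (hf x hx).trans (Nat.le_mul_of_pos_left b (hg x hx))
    _ = (l.map g).sum * b := List.sum_map_mul_right _ _ _
    _ ≤ c * b := Nat.mul_le_mul_right b hc

theorem Sample.length_encode_le {Model : ℕ → Type} {enc : {m : ℕ} → Model m → List Γ'}
    {modelSize : {m : ℕ} → Model m → ℕ} {c e : ℕ}
    (hsize : ∀ {m : ℕ} (X : Model m), 0 < m → 1 ≤ modelSize X)
    (henc : ∀ {m : ℕ} (X : Model m), (enc X).length ≤ (modelSize X + m + c) ^ e) :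
    ∃ q : Polynomial ℕ, ∀ x : Sample Model, (x.encode enc).length ≤ q.eval (x.size modelSize) := by
  refine ⟨Polynomial.X + 6 + 2 * (Polynomial.X * (Polynomial.X + Polynomial.C c) ^ e),
    fun x => ?_⟩
  obtain ⟨s, hs⟩ : ∃ s, s = x.size modelSize := ⟨_, rfl⟩
  have hsum (l : List (Model x.numProp)) (hl : (l.map modelSize).sum + x.numProp ≤ s) :
      (l.flatMap enc).length ≤ s * (s + c) ^ e := by
    rw [List.length_flatMap]
    refine sum_map_le_mul (g := modelSize) (fun X hX => (henc X).trans ?_)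
      (fun X _ => hsize X x.numProp_pos) (by omega)
    have hX := List.le_sum_of_mem (List.mem_map_of_mem (f := modelSize) hX)
    exact Nat.pow_le_pow_left (by omega) e
  have hs' := hs
  rw [Sample.size] at hs'
  have hpos := hsum x.pos (by omega)
  have hneg := hsum x.neg (by omega)
  rw [Sample.length_encode, ← hs]
  simp only [Polynomial.eval_add, Polynomial.eval_mul, Polynomial.eval_pow, Polynomial.eval_X,
    Polynomial.eval_C, Polynomial.eval_ofNat]
  omega

/-! ### Membership in NP -/

variable (Ut : Set UnOp) (Bt : Set BinTp) (Bl : Set BinLg) (n : ℕ∞)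

theorem learnable_coding_iff_exists_ltl {x : Sample fun m => UPWord (Fin m)} :
    UPWord.coding.Learnable Ut Bt Bl n x ↔ ∃ φ : LTL (Fin x.numProp), φ.InFragment Ut Bt Bl ∧
      φ.size ≤ x.bound ∧ (φ.numBin : ℕ∞) ≤ n ∧
      (∀ w ∈ x.pos, φ.Sat w.word) ∧ (∀ w ∈ x.neg, ¬ φ.Sat w.word) := by
  have hsurj : Function.Surjective (LTL.toATL (P := Fin x.numProp)) :=
    fun ψ => ⟨_, LTL.toATL_ofATL ψ⟩
  refine hsurj.exists.trans (exists_congr fun φ => ?_)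
  simp only [LTL.inFragment_toATL_iff, LTL.size_toATL, LTL.numBin_toATL]
  exact and_congr_right' (and_congr_right' (and_congr_right'
    (and_congr (forall₂_congr fun w _ => w.sat_toATL_iff φ)
      (forall₂_congr fun w _ => not_congr (w.sat_toATL_iff φ)))))

theorem ltlLearn_inNP : (LTLLearn Ut Bt Bl n).InNP :=
  UPWord.coding.inNP _ Ut Bt Bl n (fun x => x) (fun _ => rfl)
    (fun _ => (learnable_coding_iff_exists_ltl Ut Bt Bl n).symm)
    (Sample.length_encode_le (Model := fun m => UPWord (Fin m)) (modelSize := UPWord.size)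
      (fun X _ => X.size_pos) UPWord.length_encode_le)

theorem learnable_coding_iff_exists_ctl {x : Sample fun m => Kripke (Fin m)} :
    Kripke.coding.Learnable Ut Bt Bl n x ↔ ∃ φ : CTL (Fin x.numProp), φ.InFragment Ut Bt Bl ∧
      φ.size ≤ x.bound ∧ (φ.numBin : ℕ∞) ≤ n ∧
      (∀ K ∈ x.pos, K.Sat φ) ∧ (∀ K ∈ x.neg, ¬ K.Sat φ) :=
  exists_congr fun φ => and_congr_right' (and_congr_right' (and_congr_right'
    (and_congr (forall₂_congr fun _ _ => Kripke.sat_toCGS_iff φ)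
      (forall₂_congr fun _ _ => not_congr (Kripke.sat_toCGS_iff φ)))))

theorem ctlLearn_inNP : (CTLLearn Ut Bt Bl n).InNP :=
  Kripke.coding.inNP _ Ut Bt Bl n (fun x => x) (fun _ => rfl)
    (fun _ => (learnable_coding_iff_exists_ctl Ut Bt Bl n).symm)
    (Sample.length_encode_le (Model := fun m => Kripke (Fin m)) (modelSize := fun K => K.size)
      (fun K hm => hm.trans_le ((Nat.le_add_left _ _).trans K.numStates_add_le_size))
      Kripke.length_encode_le)

theorem atlLearn_inNP (k : ℕ) : (ATLLearn k Ut Bt Bl n).InNP :=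
  (CGS.coding k).inNP _ Ut Bt Bl n (fun x => x) (fun _ => rfl) (fun _ => Iff.rfl)
    (Sample.length_encode_le (Model := fun m => CGS k (Fin m)) (modelSize := fun C => C.size)
      (fun C hm => hm.trans_le ((Nat.le_add_left _ _).trans C.size_eq_numMoves_add.ge))
      CGS.length_encode_le)

end TemporalLearning

theorem mainTheorem3 (Ut : Set TemporalLearning.UnOp) (Bt : Set TemporalLearning.BinTp)
    (Bl : Set TemporalLearning.BinLg) (n : ℕ∞) :
    (TemporalLearning.LTLLearn Ut Bt Bl n).InNP ∧
    (TemporalLearning.CTLLearn Ut Bt Bl n).InNP ∧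
    ∀ k : ℕ, 1 ≤ k → (TemporalLearning.ATLLearn k Ut Bt Bl n).InNP :=
  ⟨TemporalLearning.ltlLearn_inNP Ut Bt Bl n, TemporalLearning.ctlLearn_inNP Ut Bt Bl n,
    fun k _ => TemporalLearning.atlLearn_inNP Ut Bt Bl n k⟩
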